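/- The model of computation is the (deterministic) word RAM with words of $O(\log n)$ bits, where $n$ is the size parameter of the input: arithmetic and bitwise operations on words, and memory accesses, take one step each. **3-uniform 6-hyperclique hypothesis.** The input is a 6-partite 3-uniform hypergraph $G=(V,E)$, where $V$ is the disjoint union of sets $V^{(1)},\dots,V^{(6)}$ of $n$ vertices each and every edge consists of three vertices from three different parts, given by its adjacency table. The problem is to decide whether there are $v_i\in V^{(i)}$, $i=1,\dots,6$, such that $\{v_i,v_j,v_k\}\in E$ for all distinct $i,j,k$. The hypothesis says that this requires $n^{6-o(1)}$ time: for no $\varepsilon>0$ is there an algorithm that runs in time $O(n^{6-\varepsilon})$. **Definitions.** The intersection graph of a set of triangles in the Euclidean plane has the triangles (closed and filled) as its vertices, two different triangles being adjacent if they intersect. Its diameter is the supremum of the distances between its vertices, and is infinite if the graph is disconnected. For $\alpha>0$, a (nondegenerate) triangle is $\alpha$-fat if all its angles are at least $\alpha$. For $\delta>0$, a (nondegenerate) triangle is a $\delta$-half-square if, for some $s>0$, its longest side has length in $[(\sqrt2-\delta)s,(\sqrt2+\delta)s]$ and its two other sides have lengths in $[(1-\delta)s,(1+\delta)s]$. **Theorem.**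 Assume the 3-uniform 6-hyperclique hypothesis. 1. For every fixed $\alpha\in(0,\pi/4)$ and every $\varepsilon>0$, there is no $O(n^{2-\varepsilon})$ time algorithm that decides whether the intersection graph of a given set of $n$ $\alpha$-fat triangles in the Euclidean plane has diameter at most $2$. 2. For every fixed $\delta>0$ and every $\varepsilon>0$, there is no $O(n^{2-\varepsilon})$ time algorithm that decides whether the intersection graph of a given set of $n$ $\delta$-half-squares in the Euclidean plane has diameter at most $2$. Both parts hold even if the vertices of the triangles are restricted to have natural numbers as coordinates, bounded by $n^d$ for a constant $d$ that depends only on $\alpha$, respectively on $\delta$. -/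

import Mathlib

/-! ### The word RAM -/

namespace WordRAM

/-- The arithmetic and bitwise word operations. Subtraction is truncated at zero. -/
inductive BinOp where
  | add | sub | mul | div | mod | and | or | xor | shl | shr

/-- The function computed by a word operation. -/
def BinOp.eval : BinOp → ℕ → ℕ → ℕ
  | .add, a, b => a + b
  | .sub, a, b => a - b
  | .mul, a, b => a * b
  | .div, a, b => a / b
  | .mod, a, b => a % b
  | .and, a, b => a &&& b
  | .or, a, b => a ||| b
  | .xor, a, b => a ^^^ b
  | .shl, a, b => a <<< b
  | .shr, a, b => a >>> b

/-- Random access machine programs, with structured control flow. Registers are named by natural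
numbers (a program mentions only finitely many of them). -/
inductive Program where
  /-- do nothing -/
  | skip
  /-- `r := v` for a fixed constant `v` -/
  | const (r v : ℕ)
  /-- `r := a ∘ b` for registers `r`, `a`, `b` -/
  | op (o : BinOp) (r a b : ℕ)
  /-- `r := memory[a]`, where the register `a` holds the address -/
  | load (r a : ℕ)
  /-- `memory[a] := r`, where the register `a` holds the address -/
  | store (a r : ℕ)
  /-- first `p`, then `q` -/
  | seq (p q : Program)
  /-- if register `r` is nonzero then `p` else `q` -/
  | ite (r : ℕ) (p q : Program)
  /-- while register `r` is nonzero do `p` -/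
  | loop (r : ℕ) (p : Program)

/-- A state of the machine: the contents of the registers and of the memory. -/
@[ext]
structure State where
  reg : ℕ → ℕ
  mem : ℕ → ℕ

/-- `s.set r v` is the state `s` with the value `v` written to register `r`. -/
def State.set (s : State) (r v : ℕ) : State := ⟨Function.update s.reg r v, s.mem⟩

/-- `s.write a v` is the state `s` with the value `v` written to memory cell `a`. -/
def State.write (s : State) (a v : ℕ) : State := ⟨s.reg, Function.update s.mem a v⟩

/-- `Exec B p s t s'`: on a machine whose words hold the numbers `0, …, B - 1`, the program `p`,
started in the state `s`, halts after exactly `t` steps in the state `s'`. Every instruction and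
every test of a branch or loop costs one step. An instruction that computes a number which does
not fit into a word has no execution, so a run in the sense of `Exec` never overflows. -/
inductive Exec (B : ℕ) : Program → State → ℕ → State → Prop where
  | skip (s : State) : Exec B .skip s 1 s
  | const (s : State) (r v : ℕ) (hv : v < B) : Exec B (.const r v) s 1 (s.set r v)
  | op (s : State) (o : BinOp) (r a b : ℕ) (hv : o.eval (s.reg a) (s.reg b) < B) :
      Exec B (.op o r a b) s 1 (s.set r (o.eval (s.reg a) (s.reg b)))
  | load (s : State) (r a : ℕ) : Exec B (.load r a) s 1 (s.set r (s.mem (s.reg a)))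
  | store (s : State) (a r : ℕ) : Exec B (.store a r) s 1 (s.write (s.reg a) (s.reg r))
  | seq {p q : Program} {s₁ s₂ s₃ : State} {t₁ t₂ : ℕ}
      (h₁ : Exec B p s₁ t₁ s₂) (h₂ : Exec B q s₂ t₂ s₃) : Exec B (.seq p q) s₁ (t₁ + t₂) s₃
  | ite_true {r : ℕ} {p q : Program} {s s' : State} {t : ℕ} (hr : s.reg r ≠ 0)
      (h : Exec B p s t s') : Exec B (.ite r p q) s (t + 1) s'
  | ite_false {r : ℕ} {p q : Program} {s s' : State} {t : ℕ} (hr : s.reg r = 0)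
      (h : Exec B q s t s') : Exec B (.ite r p q) s (t + 1) s'
  | loop_done {r : ℕ} {p : Program} {s : State} (hr : s.reg r = 0) : Exec B (.loop r p) s 1 s
  | loop_step {r : ℕ} {p : Program} {s₁ s₂ s₃ : State} {t₁ t₂ : ℕ} (hr : s₁.reg r ≠ 0)
      (h₁ : Exec B p s₁ t₁ s₂) (h₂ : Exec B (.loop r p) s₂ t₂ s₃) :
      Exec B (.loop r p) s₁ (t₁ + t₂ + 1) s₃

/-- A decision problem: the instances of each size `n`, the memory contents that present an
instance to the machine, and the instances whose answer is yes. -/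
structure Problem where
  Inst : ℕ → Type
  input : {n : ℕ} → Inst n → ℕ → ℕ
  Yes : {n : ℕ} → Inst n → Prop

/-- The initial state on an instance of size `n`: register `0` holds `n`, all other registers
hold `0`, and the memory holds the instance. -/
def Problem.init (Q : Problem) {n : ℕ} (x : Q.Inst n) : State :=
  ⟨fun r => if r = 0 then n else 0, Q.input x⟩

/-- `Q` has an algorithm with running time `O(n ^ e)` on the word RAM with words of `O(log n)`
bits: on every instance of size `n ≥ 1` the program halts within `K * n ^ e` steps, uses only
words below `(n + 2) ^ c`, and leaves `1` in register `0` exactly if the answer is yes. -/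
def Problem.SolvableInTime (Q : Problem) (e : ℝ) : Prop :=
  ∃ (P : Program) (c : ℕ) (K : ℝ), ∀ n : ℕ, 1 ≤ n → ∀ x : Q.Inst n,
    ∃ (t : ℕ) (s : State), Exec ((n + 2) ^ c) P (Q.init x) t s ∧
      (t : ℝ) ≤ K * (n : ℝ) ^ e ∧ (s.reg 0 = 1 ↔ Q.Yes x)

end WordRAM

/-! ### The 3-uniform 6-hyperclique problem -/

/-- A 6-partite 3-uniform hypergraph whose `i`-th part consists of the `n` vertices `(i, a)`:
every edge consists of three vertices from pairwise different parts. -/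
structure SixPartiteHypergraph (n : ℕ) where
  edges : Set (Finset (Fin 6 × Fin n))
  card_eq : ∀ e ∈ edges, e.card = 3
  partite : ∀ e ∈ edges, Set.InjOn Prod.fst (e : Set (Fin 6 × Fin n))

namespace SixPartiteHypergraph

variable {n : ℕ}

/-- `v 0, …, v 5` select one vertex from each part; they form a hyperclique if any three of
them form an edge. -/
def HasHyperclique (G : SixPartiteHypergraph n) : Prop :=
  ∃ v : Fin 6 → Fin n, ∀ i j k : Fin 6, i ≠ j → i ≠ k → j ≠ k →
    ({(i, v i), (j, v j), (k, v k)} : Finset (Fin 6 × Fin n)) ∈ G.edges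

/-- The number of a vertex, between `0` and `6 * n - 1`. -/
def vertexIndex (u : Fin 6 × Fin n) : ℕ := u.1 * n + u.2

open Classical in
/-- The adjacency table of the hypergraph, a `6n × 6n × 6n` array of bits in row-major order. -/
noncomputable def table (G : SixPartiteHypergraph n) (m : ℕ) : ℕ :=
  if ∃ u v w : Fin 6 × Fin n, ({u, v, w} : Finset (Fin 6 × Fin n)) ∈ G.edges ∧
      m = (vertexIndex u * (6 * n) + vertexIndex v) * (6 * n) + vertexIndex w
  then 1 else 0

end SixPartiteHypergraph

/-- The problem of deciding whether a 6-partite 3-uniform hypergraph has a 6-hyperclique. The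
size of an instance is the number of vertices in each part. -/
noncomputable def hypercliqueProblem : WordRAM.Problem where
  Inst := SixPartiteHypergraph
  input := fun G => G.table
  Yes := fun G => G.HasHyperclique

/-- The 3-uniform 6-hyperclique hypothesis: the problem requires time `n ^ (6 - o(1))`, that is,
for no `ε > 0` does it have an algorithm with running time `O(n ^ (6 - ε))`. -/
def HypercliqueHypothesis : Prop :=
  ∀ ε : ℝ, 0 < ε → ¬ hypercliqueProblem.SolvableInTime (6 - ε)

/-! ### Triangles in the Euclidean plane -/

/-- The Euclidean plane. -/
abbrev Plane : Type := EuclideanSpace ℝ (Fin 2)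

/-- A triangle with vertices `p 0, p 1, p 2` is a `δ`-half-square if for some `s > 0` its longest
side has length in `[(√2 - δ) s, (√2 + δ) s]` and its other two sides have lengths in
`[(1 - δ) s, (1 + δ) s]`. Here `p i` and `p j` are the endpoints of the longest side. -/
def IsHalfSquare (δ : ℝ) (p : Fin 3 → Plane) : Prop :=
  ∃ s : ℝ, 0 < s ∧ ∃ i j k : Fin 3, i ≠ j ∧ i ≠ k ∧ j ≠ k ∧
    dist (p i) (p k) ≤ dist (p i) (p j) ∧ dist (p j) (p k) ≤ dist (p i) (p j) ∧
    dist (p i) (p j) ∈ Set.Icc ((√2 - δ) * s) ((√2 + δ) * s) ∧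
    dist (p i) (p k) ∈ Set.Icc ((1 - δ) * s) ((1 + δ) * s) ∧
    dist (p j) (p k) ∈ Set.Icc ((1 - δ) * s) ((1 + δ) * s)

/-- A triangle with vertices `p 0, p 1, p 2` is `α`-fat if all its angles are at least `α`. -/
def IsFatTriangle (α : ℝ) (p : Fin 3 → Plane) : Prop :=
  ∀ i j k : Fin 3, i ≠ j → i ≠ k → j ≠ k → α ≤ EuclideanGeometry.angle (p i) (p j) (p k)

/-- A set of `n` (nondegenerate, pairwise different) triangles of a given shape, listed in some
order. The coordinates of the vertices are natural numbers not exceeding `n ^ d`. -/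
structure TriangleSet (shape : (Fin 3 → Plane) → Prop) (d n : ℕ) where
  /-- `coord i j` are the two coordinates of the `j`-th vertex of the `i`-th triangle. -/
  coord : Fin n → Fin 3 → Fin 2 → ℕ
  coord_le : ∀ i j l, coord i j l ≤ n ^ d
  nondegenerate : ∀ i, AffineIndependent ℝ (fun j => (!₂[(coord i j 0 : ℝ), coord i j 1] : Plane))
  shape_of : ∀ i, shape (fun j => !₂[(coord i j 0 : ℝ), coord i j 1])
  distinct : Function.Injective fun i =>
    convexHull ℝ (Set.range fun j => (!₂[(coord i j 0 : ℝ), coord i j 1] : Plane))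

namespace TriangleSet

variable {shape : (Fin 3 → Plane) → Prop} {d n : ℕ}

/-- The vertices of the `i`-th triangle. -/
noncomputable def vertex (T : TriangleSet shape d n) (i : Fin n) (j : Fin 3) : Plane :=
  !₂[(T.coord i j 0 : ℝ), T.coord i j 1]

/-- The `i`-th triangle as a (closed, filled) subset of the plane. -/
noncomputable def region (T : TriangleSet shape d n) (i : Fin n) : Set Plane :=
  convexHull ℝ (Set.range (T.vertex i))

/-- The intersection graph: two different triangles are adjacent if they intersect. -/
def intersectionGraph (T : TriangleSet shape d n) : SimpleGraph (Fin n) where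
  Adj i j := i ≠ j ∧ (T.region i ∩ T.region j).Nonempty
  symm := ⟨fun _ _ h => ⟨h.1.symm, by rw [Set.inter_comm]; exact h.2⟩⟩
  loopless := ⟨fun _ h => h.1 rfl⟩

/-- The list of all coordinates, six consecutive words for each triangle. -/
def words (T : TriangleSet shape d n) (m : ℕ) : ℕ :=
  if h : m / 6 < n then
    T.coord ⟨m / 6, h⟩ ⟨m % 6 / 2, by omega⟩ ⟨m % 2, by omega⟩
  else 0

end TriangleSet

/-- The problem of deciding whether the intersection graph of `n` given triangles of a given
shape, whose vertices lie on the integer grid `{0, …, n ^ d}²`, has diameter at most 2. -/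
noncomputable def diameterTwoProblem (shape : (Fin 3 → Plane) → Prop) (d : ℕ) :
    WordRAM.Problem where
  Inst := TriangleSet shape d
  input := fun T => T.words
  Yes := fun T => T.intersectionGraph.ediam ≤ 2

/-! ### Executions under a change of word size, and updates of states. -/

namespace WordRAM

/-! A hypergraph with `n` vertices in each part is turned, in time `O(n ^ 3)`, into `N = 20 * n ^ 3
+ 2` triangles whose intersection graph has diameter greater than 2 exactly if there is a
hyperclique. For `ε ≤ 1`, which is no restriction, an `O(N ^ (2 - ε))` algorithm for the diameter
would thus solve the hyperclique problem in time `O(n ^ (6 - 3 * ε))`, against the hypothesis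
(`solvableInTime_of_reduction`).

Combinatorics (`ediam_triangles_le_two_iff`). Every edge in parts 0, 1, 2 gives a small triangle on
the right, every edge in parts 3, 4, 5 one on the left; right and left small triangles are disjoint.
Every non-edge with vertices on both sides gives a large triangle; it meets a right and a left small
triangle simultaneously exactly if their two labels together extend the non-edge. The hubs on each
side meet everything except the small triangles of the other side, so they bring all pairs within
distance 2 except perhaps a right and a left small triangle. A common neighbour of such a pair must
be a large triangle, that is, a non-edge among the six labelled vertices; it is missing exactly if
they form a hyperclique. Triples that yield no triangle are replaced by further right hubs, which
keeps `N` independent of the hypergraph and creates no new path from right to left.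

Geometry (`meet_small_large_iff`). Each end of a large triangle has to select the small triangles
whose label has one or two prescribed digits. Any one or two of three digits are the leading digits
of a cyclic shift of the label, so the selected labels form an interval of one of the three shifts.
Accordingly each shift is encoded as a perturbation of one vertex of the small triangle, and the
large triangle touches the vertex that belongs to the shift in question. At each vertex two linear
conditions on the perturbations decide about the contact, one for each end of the interval. The
edges are tilted by a relative amount of order `1 / k` against the directions of an exact
half-square; without the tilt some perturbations would move a vertex along an edge and remain
invisible.

The scales `E`, `T = 100 * E ^ 2`, `U = T ^ 2`, `S = k * U` are so far apart that the signed area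
deciding a contact is a large factor times an integer linear form, up to a smaller error. The forms
evaluate to multiples of odd integers, hence never to zero, and their sign decides. The
intersections are certified by barycentric coordinates, the disjointness by separating lines.

All triangles are half-squares up to a relative error of order `1 / k`, so a large constant `k`
gives any prescribed quality `δ`. Half-squares of good quality are `α`-fat for `α < π / 4` by the
law of cosines and continuity, which reduces the first part to the second. -/

theorem Exec.mono {B B' : ℕ} (h : B ≤ B') {p : Program} {s s' : State} {t : ℕ}
    (e : Exec B p s t s') : Exec B' p s t s' := by
  induction e with
  | skip s => exact .skip s
  | const s r v hv => exact .const s r v (hv.trans_le h)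
  | op s o r a b hv => exact .op s o r a b (hv.trans_le h)
  | load s r a => exact .load s r a
  | store s a r => exact .store s a r
  | seq _ _ h₁ h₂ => exact .seq h₁ h₂
  | ite_true hr _ h₁ => exact .ite_true hr h₁
  | ite_false hr _ h₁ => exact .ite_false hr h₁
  | loop_done hr => exact .loop_done hr
  | loop_step hr _ _ h₁ h₂ => exact .loop_step hr h₁ h₂

@[simp] theorem State.set_mem (s : State) (r v : ℕ) : (s.set r v).mem = s.mem := rfl

@[simp] theorem State.set_reg (s : State) (r v q : ℕ) :
    (s.set r v).reg q = if q = r then v else s.reg q := by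
  simp [State.set, Function.update_apply]

@[simp] theorem State.write_mem (s : State) (a v : ℕ) :
    (s.write a v).mem = Function.update s.mem a v := rfl

@[simp] theorem State.write_reg (s : State) (a v : ℕ) : (s.write a v).reg = s.reg := rfl

/-! ### Arithmetic expressions and their compilation -/

/-- The word operations that keep polynomially bounded numbers polynomially bounded. -/
inductive Arith where
  | add | sub | mul | div | mod

/-- The word operation of an arithmetic operation. -/
def Arith.toBinOp : Arith → BinOp
  | .add => .add
  | .sub => .sub
  | .mul => .mul
  | .div => .div
  | .mod => .mod

/-- Expressions in the size `n` of the instance, a loop index and the bits stored in memory. -/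
inductive Expr where
  | size
  | index
  | const (v : ℕ)
  | op (o : Arith) (a b : Expr)
  | bit (a : Expr)

namespace Expr

/-- The value of an expression. -/
def eval (n i : ℕ) (mem : ℕ → ℕ) : Expr → ℕ
  | size => n
  | index => i
  | const v => v
  | op o a b => o.toBinOp.eval (a.eval n i mem) (b.eval n i mem)
  | bit a => mem (a.eval n i mem) % 2

/-- The degree of a polynomial bound for the value of an expression. -/
def deg : Expr → ℕ
  | size => 1
  | index => 1
  | const v => v + 1
  | op _ a b => a.deg + b.deg + 1
  | bit a => a.deg + 1

/-- The number of steps of the compiled expression. -/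
def cost : Expr → ℕ
  | size => 1
  | index => 1
  | const _ => 1
  | op _ a b => a.cost + (b.cost + 1)
  | bit a => a.cost + (1 + (1 + 1))

/-- The number of registers used by the compiled expression. -/
def width : Expr → ℕ
  | size => 1
  | index => 1
  | const _ => 1
  | op _ a b => a.width + b.width + 1
  | bit a => a.width + 2

/-- A program that leaves the value of the expression in register `r`, using registers from `r`
on. Register `0` holds the size and register `1` the loop index. -/
def compile : Expr → ℕ → Program
  | size, r => .op .and r 0 0
  | index, r => .op .and r 1 1
  | const v, r => .const r v
  | op o a b, r => .seq (a.compile r) (.seq (b.compile (r + 1)) (.op o.toBinOp r r (r + 1)))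
  | bit a, r => .seq (a.compile r) (.seq (.load r r) (.seq (.const (r + 1) 2)
      (.op .mod r r (r + 1))))

/-- Each operation costs at most one more factor `X ≥ 2`, sums being the critical case. A constant
`v` is below `2 ^ v`, which explains its degree. Bits are reduced modulo 2, so no bound on the
memory is needed. -/
theorem eval_lt_pow {n i X : ℕ} (hX : 2 ≤ X) (hn : n < X) (hi : i < X) (mem : ℕ → ℕ) (e : Expr) :
    e.eval n i mem < X ^ e.deg := by
  induction e with
  | size => simpa [eval, deg] using hn
  | index => simpa [eval, deg] using hi
  | const v =>
    calc v < 2 ^ v := Nat.lt_two_pow_self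
      _ ≤ X ^ v := Nat.pow_le_pow_left hX v
      _ ≤ X ^ (v + 1) := Nat.pow_le_pow_right (by omega) (by omega)
  | op o a b ha hb =>
    have h₁ : X ^ a.deg ≤ X ^ (a.deg + b.deg) := Nat.pow_le_pow_right (by omega) (by omega)
    have h₂ : X ^ b.deg ≤ X ^ (a.deg + b.deg) := Nat.pow_le_pow_right (by omega) (by omega)
    have h₃ : 2 * X ^ (a.deg + b.deg) ≤ X ^ (a.deg + b.deg + 1) := by
      rw [pow_succ, mul_comm]; exact Nat.mul_le_mul_left _ hX
    simp only [eval, deg]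
    cases o with
    | add => simp only [Arith.toBinOp, BinOp.eval]; omega
    | sub => simp only [Arith.toBinOp, BinOp.eval]; omega
    | mul =>
      simp only [Arith.toBinOp, BinOp.eval]
      have := Nat.mul_lt_mul'' ha hb
      rw [← pow_add] at this
      omega
    | div =>
      simp only [Arith.toBinOp, BinOp.eval]
      have := Nat.div_le_self (a.eval n i mem) (b.eval n i mem)
      omega
    | mod =>
      simp only [Arith.toBinOp, BinOp.eval]
      have := Nat.mod_le (a.eval n i mem) (b.eval n i mem)
      omega
  | bit a _ =>
    calc mem (a.eval n i mem) % 2 < 2 := Nat.mod_lt _ (by norm_num)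
      _ ≤ X := hX
      _ = X ^ 1 := (pow_one X).symm
      _ ≤ X ^ (a.deg + 1) := Nat.pow_le_pow_right (by omega) (by omega)

/-- Registers serve as a stack: the first operand stays in `r` while the second is computed from `r
+ 1` on. The clause about high registers is what later allows every used register to be reset. -/
theorem exec_compile {n i X B : ℕ} (hX : 2 ≤ X) (hn : n < X) (hi : i < X) (e : Expr) :
    ∀ (r : ℕ) (s : State), 2 ≤ r → X ^ e.deg ≤ B → s.reg 0 = n → s.reg 1 = i →
      ∃ s', Exec B (e.compile r) s e.cost s' ∧ s'.mem = s.mem ∧ s'.reg r = e.eval n i s.mem ∧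
        (∀ q < r, s'.reg q = s.reg q) ∧ ∀ q, r + e.width ≤ q → s'.reg q = s.reg q := by
  induction e with
  | size =>
    intro r s hr hB h0 _
    refine ⟨s.set r n, ?_, rfl, by simp [eval], fun q hq => ?_, fun q hq => ?_⟩
    -- There is no move instruction; the bitwise "and" of a register with itself copies it.
    · have := Exec.op (B := B) s .and r 0 0 (by simp [BinOp.eval, h0]; simp [deg] at hB; omega)
      rw [show BinOp.and.eval (s.reg 0) (s.reg 0) = n by simp [BinOp.eval, h0]] at this
      exact this
    · simp [hq.ne]
    · simp only [width] at hq; simp [show q ≠ r by omega]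
  | index =>
    intro r s hr hB _ h1
    refine ⟨s.set r i, ?_, rfl, by simp [eval], fun q hq => ?_, fun q hq => ?_⟩
    · have := Exec.op (B := B) s .and r 1 1 (by simp [BinOp.eval, h1]; simp [deg] at hB; omega)
      rw [show BinOp.and.eval (s.reg 1) (s.reg 1) = i by simp [BinOp.eval, h1]] at this
      exact this
    · simp [hq.ne]
    · simp only [width] at hq; simp [show q ≠ r by omega]
  | const v =>
    intro r s hr hB _ _
    refine ⟨s.set r v, .const s r v ?_, rfl, by simp [eval], fun q hq => ?_, fun q hq => ?_⟩
    · exact (eval_lt_pow hX hn hi s.mem (.const v)).trans_le hB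
    · simp [hq.ne]
    · simp only [width] at hq; simp [show q ≠ r by omega]
  | op o a b ha hb =>
    intro r s hr hB h0 h1
    have hBa : X ^ a.deg ≤ B := (Nat.pow_le_pow_right (by omega) (by simp [deg]; omega)).trans hB
    have hBb : X ^ b.deg ≤ B := (Nat.pow_le_pow_right (by omega) (by simp [deg]; omega)).trans hB
    obtain ⟨s₁, e₁, m₁, v₁, l₁, u₁⟩ := ha r s hr hBa h0 h1
    obtain ⟨s₂, e₂, m₂, v₂, l₂, u₂⟩ := hb (r + 1) s₁ (by omega) hBb
      (by rw [l₁ 0 (by omega), h0]) (by rw [l₁ 1 (by omega), h1])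
    have hv : o.toBinOp.eval (s₂.reg r) (s₂.reg (r + 1)) = (op o a b).eval n i s.mem := by
      rw [l₂ r (by omega), v₁, v₂, m₁]; rfl
    refine ⟨_, .seq e₁ (.seq e₂ (.op s₂ _ _ _ _ ?_)), ?_, ?_, fun q hq => ?_, fun q hq => ?_⟩
    · rw [hv]; exact (eval_lt_pow hX hn hi s.mem _).trans_le hB
    · simp [m₂, m₁]
    · simp [hv]
    · simp [hq.ne, l₂ q (by omega), l₁ q hq]
    · simp only [width] at hq
      simp [show q ≠ r by omega, u₂ q (by omega), u₁ q (by omega)]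
  | bit a ha =>
    intro r s hr hB h0 h1
    have hBa : X ^ a.deg ≤ B := (Nat.pow_le_pow_right (by omega) (by simp [deg])).trans hB
    have hB2 : X * X ^ a.deg ≤ B := by rw [mul_comm, ← pow_succ]; exact hB
    have hpos := (eval_lt_pow hX hn hi s.mem a)
    obtain ⟨s₁, e₁, m₁, v₁, l₁, u₁⟩ := ha r s hr hBa h0 h1
    have hX3 : 2 ≤ B := by nlinarith
    have ha0 : a.deg ≠ 0 := by cases a <;> simp [deg]
    have hB3 : 2 < B := by
      have : X ^ 1 ≤ X ^ a.deg := Nat.pow_le_pow_right (by omega) (by omega)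
      nlinarith
    refine ⟨_, .seq e₁ (.seq (.load s₁ r r) (.seq (.const _ (r + 1) 2 hB3)
      (.op _ .mod r r (r + 1) ?_))), ?_, ?_, fun q hq => ?_, fun q hq => ?_⟩
    · simp only [BinOp.eval, State.set_reg]
      simp only [if_true, show r ≠ r + 1 by omega, if_false]
      exact (Nat.mod_lt _ (by norm_num)).trans_le hX3
    · simp [m₁]
    · simp [BinOp.eval, eval, v₁, m₁]
    · simp [hq.ne, show q ≠ r + 1 by omega, l₁ q hq]
    · simp only [width] at hq
      simp [show q ≠ r by omega, show q ≠ r + 1 by omega, u₁ q (by omega)]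

/-- The expression with all memory accesses moved by `F`. -/
def shift : Expr → Expr → Expr
  | size, _ => size
  | index, _ => index
  | const v, _ => const v
  | op o a b, F => op o (a.shift F) (b.shift F)
  | bit a, F => bit (op .add F (a.shift F))

/-- The output is written over the input, so it has to be computed from a copy of the input at an
offset `f`. -/
theorem shift_eval (n i f : ℕ) (mem : ℕ → ℕ) (F : Expr) (hF : F.eval n i mem = f) (e : Expr) :
    (e.shift F).eval n i mem = e.eval n i fun a => mem (f + a) := by
  induction e with
  | size => rfl
  | index => rfl
  | const v => rfl
  | op o a b ha hb => simp only [shift, eval, ha, hb]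
  | bit a ha => simp only [shift, eval, ha, hF]; rfl

end Expr

/-! ### Loops that fill the memory -/

/-- The body of the loop in `fill`. -/
def fillBody (addr val : Expr) : Program :=
  .seq (addr.compile 3) (.seq (val.compile 4) (.seq (.store 3 4) (.seq (.const 3 1)
    (.seq (.op .add 1 1 3) (.op .sub 2 2 3)))))

/-- For `i = 0, …, cnt - 1` store `val` at the address `addr`. -/
def fill (cnt addr val : Expr) : Program :=
  .seq (.const 1 0) (.seq (cnt.compile 2) (.loop 2 (fillBody addr val)))

/-- All registers used by `fill` are below this number. -/
def fillWidth (cnt addr val : Expr) : ℕ := cnt.width + addr.width + val.width + 5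

theorem exec_fillBody {n i X B : ℕ} (hX : 2 ≤ X) (hn : n < X) (hi : i + 1 < X) (addr val : Expr)
    (hB : X ≤ B) (hBa : X ^ addr.deg ≤ B) (hBv : X ^ val.deg ≤ B) (s : State)
    (h0 : s.reg 0 = n) (h1 : s.reg 1 = i) (h2 : s.reg 2 < X) :
    ∃ s', Exec B (fillBody addr val) s (addr.cost + val.cost + 4) s' ∧
      s'.mem = Function.update s.mem (addr.eval n i s.mem) (val.eval n i s.mem) ∧
      s'.reg 0 = n ∧ s'.reg 1 = i + 1 ∧ s'.reg 2 = s.reg 2 - 1 ∧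
      ∀ q, addr.width + val.width + 5 ≤ q → s'.reg q = s.reg q := by
  obtain ⟨s₁, e₁, m₁, v₁, l₁, u₁⟩ := addr.exec_compile hX hn (by omega : i < X) 3 s (by omega)
    hBa h0 h1
  obtain ⟨s₂, e₂, m₂, v₂, l₂, u₂⟩ := val.exec_compile hX hn (by omega : i < X) 4 s₁ (by omega)
    hBv (by rw [l₁ 0 (by omega), h0]) (by rw [l₁ 1 (by omega), h1])
  have a0 : s₂.reg 0 = n := by rw [l₂ 0 (by omega), l₁ 0 (by omega), h0]
  have a1 : s₂.reg 1 = i := by rw [l₂ 1 (by omega), l₁ 1 (by omega), h1]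
  have a2 : s₂.reg 2 = s.reg 2 := by rw [l₂ 2 (by omega), l₁ 2 (by omega)]
  have a3 : s₂.reg 3 = addr.eval n i s.mem := by rw [l₂ 3 (by omega), v₁]
  -- Once the address in register 3 has been used by the store, the register is reused for the
  -- constant 1 by which both counters change.
  refine ⟨⟨fun q => if q = 2 then s.reg 2 - 1 else if q = 1 then i + 1 else
        if q = 3 then 1 else s₂.reg q,
      Function.update s.mem (addr.eval n i s.mem) (val.eval n i s.mem)⟩, ?_, ?_, ?_, ?_, ?_, ?_⟩
  · have e := Exec.seq e₁ (.seq e₂ (.seq (.store s₂ 3 4) (.seq (.const _ 3 1 (by omega : 1 < B))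
      (.seq (.op _ .add 1 1 3 ?_) (.op _ .sub 2 2 3 ?_)))))
    · convert e using 1
      · rfl
      · ring
      · ext q
        · simp [BinOp.eval, a1, a2]
        · simp [a3, v₂, m₂, m₁]
    · simp [BinOp.eval, a1]; omega
    · simp [BinOp.eval, a2]; omega
  · rfl
  · simp [a0]
  · simp
  · simp
  · intro q hq
    simp [show q ≠ 2 by omega, show q ≠ 1 by omega, show q ≠ 3 by omega, u₂ q (by omega),
      u₁ q (by omega)]

/-- The sequence `Mem` prescribes the memory before each round, which reduces the correctness of a
loop to an identity between consecutive members. The induction is on the number `d` of remaining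
rounds. -/
theorem exec_fillLoop {n X B : ℕ} (hX : 2 ≤ X) (hn : n < X) (addr val : Expr)
    (hB : X ≤ B) (hBa : X ^ addr.deg ≤ B) (hBv : X ^ val.deg ≤ B) (Mem : ℕ → ℕ → ℕ) (c : ℕ)
    (hc : c < X)
    (hMem : ∀ i < c, Mem (i + 1) =
      Function.update (Mem i) (addr.eval n i (Mem i)) (val.eval n i (Mem i))) :
    ∀ (d i : ℕ) (s : State), i + d = c → s.reg 0 = n → s.reg 1 = i → s.reg 2 = d →
      s.mem = Mem i →
      ∃ s', Exec B (.loop 2 (fillBody addr val)) s (d * (addr.cost + val.cost + 5) + 1) s' ∧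
        s'.mem = Mem c ∧ s'.reg 0 = n ∧
        ∀ q, addr.width + val.width + 5 ≤ q → s'.reg q = s.reg q := by
  intro d
  induction d with
  | zero =>
    intro i s hi h0 _ h2 hm
    exact ⟨s, by simpa using Exec.loop_done (B := B) h2, by rw [hm, ← hi, add_zero], h0,
      fun _ _ => rfl⟩
  | succ d ih =>
    intro i s hi h0 h1 h2 hm
    obtain ⟨s₁, e₁, m₁, r0, r1, r2, u₁⟩ := exec_fillBody hX hn (by omega : i + 1 < X) addr val hB
      hBa hBv s h0 h1 (by omega)
    obtain ⟨s₂, e₂, m₂, q0, u₂⟩ := ih (i + 1) s₁ (by omega) r0 r1 (by omega)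
      (by rw [m₁, hm, hMem i (by omega)])
    refine ⟨s₂, ?_, m₂, q0, fun q hq => by rw [u₂ q hq, u₁ q hq]⟩
    convert Exec.loop_step (by omega) e₁ e₂ using 1
    ring

theorem exec_fill {n X B : ℕ} (hX : 2 ≤ X) (hn : n < X) (cnt addr val : Expr)
    (hB : X ≤ B) (hBc : X ^ cnt.deg ≤ B) (hBa : X ^ addr.deg ≤ B) (hBv : X ^ val.deg ≤ B)
    (Mem : ℕ → ℕ → ℕ) (hc : cnt.eval n 0 (Mem 0) < X)
    (hMem : ∀ i < cnt.eval n 0 (Mem 0), Mem (i + 1) =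
      Function.update (Mem i) (addr.eval n i (Mem i)) (val.eval n i (Mem i)))
    (s : State) (h0 : s.reg 0 = n) (hm : s.mem = Mem 0) :
    ∃ s', Exec B (fill cnt addr val) s
        (1 + (cnt.cost + (cnt.eval n 0 (Mem 0) * (addr.cost + val.cost + 5) + 1))) s' ∧
      s'.mem = Mem (cnt.eval n 0 (Mem 0)) ∧ s'.reg 0 = n ∧
      ∀ q, fillWidth cnt addr val ≤ q → s'.reg q = s.reg q := by
  obtain ⟨s₁, e₁, m₁, v₁, l₁, u₁⟩ := cnt.exec_compile hX hn (by omega : 0 < X) 2 (s.set 1 0)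
    le_rfl hBc (by simp [h0]) (by simp)
  obtain ⟨s₂, e₂, m₂, r0, u₂⟩ := exec_fillLoop hX hn addr val hB hBa hBv Mem _ hc hMem
    (cnt.eval n 0 (Mem 0)) 0 s₁ (by omega) (by rw [l₁ 0 (by omega)]; simp [h0])
    (by rw [l₁ 1 (by omega)]; simp) (by rw [v₁]; simp [hm]) (by rw [m₁]; simp [hm])
  refine ⟨s₂, .seq (.const s 1 0 (by omega)) (.seq e₁ e₂), m₂, r0, fun q hq => ?_⟩
  simp only [fillWidth] at hq
  rw [u₂ q (by omega), u₁ q (by omega)]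
  simp [show q ≠ 1 by omega]

/-- Set the registers `1, …, w` to zero. -/
def clear : ℕ → Program
  | 0 => .skip
  | w + 1 => .seq (clear w) (.const (w + 1) 0)

theorem exec_clear {B : ℕ} (hB : 0 < B) (s : State) (w : ℕ) :
    Exec B (clear w) s (w + 1)
      ⟨fun q => if 1 ≤ q ∧ q ≤ w then 0 else s.reg q, s.mem⟩ := by
  induction w with
  | zero =>
    rw [show (⟨fun q => if 1 ≤ q ∧ q ≤ 0 then 0 else s.reg q, s.mem⟩ : State) = s from
      State.ext (funext fun q => if_neg (by omega)) rfl]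
    exact Exec.skip s
  | succ w ih =>
    rw [show (⟨fun q => if 1 ≤ q ∧ q ≤ w + 1 then 0 else s.reg q, s.mem⟩ : State) =
      State.set ⟨fun q => if 1 ≤ q ∧ q ≤ w then 0 else s.reg q, s.mem⟩ (w + 1) 0 from by
        ext q
        · simp only [State.set_reg]
          split_ifs <;> first | rfl | omega
        · rfl]
    exact Exec.seq ih (.const _ (w + 1) 0 hB)

end WordRAM

/-! ### In-place transformation of instances, and reductions. -/

namespace WordRAM

/-- The program that replaces an instance of a problem, stored in the first `len` cells of the
memory, by the `out` words computed by `val`, and the size by the value of `sz`. -/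
def transform (len out sz val : Expr) : Program :=
  .seq (fill len (.op .add (.op .add len out) .index) (.bit .index))
    (.seq (fill out .index (val.shift (.op .add len out)))
      (.seq (fill (.op .add len len) (.op .add out .index) (.const 0))
        (.seq (.const 1 0) (.seq (sz.compile 2) (.seq (.op .and 0 2 2)
          (clear (fillWidth len (.op .add (.op .add len out) .index) (.bit .index) +
            fillWidth out .index (val.shift (.op .add len out)) +
            fillWidth (.op .add len len) (.op .add out .index) (.const 0) + sz.width + 2)))))))

/-- A number `d` such that `transform` computes only with numbers below `X ^ d`, where `X` is a
bound for its loop indices. -/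
def transformDeg (len out sz val : Expr) : ℕ :=
  2 * len.deg + 2 * out.deg + sz.deg + (val.shift (.op .add len out)).deg + 10

/-- An output word may depend on any input bit, so the input is first copied behind the space for
the output and the input. Then the output overwrites the original, the remains are erased, and the
registers are reset: the final state has to be literally an initial state of the other problem. -/
theorem exec_transform (len out sz val : Expr) : ∃ K : ℕ, ∀ (n l o N X B : ℕ)
    (input : ℕ → ℕ), 2 ≤ X → n < X → 2 * l + o < X → N < X →
    X ^ transformDeg len out sz val ≤ B →
    (∀ i mem, len.eval n i mem = l) → (∀ i mem, out.eval n i mem = o) →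
    (∀ i mem, sz.eval n i mem = N) →
    (∀ m, input m < 2) → (∀ m, l ≤ m → input m = 0) →
    ∃ t, t ≤ K * (l + o + 1) ∧ Exec B (transform len out sz val)
      ⟨fun r => if r = 0 then n else 0, input⟩ t
      ⟨fun r => if r = 0 then N else 0, fun q => if q < o then val.eval n q input else 0⟩ := by
  set F : Expr := .op .add len out with hF
  set w := fillWidth len (.op .add F .index) (.bit .index) + fillWidth out .index (val.shift F) +
            fillWidth (.op .add len len) (.op .add out .index) (.const 0) + sz.width + 2 with hw
  set c₁ := (Expr.op .add F .index).cost + (Expr.bit .index).cost + 5 with hc₁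
  set c₂ := Expr.index.cost + (val.shift F).cost + 5 with hc₂
  set c₃ := (Expr.op .add out .index).cost + (Expr.const 0).cost + 5 with hc₃
  refine ⟨c₁ + c₂ + 2 * c₃ + len.cost + out.cost + (Expr.op .add len len).cost + sz.cost + w + 9,
    fun n l o N X B input hX hn hlo hN hB hlen hout hsize hbit hzero => ?_⟩
  have hFe : ∀ i mem, F.eval n i mem = l + o := fun i mem => by
    simp [hF, Expr.eval, Arith.toBinOp, BinOp.eval, hlen, hout]
  have le : ∀ d, d ≤ transformDeg len out sz val → X ^ d ≤ B := fun d hd =>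
    (Nat.pow_le_pow_right (by omega) hd).trans hB
  have hXB : X ≤ B := by simpa using le 1 (by simp [transformDeg])
  -- The memory after `i` rounds of the three loops: copying to the offset `l + o`, writing the
  -- output, erasing.
  set M₁ : ℕ → ℕ → ℕ := fun i a => if l + o ≤ a ∧ a < l + o + i then input (a - (l + o))
    else input a with hM₁
  set M₂ : ℕ → ℕ → ℕ := fun i a => if a < i then val.eval n a input else M₁ l a with hM₂
  set M₃ : ℕ → ℕ → ℕ := fun i a => if o ≤ a ∧ a < o + i then 0 else M₂ o a with hM₃
  have z₁ : M₁ 0 = input := by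
    funext a; simp only [hM₁]; rw [if_neg (by omega)]
  have z₂ : M₂ 0 = M₁ l := by
    funext a; simp only [hM₂]; rw [if_neg (by omega)]
  have z₃ : M₃ 0 = M₂ o := by
    funext a; simp only [hM₃]; rw [if_neg (by omega)]
  obtain ⟨s₁, e₁, m₁, r₁, u₁⟩ := exec_fill (B := B) hX hn len (.op .add F .index) (.bit .index) hXB
    (le _ (by simp [transformDeg]; omega)) (le _ (by simp [transformDeg, hF, Expr.deg]; omega))
    (le _ (by simp [transformDeg, Expr.deg])) M₁ (by rw [hlen]; omega)
    (by
      intro i hi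
      rw [hlen] at hi
      funext a
      have h1 : (Expr.op .add F .index).eval n i (M₁ i) = l + o + i := by
        simp [Expr.eval, Arith.toBinOp, BinOp.eval, hFe]
      have h2 : (Expr.bit .index).eval n i (M₁ i) = input i := by
        simp only [Expr.eval, hM₁]
        rw [if_neg (by omega)]
        have := hbit i
        omega
      rw [h1, h2, Function.update_apply]
      simp only [hM₁]
      by_cases ha : a = l + o + i
      · rw [if_pos (by omega), if_pos ha]; congr 1; omega
      · rw [if_neg ha]
        by_cases hb : l + o ≤ a ∧ a < l + o + i
        · rw [if_pos (by omega), if_pos hb]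
        · rw [if_neg (by omega), if_neg hb])
    ⟨fun r => if r = 0 then n else 0, input⟩ (by simp) (by simp [z₁])
  rw [hlen] at m₁ e₁
  obtain ⟨s₂, e₂, m₂, r₂, u₂⟩ := exec_fill (B := B) hX hn out .index (val.shift F) hXB
    (le _ (by simp [transformDeg]; omega)) (le _ (by simp [transformDeg, Expr.deg]))
    (le _ (by simp [transformDeg, hF]; omega)) M₂ (by rw [hout]; omega)
    (by
      intro i hi
      rw [hout] at hi
      have h2 : (val.shift F).eval n i (M₂ i) = val.eval n i input := by
        rw [Expr.shift_eval n i (l + o) _ F (hFe _ _)]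
        congr 1
        funext a
        simp only [hM₂, hM₁]
        rw [if_neg (by omega)]
        -- Beyond the copy, both memories are zero because the input vanishes from `l` on.
        by_cases ha : a < l
        · rw [if_pos (by omega)]; congr 1; omega
        · rw [if_neg (by omega), hzero a (by omega), hzero _ (by omega)]
      rw [h2]
      funext a
      rw [Function.update_apply]
      simp only [Expr.eval, hM₂]
      by_cases ha : a = i
      · rw [if_pos (by omega), if_pos ha, ha]
      · rw [if_neg ha]
        by_cases hb : a < i
        · rw [if_pos (by omega), if_pos hb]
        · rw [if_neg (by omega), if_neg hb]) s₁ r₁ (by rw [m₁, z₂])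
  rw [hout] at m₂ e₂
  have hll : ∀ i mem, (Expr.op .add len len).eval n i mem = 2 * l := fun i mem => by
    simp [Expr.eval, Arith.toBinOp, BinOp.eval, hlen]; omega
  -- The `2 * l` cells from `o` on contain the copy as well as the part of the input that was not
  -- overwritten.
  obtain ⟨s₃, e₃, m₃, r₃, u₃⟩ := exec_fill (B := B) hX hn (.op .add len len)
    (.op .add out .index) (.const 0) hXB
    (le _ (by simp [transformDeg, Expr.deg]; omega))
    (le _ (by simp [transformDeg, Expr.deg]; omega))
    (le _ (by simp [transformDeg, Expr.deg])) M₃ (by rw [hll]; omega)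
    (by
      intro i hi
      funext a
      have h1 : (Expr.op .add out .index).eval n i (M₃ i) = o + i := by
        simp [Expr.eval, Arith.toBinOp, BinOp.eval, hout]
      rw [h1, Function.update_apply]
      simp only [Expr.eval, hM₃]
      by_cases ha : a = o + i
      · rw [if_pos (by omega), if_pos ha]
      · rw [if_neg ha]
        by_cases hb : o ≤ a ∧ a < o + i
        · rw [if_pos (by omega), if_pos hb]
        · rw [if_neg (by omega), if_neg hb]) s₂ r₂ (by rw [m₂, z₃])
  rw [hll] at m₃ e₃
  obtain ⟨s₄, e₄, m₄, v₄, l₄, u₄⟩ := sz.exec_compile (B := B) hX hn (by omega : 0 < X) 2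
    (s₃.set 1 0) le_rfl (le _ (by simp [transformDeg]; omega)) (by simp [r₃]) (by simp)
  rw [hsize] at v₄
  have e₅ := Exec.op (B := B) s₄ .and 0 2 2 (by simp [BinOp.eval, v₄]; omega)
  have e₆ := exec_clear (B := B) (by omega) (s₄.set 0 (BinOp.and.eval (s₄.reg 2) (s₄.reg 2))) w
  have e := Exec.seq e₁ (.seq e₂ (.seq e₃ (.seq (.const s₃ 1 0 (by omega)) (.seq e₄
    (.seq e₅ e₆)))))
  have hs : (⟨fun r => if r = 0 then N else 0,
      fun q => if q < o then val.eval n q input else 0⟩ : State) =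
      ⟨fun q => if 1 ≤ q ∧ q ≤ w then 0 else
        (s₄.set 0 (BinOp.and.eval (s₄.reg 2) (s₄.reg 2))).reg q,
        (s₄.set 0 (BinOp.and.eval (s₄.reg 2) (s₄.reg 2))).mem⟩ := by
    ext q
    · by_cases h0 : q = 0
      · simp [h0, BinOp.eval, v₄]
      · simp only [State.set_reg, h0, if_false]
        by_cases hq : q ≤ w
        · rw [if_pos (by omega)]
        · rw [if_neg (by omega), u₄ q (by omega), State.set_reg, if_neg (by omega),
            u₃ q (by omega), u₂ q (by omega), u₁ q (by omega)]
          exact (if_neg h0).symm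
    · simp only [State.set_mem, m₄, m₃, hM₃, hM₂, hM₁]
      by_cases h : q < o
      · rw [if_pos h, if_neg (by omega), if_pos h]
      · rw [if_neg h]
        by_cases h' : q < o + 2 * l
        · rw [if_pos (by omega)]
        · rw [if_neg (by omega), if_neg h, if_neg (by omega), hzero _ (by omega)]
  rw [hs]
  refine ⟨_, ?_, e⟩
  nlinarith [Nat.zero_le (c₁ * o), Nat.zero_le (c₂ * l), Nat.zero_le (c₃ * o),
      Nat.zero_le ((len.cost + out.cost + (Expr.op .add len len).cost + sz.cost + w + 9) *
        (l + o))]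

/-- Set register `0` to `1` if it does not hold `1`, and to `0` if it does. -/
def negate : Program :=
  .seq (.const 1 1) (.seq (.op .div 2 1 0) (.op .sub 0 1 2))

/-- In natural numbers `1 / r` is 1 for `r = 1` and 0 otherwise, including `r = 0`. -/
theorem exec_negate {B : ℕ} (hB : 2 ≤ B) (s : State) :
    ∃ s', Exec B negate s 3 s' ∧ (s'.reg 0 = 1 ↔ s.reg 0 ≠ 1) := by
  have h : 1 / s.reg 0 ≤ 1 := Nat.div_le_self _ _
  refine ⟨_, .seq (.const s 1 1 hB) (.seq (.op _ .div 2 1 0 ?_) (.op _ .sub 0 1 2 ?_)), ?_⟩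
  · simp [BinOp.eval]; omega
  · refine (Nat.sub_le _ _).trans_lt ?_; simp; omega
  · simp only [BinOp.eval, State.set_reg]
    simp only [if_true, show (1 : ℕ) ≠ 2 by omega, if_false, show (0 : ℕ) ≠ 1 by omega]
    rcases Nat.lt_trichotomy (s.reg 0) 1 with h | h | h
    · simp [show s.reg 0 = 0 by omega]
    · simp [h]
    · rw [Nat.div_eq_of_lt h]; simp; omega

/-- A reduction in cubic time from the complement of `Q` to a problem `Q'`, on instances of cubic
size, turns an algorithm for `Q'` with running time `O(n ^ (2 - ε))` into an algorithm for `Q`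
with running time `O(n ^ (6 - 3 ε))`. -/
theorem solvableInTime_of_reduction (Q Q' : Problem) (len out sz val : Expr) (l o N : ℕ → ℕ)
    (C : ℕ)
    (hlen : ∀ n i mem, len.eval n i mem = l n) (hout : ∀ n i mem, out.eval n i mem = o n)
    (hsize : ∀ n i mem, sz.eval n i mem = N n)
    (hbit : ∀ (n : ℕ) (x : Q.Inst n) (m : ℕ), Q.input x m < 2)
    (hzero : ∀ (n : ℕ) (x : Q.Inst n) (m : ℕ), l n ≤ m → Q.input x m = 0)
    (hl : ∀ n, 1 ≤ n → l n ≤ C * n ^ 3) (ho : ∀ n, 1 ≤ n → o n ≤ C * n ^ 3)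
    (hN : ∀ n, 1 ≤ n → N n ≤ C * n ^ 3) (hN1 : ∀ n, 1 ≤ n → 1 ≤ N n)
    (hred : ∀ n, 1 ≤ n → ∀ x : Q.Inst n, ∃ y : Q'.Inst (N n),
      (∀ q, Q'.input y q = if q < o n then val.eval n q (Q.input x) else 0) ∧
      (Q'.Yes y ↔ ¬ Q.Yes x))
    {ε : ℝ} (hε1 : ε ≤ 1) (h : Q'.SolvableInTime (2 - ε)) :
    Q.SolvableInTime (6 - 3 * ε) := by
  obtain ⟨P, c, K, hP⟩ := h
  obtain ⟨K₁, hK₁⟩ := exec_transform len out sz val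
  -- With this `D` the number `X = (n + 2) ^ D` exceeds all loop indices and sizes. The word bound
  -- is `X ^ (transformDeg + c + 1)`, enough for the transformation, for `P` on the new instance (as
  -- `N n + 2 ≤ X`) and for the negation.
  set D := 3 * C + 4 with hD
  refine ⟨.seq (transform len out sz val) (.seq P negate),
    D * (transformDeg len out sz val + c + 1),
    K₁ * (2 * C + 1) + |K| * (C : ℝ) ^ (2 - ε) + 3, fun n hn x => ?_⟩
  obtain ⟨y, hy, hyes⟩ := hred n hn x
  set X := (n + 2) ^ D with hXdef
  have hn3 : n ^ 3 ≤ (n + 2) ^ 3 := Nat.pow_le_pow_left (by omega) 3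
  have hX : 3 * C * n ^ 3 + n + 2 < X := by
    have h1 : 3 * C < 2 ^ (3 * C) := Nat.lt_two_pow_self
    have h2 : 2 ^ (3 * C) ≤ (n + 2) ^ (3 * C) := Nat.pow_le_pow_left (by omega) _
    have h3 : X = (n + 2) ^ (3 * C) * ((n + 2) ^ 3 * (n + 2)) := by
      rw [hXdef, hD]; ring
    have h4 : 3 * C + 1 ≤ (n + 2) ^ (3 * C) := by omega
    have h5 : (3 * C + 1) * ((n + 2) ^ 3 * (n + 2)) ≤ X := by
      rw [h3]; exact Nat.mul_le_mul_right _ h4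
    have h6 : n ^ 3 ≤ (n + 2) ^ 3 * (n + 2) := by nlinarith
    have h7 : n + 2 < (n + 2) ^ 3 * (n + 2) := by
      have : 1 < (n + 2) ^ 3 := Nat.one_lt_pow (by omega) (by omega)
      nlinarith
    nlinarith [Nat.mul_le_mul_left (3 * C) h6]
  have hX2 : 2 ≤ X := by omega
  have hl' := hl n hn
  have ho' := ho n hn
  have hN' := hN n hn
  have hXpow : ∀ d, d ≤ transformDeg len out sz val + c + 1 →
      X ^ d ≤ (n + 2) ^ (D * (transformDeg len out sz val + c + 1)) := fun d hd => by
    rw [pow_mul]; exact Nat.pow_le_pow_right (by omega) hd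
  have h3C : 3 * C * n ^ 3 = C * n ^ 3 + C * n ^ 3 + C * n ^ 3 := by ring
  obtain ⟨t₁, ht₁, e₁⟩ := hK₁ n (l n) (o n) (N n) X _ (Q.input x) hX2 (by omega) (by omega)
    (by omega) (hXpow _ (by omega)) (hlen n) (hout n) (hsize n) (hbit n x) (hzero n x)
  obtain ⟨t₂, s₂, e₂, ht₂, hs₂⟩ := hP (N n) (hN1 n hn) y
  have hinit : Q'.init y = ⟨fun r => if r = 0 then N n else 0,
      fun q => if q < o n then val.eval n q (Q.input x) else 0⟩ := by
    simp only [Problem.init]; congr 1; funext q; exact hy q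
  rw [hinit] at e₂
  obtain ⟨s₃, e₃, hs₃⟩ := exec_negate (B := X) hX2 s₂
  have e₂' := e₂.mono (B' := (n + 2) ^ (D * (transformDeg len out sz val + c + 1)))
    ((Nat.pow_le_pow_left (by omega : N n + 2 ≤ X) c).trans (hXpow _ (by omega)))
  have e₃' := e₃.mono (B' := (n + 2) ^ (D * (transformDeg len out sz val + c + 1)))
    (by simpa using hXpow 1 (by omega))
  refine ⟨_, s₃, .seq e₁ (.seq e₂' e₃'), ?_, ?_⟩
  · have hn1 : (1 : ℝ) ≤ n := by exact_mod_cast hn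
    have hnp : (1 : ℝ) ≤ (n : ℝ) ^ (6 - 3 * ε) := Real.one_le_rpow hn1 (by linarith)
    -- Here `ε ≤ 1` enters: the cubic cost of the transformation is absorbed, as `3 ≤ 6 - 3 * ε`.
    have hn3' : (n : ℝ) ^ 3 ≤ (n : ℝ) ^ (6 - 3 * ε) := by
      rw [← Real.rpow_natCast]
      exact Real.rpow_le_rpow_of_exponent_le hn1 (by push_cast; linarith)
    have a₁ : (t₁ : ℝ) ≤ K₁ * (2 * C + 1) * (n : ℝ) ^ (6 - 3 * ε) := by
      have : (t₁ : ℝ) ≤ K₁ * (l n + o n + 1) := by exact_mod_cast ht₁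
      have b1 : (l n : ℝ) ≤ C * (n : ℝ) ^ 3 := by exact_mod_cast hl'
      have b2 : (o n : ℝ) ≤ C * (n : ℝ) ^ 3 := by exact_mod_cast ho'
      have b3 : (C : ℝ) * (n : ℝ) ^ 3 ≤ C * (n : ℝ) ^ (6 - 3 * ε) := by gcongr
      calc (t₁ : ℝ) ≤ K₁ * (l n + o n + 1) := this
        _ ≤ K₁ * ((2 * C + 1) * (n : ℝ) ^ (6 - 3 * ε)) := by
          gcongr; linarith
        _ = _ := by ring
    have a₂ : (t₂ : ℝ) ≤ |K| * (C : ℝ) ^ (2 - ε) * (n : ℝ) ^ (6 - 3 * ε) := by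
      have b1 : (N n : ℝ) ≤ C * (n : ℝ) ^ 3 := by exact_mod_cast hN'
      calc (t₂ : ℝ) ≤ K * (N n : ℝ) ^ (2 - ε) := ht₂
        _ ≤ |K| * (N n : ℝ) ^ (2 - ε) := by gcongr; exact le_abs_self K
        _ ≤ |K| * (C * (n : ℝ) ^ 3) ^ (2 - ε) := by
          gcongr; linarith
        _ = _ := by
          rw [Real.mul_rpow (by positivity) (by positivity), ← Real.rpow_natCast,
            ← Real.rpow_mul (by positivity), mul_assoc]
          congr 3; push_cast; ring
    push_cast
    nlinarith
  · rw [hs₃]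
    constructor
    · intro h1; by_contra h2; exact h1 (hs₂.2 (hyes.2 h2))
    · intro h1 h2; exact (hyes.1 (hs₂.1 h2)) h1

end WordRAM

/-! ### Triangles in coordinates -/

/-- The point of the plane with given coordinates. -/
noncomputable abbrev toPlane (p : ℝ × ℝ) : Plane := !₂[p.1, p.2]

/-- The triangles with vertices `p 0, p 1, p 2` and `q 0, q 1, q 2` have a common point, given by
its barycentric coordinates in both. -/
def Meet (p q : Fin 3 → ℝ × ℝ) : Prop :=
  ∃ u v : Fin 3 → ℝ, (∀ i, 0 ≤ u i) ∧ (∀ i, 0 ≤ v i) ∧ u 0 + u 1 + u 2 = 1 ∧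
    v 0 + v 1 + v 2 = 1 ∧
    u 0 * (p 0).1 + u 1 * (p 1).1 + u 2 * (p 2).1 =
      v 0 * (q 0).1 + v 1 * (q 1).1 + v 2 * (q 2).1 ∧
    u 0 * (p 0).2 + u 1 * (p 1).2 + u 2 * (p 2).2 =
      v 0 * (q 0).2 + v 1 * (q 1).2 + v 2 * (q 2).2

theorem mem_convexHull_triangle (p : Fin 3 → ℝ × ℝ) (x : ℝ × ℝ) :
    toPlane x ∈ convexHull ℝ (Set.range fun j => toPlane (p j)) ↔
      ∃ u : Fin 3 → ℝ, (∀ i, 0 ≤ u i) ∧ u 0 + u 1 + u 2 = 1 ∧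
        x.1 = u 0 * (p 0).1 + u 1 * (p 1).1 + u 2 * (p 2).1 ∧
        x.2 = u 0 * (p 0).2 + u 1 * (p 1).2 + u 2 * (p 2).2 := by
  rw [convexHull_range_eq_exists_affineCombination]
  constructor
  · rintro ⟨s, w, hw0, hw1, hx⟩
    rw [Finset.affineCombination_eq_linear_combination _ _ _ hw1] at hx
    classical
    -- The weights are given on a subset `s` of the vertices and are extended by zero.
    have key : ∀ f : Fin 3 → ℝ, ∑ i ∈ s, w i * f i =
        (if 0 ∈ s then w 0 else 0) * f 0 + (if 1 ∈ s then w 1 else 0) * f 1 +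
        (if 2 ∈ s then w 2 else 0) * f 2 := fun f => by
      rw [← Fin.sum_univ_three (fun i => (if i ∈ s then w i else 0) * f i)]
      simp [ite_mul, Finset.sum_ite_mem]
    refine ⟨fun i => if i ∈ s then w i else 0, fun i => ?_, ?_, ?_, ?_⟩
    · dsimp only; split_ifs with h
      · exact hw0 i h
      · exact le_rfl
    · have := key fun _ => 1
      simp only [mul_one] at this
      rw [← this, hw1]
    · rw [← key fun j => (p j).1]
      have := congrArg (fun z : Plane => z 0) hx
      simpa using this.symm
    · rw [← key fun j => (p j).2]
      have := congrArg (fun z : Plane => z 1) hx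
      simpa using this.symm
  · rintro ⟨u, hu, hu1, h1, h2⟩
    have hs : ∑ i, u i = 1 := by rw [Fin.sum_univ_three, hu1]
    refine ⟨Finset.univ, u, fun i _ => hu i, hs, ?_⟩
    rw [Finset.affineCombination_eq_linear_combination _ _ _ hs, Fin.sum_univ_three]
    ext i
    fin_cases i
    · simp [h1]
    · simp [h2]

theorem inter_convexHull_nonempty_iff (p q : Fin 3 → ℝ × ℝ) :
    (convexHull ℝ (Set.range fun j => toPlane (p j)) ∩
      convexHull ℝ (Set.range fun j => toPlane (q j))).Nonempty ↔ Meet p q := by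
  constructor
  · rintro ⟨z, hp, hq⟩
    have hz : z = toPlane (z 0, z 1) := by ext i; fin_cases i <;> rfl
    rw [hz, mem_convexHull_triangle] at hp hq
    obtain ⟨u, hu, hu1, h1, h2⟩ := hp
    obtain ⟨v, hv, hv1, g1, g2⟩ := hq
    exact ⟨u, v, hu, hv, hu1, hv1, h1.symm.trans g1, h2.symm.trans g2⟩
  · rintro ⟨u, v, hu, hv, hu1, hv1, h1, h2⟩
    exact ⟨toPlane (_, _), (mem_convexHull_triangle p (_, _)).2 ⟨u, hu, hu1, rfl, rfl⟩,
      (mem_convexHull_triangle q _).2 ⟨v, hv, hv1, h1, h2⟩⟩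

theorem Meet.symm {p q : Fin 3 → ℝ × ℝ} (h : Meet p q) : Meet q p := by
  obtain ⟨u, v, hu, hv, hu1, hv1, h1, h2⟩ := h
  exact ⟨v, u, hv, hu, hv1, hu1, h1.symm, h2.symm⟩

/-- Translate by `(a, b)`, after a reflection of the first coordinate if `c = -1`. -/
def place (a b c : ℝ) (x : ℝ × ℝ) : ℝ × ℝ := (a + c * x.1, b + x.2)

/-- Invertible affine maps preserve barycentric coordinates, so the same weights work on both sides.
-/
theorem meet_place_iff {a b c : ℝ} (hc : c ≠ 0) (p q : Fin 3 → ℝ × ℝ) :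
    Meet (fun i => place a b c (p i)) (fun i => place a b c (q i)) ↔ Meet p q := by
  unfold Meet place
  refine exists_congr fun u => exists_congr fun v => and_congr_right fun _ =>
    and_congr_right fun _ => and_congr_right fun hu => and_congr_right fun hv => ?_
  refine and_congr ⟨fun h => mul_left_cancel₀ hc ?_, fun h => ?_⟩ ⟨fun h => ?_, fun h => ?_⟩
  · linear_combination h - a * hu + a * hv
  · linear_combination c * h + a * hu - a * hv
  · linear_combination h - b * hu + b * hv
  · linear_combination h + b * hu - b * hv

/-- Some weight of a point of the first triangle is positive, so the functional is positive there,
and it is nonpositive on the second triangle. Strictness on one side only permits separating lines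
that run along an edge. -/
theorem not_meet_of_separated {p q : Fin 3 → ℝ × ℝ} (α β γ : ℝ)
    (hp : ∀ i, 0 < α * (p i).1 + β * (p i).2 + γ) (hq : ∀ i, α * (q i).1 + β * (q i).2 + γ ≤ 0) :
    ¬ Meet p q := by
  rintro ⟨u, v, hu, hv, hu1, hv1, h1, h2⟩
  have a : 0 < u 0 * (α * (p 0).1 + β * (p 0).2 + γ) + u 1 * (α * (p 1).1 + β * (p 1).2 + γ) +
      u 2 * (α * (p 2).1 + β * (p 2).2 + γ) := by
    have b0 := mul_nonneg (hu 0) (hp 0).le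
    have b1 := mul_nonneg (hu 1) (hp 1).le
    have b2 := mul_nonneg (hu 2) (hp 2).le
    rcases (hu 0).lt_or_eq with h | h
    · have := mul_pos h (hp 0); linarith
    · rcases (hu 1).lt_or_eq with h' | h'
      · have := mul_pos h' (hp 1); linarith
      · have := mul_pos (by linarith : 0 < u 2) (hp 2); linarith
  have b0 := mul_nonneg (hv 0) (neg_nonneg.2 (hq 0))
  have b1 := mul_nonneg (hv 1) (neg_nonneg.2 (hq 1))
  have b2 := mul_nonneg (hv 2) (neg_nonneg.2 (hq 2))
  have e : u 0 * (α * (p 0).1 + β * (p 0).2 + γ) + u 1 * (α * (p 1).1 + β * (p 1).2 + γ) +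
      u 2 * (α * (p 2).1 + β * (p 2).2 + γ) = v 0 * (α * (q 0).1 + β * (q 0).2 + γ) +
      v 1 * (α * (q 1).1 + β * (q 1).2 + γ) + v 2 * (α * (q 2).1 + β * (q 2).2 + γ) := by
    linear_combination α * h1 + β * h2 + γ * hu1 - γ * hv1
  linarith

theorem convexHull_ne_of_lt {p q : Fin 3 → ℝ × ℝ} (α β : ℝ) (j : Fin 3)
    (h : ∀ i, α * (p i).1 + β * (p i).2 < α * (q j).1 + β * (q j).2) :
    convexHull ℝ (Set.range fun j => toPlane (p j)) ≠
      convexHull ℝ (Set.range fun j => toPlane (q j)) := by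
  intro he
  have hm : toPlane (q j) ∈ convexHull ℝ (Set.range fun j => toPlane (q j)) :=
    subset_convexHull ℝ _ ⟨j, rfl⟩
  -- A degenerate triangle with three equal vertices turns membership of a point into `Meet`.
  have : Meet p (fun _ => q j) := by
    rw [← inter_convexHull_nonempty_iff]
    exact ⟨toPlane (q j), he ▸ hm, subset_convexHull ℝ _ ⟨0, rfl⟩⟩
  refine not_meet_of_separated (-α) (-β) (α * (q j).1 + β * (q j).2) (fun i => ?_) (fun i => ?_)
    this
  · linarith [h i]
  · linarith

/-- Twice the signed area of the triangle `a b c`. -/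
def area (a b c : ℝ × ℝ) : ℝ := (b.1 - a.1) * (c.2 - a.2) - (b.2 - a.2) * (c.1 - a.1)

theorem area_add (a b c x : ℝ × ℝ) : area b c x + area c a x + area a b x = area a b c := by
  simp only [area]; ring

/-- Barycentric coordinates of a point on the inner side of all three edges. -/
theorem exists_weights {a b c x : ℝ × ℝ} (h : 0 < area a b c) (h₁ : 0 ≤ area b c x)
    (h₂ : 0 ≤ area c a x) (h₃ : 0 ≤ area a b x) :
    ∃ u : Fin 3 → ℝ, (∀ i, 0 ≤ u i) ∧ u 0 + u 1 + u 2 = 1 ∧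
      u 0 * a.1 + u 1 * b.1 + u 2 * c.1 = x.1 ∧ u 0 * a.2 + u 1 * b.2 + u 2 * c.2 = x.2 := by
  refine ⟨![area b c x / area a b c, area c a x / area a b c, area a b x / area a b c],
    fun i => ?_, ?_, ?_, ?_⟩
  · fin_cases i <;> simp <;> positivity
  · simp only [Matrix.cons_val]
    rw [← add_div, ← add_div, area_add, div_self h.ne']
  · simp only [Matrix.cons_val]
    field_simp
    simp only [area]; ring
  · simp only [Matrix.cons_val]
    field_simp
    simp only [area]; ring

/-- Cramer's rule: the area is the determinant of the linear system for the weights. -/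
theorem affineIndependent_of_area_ne_zero (p : Fin 3 → ℝ × ℝ) (h : area (p 0) (p 1) (p 2) ≠ 0) :
    AffineIndependent ℝ fun j => toPlane (p j) := by
  rw [affineIndependent_iff_of_fintype]
  intro w hw hv
  rw [Finset.univ.weightedVSub_eq_linear_combination hw, Fin.sum_univ_three] at hv
  rw [Fin.sum_univ_three] at hw
  have h1 : w 0 * (p 0).1 + w 1 * (p 1).1 + w 2 * (p 2).1 = 0 := by
    simpa using congrArg (fun z : Plane => z 0) hv
  have h2 : w 0 * (p 0).2 + w 1 * (p 1).2 + w 2 * (p 2).2 = 0 := by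
    simpa using congrArg (fun z : Plane => z 1) hv
  have e1 : w 1 = 0 := by
    refine (mul_eq_zero.1 (?_ : area (p 0) (p 1) (p 2) * w 1 = 0)).resolve_left h
    simp only [area]
    linear_combination ((p 2).2 - (p 0).2) * (h1 - (p 0).1 * hw) -
      ((p 2).1 - (p 0).1) * (h2 - (p 0).2 * hw)
  have e2 : w 2 = 0 := by
    refine (mul_eq_zero.1 (?_ : area (p 0) (p 1) (p 2) * w 2 = 0)).resolve_left h
    simp only [area]
    linear_combination ((p 1).1 - (p 0).1) * (h2 - (p 0).2 * hw) -
      ((p 1).2 - (p 0).2) * (h1 - (p 0).1 * hw)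
  have e0 : w 0 = 0 := by linarith
  intro i
  fin_cases i
  · exact e0
  · exact e1
  · exact e2

/-! ### Shapes -/

theorem dist_toPlane (x y : ℝ × ℝ) :
    dist (toPlane x) (toPlane y) = √((x.1 - y.1) ^ 2 + (x.2 - y.2) ^ 2) := by
  rw [EuclideanSpace.dist_eq, Fin.sum_univ_two]
  simp [Real.dist_eq, sq_abs]

theorem dist_toPlane_le (x y : ℝ × ℝ) :
    dist (toPlane x) (toPlane y) ≤ |x.1 - y.1| + |x.2 - y.2| := by
  rw [dist_toPlane]
  refine Real.sqrt_le_iff.2 ⟨by positivity, ?_⟩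
  nlinarith [sq_abs (x.1 - y.1), sq_abs (x.2 - y.2),
    mul_nonneg (abs_nonneg (x.1 - y.1)) (abs_nonneg (x.2 - y.2))]

/-- A triangle whose vertices are close to those of an isosceles right triangle with legs of
length `s` is a half-square. The right angle is at vertex `k`. -/
theorem isHalfSquare_of_near {δ s ρ : ℝ} (hs : 0 < s) (hρ : 2 * ρ ≤ δ) (hρ' : ρ ≤ 1 / 10)
    {p e : Fin 3 → Plane} {i j k : Fin 3} (hij : i ≠ j) (hik : i ≠ k) (hjk : j ≠ k)
    (eij : dist (e i) (e j) = √2 * s) (eik : dist (e i) (e k) = s) (ejk : dist (e j) (e k) = s)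
    (h : ∀ l, dist (p l) (e l) ≤ ρ * s) : IsHalfSquare δ p := by
  have key : ∀ a b, |dist (p a) (p b) - dist (e a) (e b)| ≤ 2 * ρ * s := fun a b => by
    have h1 := dist_triangle4 (p a) (e a) (e b) (p b)
    have h2 := dist_triangle4 (e a) (p a) (p b) (e b)
    rw [dist_comm (e b) (p b)] at h1
    rw [dist_comm (e a) (p a)] at h2
    rw [abs_le]
    constructor <;> linarith [h a, h b]
  have k1 := abs_le.1 (key i j)
  have k2 := abs_le.1 (key i k)
  have k3 := abs_le.1 (key j k)
  rw [eij] at k1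
  rw [eik] at k2
  rw [ejk] at k3
  have hδ : 2 * ρ * s ≤ δ * s := by gcongr
  have hρs : ρ * s ≤ 1 / 10 * s := by gcongr
  -- With `ρ ≤ 1 / 10` the hypotenuse stays the longest side, since `1.4 - 0.2 = 1 + 0.2`.
  have h2 : 14 / 10 * s ≤ √2 * s := by
    gcongr
    exact Real.le_sqrt_of_sq_le (by norm_num)
  refine ⟨s, hs, i, j, k, hij, hik, hjk, ?_, ?_, ⟨?_, ?_⟩, ⟨?_, ?_⟩, ?_, ?_⟩ <;> linarith

/-- The law of cosines with one-sided bounds: an angle below `α` would make `2 * dist a b * dist c b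
* cos` exceed `2 * x * y * cos α`, whereas it equals `dist a b ^ 2 + dist c b ^ 2 - dist a c ^ 2`.
-/
theorem le_angle_of_sides {α x y z : ℝ} {a b c : Plane} (hαπ : α < Real.pi)
    (hx : 0 < x) (hy : 0 < y)
    (hab : x ≤ dist a b) (hcb : y ≤ dist c b)
    (h : dist a b ^ 2 + dist c b ^ 2 - z ^ 2 ≤ 2 * x * y * Real.cos α) (hc : 0 ≤ Real.cos α)
    (hz : 0 ≤ z) (hac : z ≤ dist a c) : α ≤ EuclideanGeometry.angle a b c := by
  by_contra! hlt
  have hcos : Real.cos α < Real.cos (EuclideanGeometry.angle a b c) :=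
    Real.cos_lt_cos_of_nonneg_of_le_pi (EuclideanGeometry.angle_nonneg _ _ _) hαπ.le hlt
  have law := EuclideanGeometry.law_cos a b c
  have h1 : x * y ≤ dist a b * dist c b := by gcongr
  have h2 : 0 < x * y := mul_pos hx hy
  have h3 : x * y * Real.cos α < dist a b * dist c b * Real.cos (EuclideanGeometry.angle a b c) := by
    calc x * y * Real.cos α < x * y * Real.cos (EuclideanGeometry.angle a b c) := by gcongr
      _ ≤ _ := by gcongr; linarith
  have h4 : z ^ 2 ≤ dist a c ^ 2 := by gcongr
  nlinarith

/-- Half-squares of sufficiently good quality are `α`-fat. -/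
theorem exists_isFatTriangle_of_isHalfSquare {α : ℝ} (hα : 0 < α) (hα' : α < Real.pi / 4) :
    ∃ δ : ℝ, 0 < δ ∧ ∀ p : Fin 3 → Plane, IsHalfSquare δ p → IsFatTriangle α p := by
  have hcos : √2 / 2 < Real.cos α := by
    rw [← Real.cos_pi_div_four]
    exact Real.cos_lt_cos_of_nonneg_of_le_pi hα.le (by linarith [Real.pi_pos]) hα'
  have hs2 : √2 ^ 2 = 2 := Real.sq_sqrt (by norm_num)
  have hs1 : (1 : ℝ) < √2 := Real.lt_sqrt_of_sq_lt (by norm_num)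
  have hcpos : 0 < Real.cos α := by linarith
  -- The angle opposite the longest side; at `δ = 0` the inequality is `0 < 2 * cos α`.
  have c1 : ∀ᶠ δ : ℝ in nhds 0, (1 + δ) ^ 2 + (1 + δ) ^ 2 - (√2 - δ) ^ 2 <
      2 * (1 - δ) * (1 - δ) * Real.cos α := by
    refine ContinuousAt.eventually_lt (by fun_prop) (by fun_prop) ?_
    norm_num [hs2]; exact hcpos
  -- The two acute angles; at `δ = 0` the inequality is `2 < 2 * √2 * cos α`, which is `α < π / 4`.
  have c2 : ∀ᶠ δ : ℝ in nhds 0, (√2 + δ) ^ 2 + (1 + δ) ^ 2 - (1 - δ) ^ 2 <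
      2 * (√2 - δ) * (1 - δ) * Real.cos α := by
    refine ContinuousAt.eventually_lt (by fun_prop) (by fun_prop) ?_
    norm_num [hs2]
    nlinarith
  have c3 : ∀ᶠ δ : ℝ in nhds 0, δ < 1 := eventually_lt_nhds (by norm_num)
  obtain ⟨δ, ⟨⟨h1, h2⟩, h3⟩, hδ⟩ := (((c1.and c2).and c3).filter_mono nhdsWithin_le_nhds |>.and
    (self_mem_nhdsWithin : Set.Ioi (0 : ℝ) ∈ nhdsWithin 0 (Set.Ioi 0))).exists
  have hδ0 : 0 < δ := hδ
  refine ⟨δ, hδ0, ?_⟩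
  rintro p ⟨s, hs, i, j, k, hij, hik, hjk, -, -, ⟨l1, u1⟩, ⟨l2, u2⟩, ⟨l3, u3⟩⟩
  have hαπ : α < Real.pi := by linarith [Real.pi_pos]
  have p1 : 0 < (1 - δ) * s := mul_pos (by linarith) hs
  have p2 : 0 < (√2 - δ) * s := mul_pos (by linarith) hs
  have q1 : dist (p i) (p j) ^ 2 ≤ ((√2 + δ) * s) ^ 2 := by gcongr
  have q2 : dist (p i) (p k) ^ 2 ≤ ((1 + δ) * s) ^ 2 := by gcongr
  have q3 : dist (p j) (p k) ^ 2 ≤ ((1 + δ) * s) ^ 2 := by gcongr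
  have s2 : 0 < s ^ 2 := by positivity
  have t1 := mul_le_mul_of_nonneg_left h1.le s2.le
  have t2 := mul_le_mul_of_nonneg_left h2.le s2.le
  have ai : α ≤ EuclideanGeometry.angle (p j) (p i) (p k) := by
    refine le_angle_of_sides (z := (1 - δ) * s) hαπ p2 p1 ?_ ?_ ?_ hcpos.le p1.le l3
    · rwa [dist_comm]
    · rwa [dist_comm]
    · rw [dist_comm (p j), dist_comm (p k)]; linarith
  have aj : α ≤ EuclideanGeometry.angle (p i) (p j) (p k) := by
    refine le_angle_of_sides (z := (1 - δ) * s) hαπ p2 p1 l1 ?_ ?_ hcpos.le p1.le l2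
    · rwa [dist_comm]
    · rw [dist_comm (p k)]; linarith
  have ak : α ≤ EuclideanGeometry.angle (p i) (p k) (p j) := by
    refine le_angle_of_sides (z := (√2 - δ) * s) hαπ p1 p1 l2 l3 ?_ hcpos.le p2.le l1
    linarith
  intro a b c hab hac hbc
  have perms : ∀ i j k : Fin 3, i ≠ j → i ≠ k → j ≠ k → ∀ a b c : Fin 3, a ≠ b → a ≠ c → b ≠ c →
      (b = i ∧ (a = j ∧ c = k ∨ a = k ∧ c = j)) ∨ (b = j ∧ (a = i ∧ c = k ∨ a = k ∧ c = i)) ∨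
      (b = k ∧ (a = i ∧ c = j ∨ a = j ∧ c = i)) := by decide
  rcases perms i j k hij hik hjk a b c hab hac hbc with ⟨rfl, ⟨rfl, rfl⟩ | ⟨rfl, rfl⟩⟩ | ⟨rfl, ⟨rfl, rfl⟩ | ⟨rfl, rfl⟩⟩ |
    ⟨rfl, ⟨rfl, rfl⟩ | ⟨rfl, rfl⟩⟩
  · exact ai
  · rwa [EuclideanGeometry.angle_comm]
  · exact aj
  · rwa [EuclideanGeometry.angle_comm]
  · exact ak
  · rwa [EuclideanGeometry.angle_comm]

/-! ### The contact between triangles -/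

theorem area_swap (a b x : ℝ × ℝ) : area b a x = -area a b x := by
  simp only [area]; ring

theorem not_meet_of_area {p q : Fin 3 → ℝ × ℝ} (a b : ℝ × ℝ) (hp : ∀ i, 0 < area a b (p i))
    (hq : ∀ i, area a b (q i) ≤ 0) : ¬ Meet p q := by
  refine not_meet_of_separated (-(b.2 - a.2)) (b.1 - a.1)
    ((b.2 - a.2) * a.1 - (b.1 - a.1) * a.2) (fun i => ?_) fun i => ?_
  · have := hp i; simp only [area] at this; linarith
  · have := hq i; simp only [area] at this; linarith

theorem meet_of_vertex_mem {p q : Fin 3 → ℝ × ℝ} (j : Fin 3) (h : 0 < area (p 0) (p 1) (p 2))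
    (h₁ : 0 ≤ area (p 1) (p 2) (q j)) (h₂ : 0 ≤ area (p 2) (p 0) (q j))
    (h₃ : 0 ≤ area (p 0) (p 1) (q j)) : Meet p q := by
  obtain ⟨u, hu, hu1, e1, e2⟩ := exists_weights h h₁ h₂ h₃
  refine ⟨u, fun i => if i = j then 1 else 0, hu, fun i => by positivity, hu1, ?_, ?_, ?_⟩
  · fin_cases j <;> simp
  · rw [e1]; fin_cases j <;> simp
  · rw [e2]; fin_cases j <;> simp

/-- If the edge from `p 1` to `p 2` crosses the edge from `q 2` to `q 0`, the triangles meet. -/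
theorem meet_of_crossing {p q : Fin 3 → ℝ × ℝ} (h₂ : 0 ≤ area (q 2) (q 0) (p 2))
    (h₁ : area (q 2) (q 0) (p 1) < 0) (hl₁ : (q 2).1 ≤ (p 1).1) (hl₂ : (q 2).1 ≤ (p 2).1)
    (hq : (q 2).1 < (q 0).1)
    (hr : area (q 2) (q 0) (p 2) * ((p 1).1 - (q 0).1) ≤
      area (q 2) (q 0) (p 1) * ((p 2).1 - (q 0).1)) : Meet p q := by
  set f := area (q 2) (q 0) (p 2) with hf
  set g := area (q 2) (q 0) (p 1) with hg
  have hfg : 0 < f - g := by linarith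
  have hw : 0 < (q 0).1 - (q 2).1 := by linarith
  -- The intersection of the segment from `p 1` to `p 2` with the line through `q 2` and `q 0`: the
  -- signed areas `f` and `g` measure the distances of the two ends from this line. By `hr` the
  -- point is not to the right of `q 0`.
  have hx : ∃ x y : ℝ, x * (f - g) = f * (p 1).1 - g * (p 2).1 ∧
      y * (f - g) = f * (p 1).2 - g * (p 2).2 :=
    ⟨_, _, div_mul_cancel₀ _ hfg.ne', div_mul_cancel₀ _ hfg.ne'⟩
  obtain ⟨x, y, ex, ey⟩ := hx
  have hx0 : x ≤ (q 0).1 := by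
    refine le_of_mul_le_mul_right (?_ : x * (f - g) ≤ (q 0).1 * (f - g)) hfg
    linarith
  have hx2 : (q 2).1 ≤ x := by
    refine le_of_mul_le_mul_right (?_ : (q 2).1 * (f - g) ≤ x * (f - g)) hfg
    nlinarith
  have harea : ((q 0).1 - (q 2).1) * (y - (q 2).2) = ((q 0).2 - (q 2).2) * (x - (q 2).1) := by
    refine mul_right_cancel₀ hfg.ne' ?_
    have e1 : f = ((q 0).1 - (q 2).1) * ((p 2).2 - (q 2).2) -
      ((q 0).2 - (q 2).2) * ((p 2).1 - (q 2).1) := hf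
    have e2 : g = ((q 0).1 - (q 2).1) * ((p 1).2 - (q 2).2) -
      ((q 0).2 - (q 2).2) * ((p 1).1 - (q 2).1) := hg
    linear_combination ((q 0).1 - (q 2).1) * ey - ((q 0).2 - (q 2).2) * ex - f * e2 + g * e1
  refine ⟨![0, f / (f - g), -g / (f - g)],
    ![(x - (q 2).1) / ((q 0).1 - (q 2).1), 0, ((q 0).1 - x) / ((q 0).1 - (q 2).1)],
    fun i => ?_, fun i => ?_, ?_, ?_, ?_, ?_⟩
  · fin_cases i
    · simp
    · exact div_nonneg h₂ hfg.le
    · exact div_nonneg (by linarith) hfg.le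
  · fin_cases i
    · exact div_nonneg (by linarith) hw.le
    · simp
    · exact div_nonneg (by linarith) hw.le
  · simp only [Matrix.cons_val]; field_simp; ring
  · simp only [Matrix.cons_val]; field_simp; ring
  · simp only [Matrix.cons_val]
    trans x
    · field_simp; linarith
    · field_simp; ring
  · simp only [Matrix.cons_val]
    trans y
    · field_simp; linarith
    · field_simp; linarith

/-! ### The scales, and the position of the triangles at large scale. -/

/-- The scales of the construction: `E` bounds the perturbations of the vertices, `T` is the size
of the small triangles and `S` the size of the large ones. -/
structure Scales (k E T U S : ℝ) : Prop where
  ten_le : 10 ≤ k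
  le_E : 2 * (k + 1) ≤ E
  T_eq : T = 100 * E ^ 2
  U_eq : U = T ^ 2
  S_eq : S = k * U

/-- The small triangle on the right, with vertices perturbed by `y`, `v` and `w`. -/
def smallTriangle (k T S y w v : ℝ) : Fin 3 → ℝ × ℝ :=
  ![(S, y), (S + k * T - w, -(k + 1) * T + w), (S + k * T + v, (k + 1) * T + v)]

/-- A large triangle. -/
def largeTriangle (P R : ℝ × ℝ) (z : ℝ) : Fin 3 → ℝ × ℝ := ![P, (0, z), R]

/-- A large triangle with vertices close to the two small triangles, and the perturbations of the
right small triangle. -/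
structure NearScales (k E T U S y w v : ℝ) (P R : ℝ × ℝ) (z : ℝ) : Prop extends
    Scales k E T U S where
  y_nonneg : 0 ≤ y
  y_le : y ≤ E
  w_nonneg : 0 ≤ w
  w_le : w ≤ E
  v_nonneg : 0 ≤ v
  v_le : v ≤ E
  le_P : S ≤ P.1
  P_low : -(E * T) ≤ P.2
  P_high : P.2 ≤ E * T
  R_le : R.1 ≤ -S
  R_low : -(E * T) ≤ R.2
  R_high : R.2 ≤ E * T
  le_z : (k - 1) * U ≤ z
  z_le : z ≤ (k - 1) * U + E

namespace Scales

variable {k E T U S : ℝ}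

theorem E_ge (h : Scales k E T U S) : 22 ≤ E := by linarith [h.ten_le, h.le_E]

theorem T_ge (h : Scales k E T U S) : 2200 * E ≤ T := by
  rw [h.T_eq]; nlinarith [h.E_ge]

theorem ET_le (h : Scales k E T U S) : 2200 * (E * T) ≤ U := by
  rw [h.U_eq]; nlinarith [h.T_ge, h.E_ge]

theorem kT_le (h : Scales k E T U S) : 2 * ((k + 1) * T) ≤ E * T := by
  nlinarith [h.T_ge, h.E_ge, h.le_E]

theorem EET_le (h : Scales k E T U S) : 100 * (E * E * T) ≤ U := by
  rw [h.U_eq]; nlinarith [h.T_eq]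

end Scales

namespace NearScales

variable {k E T U S y w v z : ℝ} {P R : ℝ × ℝ}

/-- The lower edge is almost horizontal: its ends have heights of at most `E * T`, much less than
`U`, while the apex has height at least `(k - 1) * U`. -/
theorem area_R_P_Z (h : NearScales k E T U S y w v P R z) : 0 < area R P (0, z) := by
  have hE := h.E_ge
  have hET := h.ET_le
  have hk := h.ten_le
  have hT := h.T_ge
  have hU : 0 < U := by nlinarith
  have hS : 10 * U ≤ S := by rw [h.S_eq]; nlinarith
  have h1 : U ≤ z - P.2 := by nlinarith [h.le_z, h.P_high]
  have h2 : -(2 * (E * T)) ≤ P.2 - R.2 := by linarith [h.P_low, h.R_high]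
  simp only [area]
  have e : (P.1 - R.1) * (z - R.2) - (P.2 - R.2) * (0 - R.1) =
    (P.1 - R.1) * (z - P.2) + (P.2 - R.2) * P.1 := by ring
  rw [e]
  have a1 : P.1 * U ≤ (P.1 - R.1) * (z - P.2) :=
    mul_le_mul (by linarith [h.R_le]) h1 hU.le (by linarith [h.R_le, h.le_P])
  have a2 : -(2 * (E * T)) * P.1 ≤ (P.2 - R.2) * P.1 :=
    mul_le_mul_of_nonneg_right h2 (by linarith [h.le_P])
  have a3 : 0 < P.1 * (U - 2 * (E * T)) := mul_pos (by linarith [h.le_P]) (by linarith)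
  linarith

theorem area_P_Z_R (h : NearScales k E T U S y w v P R z) : 0 < area P (0, z) R := by
  have := h.area_R_P_Z
  simp only [area] at *
  linarith

/-- The left end and the tip of a large triangle lie above the upper edge of the small one. -/
theorem upper_R (h : NearScales k E T U S y w v P R z) :
    0 < area (S, y) (S + k * T + v, (k + 1) * T + v) R := by
  have hE := h.E_ge
  have hET := h.ET_le
  have hk := h.ten_le
  have hT := h.T_ge
  have hU : 0 < U := by nlinarith
  have hS : 10 * U ≤ S := by rw [h.S_eq]; nlinarith
  have hkT := h.kT_le
  simp only [area]
  have a1 : -(2 * (E * T)) ≤ R.2 - y := by nlinarith [h.R_low, h.y_le]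
  have a2 : (k * T + v) * (-(2 * (E * T))) ≤ (k * T + v) * (R.2 - y) :=
    mul_le_mul_of_nonneg_left a1 (by nlinarith [h.v_nonneg])
  have a3 : ((k + 1) * T + v - y) * (2 * S) ≤ ((k + 1) * T + v - y) * (S - R.1) :=
    mul_le_mul_of_nonneg_left (by linarith [h.R_le]) (by nlinarith [h.v_nonneg, h.y_le])
  have a4 : k * T + v ≤ 2 * ((k + 1) * T + v - y) := by nlinarith [h.v_nonneg, h.y_le]
  have a5 : 0 < (k + 1) * T + v - y := by nlinarith [h.v_nonneg, h.y_le]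
  have a6 : 0 < ((k + 1) * T + v - y) * (2 * S - 4 * (E * T)) := mul_pos a5 (by linarith)
  nlinarith [mul_le_mul_of_nonneg_right a4 (by nlinarith : 0 ≤ 2 * (E * T))]

theorem upper_Z (h : NearScales k E T U S y w v P R z) :
    0 < area (S, y) (S + k * T + v, (k + 1) * T + v) (0, z) := by
  have hE := h.E_ge
  have hET := h.ET_le
  have hk := h.ten_le
  have hT := h.T_ge
  have hU : 0 < U := by nlinarith
  have hS : 10 * U ≤ S := by rw [h.S_eq]; nlinarith
  simp only [area]
  have a1 : 0 < z - y := by nlinarith [h.le_z, h.y_le]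
  have a2 : 0 ≤ (k * T + v) * (z - y) := mul_nonneg (by nlinarith [h.v_nonneg]) a1.le
  have a3 : 0 < ((k + 1) * T + v - y) * S :=
    mul_pos (by nlinarith [h.v_nonneg, h.y_le]) (by linarith)
  linarith

theorem lower_R (h : NearScales k E T U S y w v P R z) :
    area (S, y) (S + k * T - w, -(k + 1) * T + w) R < 0 := by
  have hE := h.E_ge
  have hET := h.ET_le
  have hk := h.ten_le
  have hT := h.T_ge
  have hU : 0 < U := by nlinarith
  have hS : 10 * U ≤ S := by rw [h.S_eq]; nlinarith
  simp only [area]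
  have a1 : R.2 - y ≤ 2 * (E * T) := by nlinarith [h.R_high, h.y_nonneg]
  have a2 : (k * T - w) * (R.2 - y) ≤ (k * T - w) * (2 * (E * T)) :=
    mul_le_mul_of_nonneg_left a1 (by nlinarith [h.w_le])
  have a3 : ((k + 1) * T - w + y) * (2 * S) ≤ ((k + 1) * T - w + y) * (S - R.1) :=
    mul_le_mul_of_nonneg_left (by linarith [h.R_le]) (by nlinarith [h.w_le, h.y_nonneg])
  have a4 : k * T - w ≤ (k + 1) * T - w + y := by nlinarith [h.y_nonneg]
  have a5 : 0 < (k + 1) * T - w + y := by nlinarith [h.w_le, h.y_nonneg]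
  have a6 : 0 < ((k + 1) * T - w + y) * (2 * S - 2 * (E * T)) := mul_pos a5 (by linarith)
  nlinarith [mul_le_mul_of_nonneg_right a4 (by nlinarith : 0 ≤ 2 * (E * T))]

/-- The line of the lower edge has slope about `-(k + 1) / k` and meets the axis `x = 0` at height
about `(k + 1) * U`. The apex, at height about `(k - 1) * U`, lies below. -/
theorem lower_Z (h : NearScales k E T U S y w v P R z) :
    area (S, y) (S + k * T - w, -(k + 1) * T + w) (0, z) < 0 := by
  have hE := h.E_ge
  have hET := h.ET_le
  have hk := h.ten_le
  have hT := h.T_ge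
  have hU : 0 < U := by nlinarith
  have hS : 10 * U ≤ S := by rw [h.S_eq]; nlinarith
  simp only [area]
  have a1 : z - y ≤ S := by
    rw [h.S_eq]; nlinarith [h.z_le, h.y_nonneg]
  have a2 : (k * T - w) * (z - y) ≤ (k * T - w) * S :=
    mul_le_mul_of_nonneg_left a1 (by nlinarith [h.w_le])
  have a3 : 0 < (T + y) * S := mul_pos (by nlinarith [h.y_nonneg]) (by linarith)
  nlinarith

theorem area_small_pos (h : NearScales k E T U S y w v P R z) :
    0 < area (S, y) (S + k * T - w, -(k + 1) * T + w) (S + k * T + v, (k + 1) * T + v) := by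
  have hE := h.E_ge
  have hk := h.ten_le
  have hT := h.T_ge
  have hT0 : 0 < T := by linarith
  have hkT : 10 * T ≤ k * T := by nlinarith
  simp only [area]
  have a1 : 0 < (k * T - w) * ((k + 1) * T + v - y) :=
    mul_pos (by linarith [h.w_le]) (by linarith [h.v_nonneg, h.y_le])
  have a2 : 0 < ((k + 1) * T - w + y) * (k * T + v) :=
    mul_pos (by linarith [h.w_le, h.y_nonneg]) (by linarith [h.v_nonneg])
  linarith

/-- The other two vertices of the large triangle always lie beyond the upper edge of the small one,
so the position of `P` alone decides whether the line of this edge separates. -/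
theorem not_meet_of_upper (h : NearScales k E T U S y w v P R z)
    (hP : 0 < area (S, y) (S + k * T + v, (k + 1) * T + v) P) :
    ¬ Meet (smallTriangle k T S y w v) (largeTriangle P R z) := by
  intro hm
  refine not_meet_of_area (S, y) (S + k * T + v, (k + 1) * T + v) (fun i => ?_) (fun i => ?_)
    hm.symm
  · fin_cases i
    · exact hP
    · exact h.upper_Z
    · exact h.upper_R
  · have := h.area_small_pos
    fin_cases i
    · simp [smallTriangle, area]
    · simp only [smallTriangle, area] at *
      simp only [Fin.mk_one, Matrix.cons_val_one, Matrix.cons_val_zero]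
      linarith
    · simp [smallTriangle, area]; linarith

theorem not_meet_of_lower (h : NearScales k E T U S y w v P R z)
    (hP : area (S, y) (S + k * T - w, -(k + 1) * T + w) P < 0) :
    ¬ Meet (smallTriangle k T S y w v) (largeTriangle P R z) := by
  intro hm
  refine not_meet_of_area (S + k * T - w, -(k + 1) * T + w) (S, y) (fun i => ?_) (fun i => ?_)
    hm.symm
  · rw [area_swap, neg_pos]
    fin_cases i
    · exact hP
    · exact h.lower_Z
    · exact h.lower_R
  · rw [area_swap, neg_nonpos]
    have := h.area_small_pos
    fin_cases i
    · simp [smallTriangle, area]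
    · simp [smallTriangle, area]; linarith
    · exact this.le

theorem meet_of_P_mem (h : NearScales k E T U S y w v P R z)
    (h₁ : 0 ≤ area (S + k * T - w, -(k + 1) * T + w) (S + k * T + v, (k + 1) * T + v) P)
    (h₂ : area (S, y) (S + k * T + v, (k + 1) * T + v) P ≤ 0)
    (h₃ : 0 ≤ area (S, y) (S + k * T - w, -(k + 1) * T + w) P) :
    Meet (smallTriangle k T S y w v) (largeTriangle P R z) := by
  refine meet_of_vertex_mem 0 h.area_small_pos h₁ ?_ h₃
  simp only [smallTriangle, largeTriangle, Matrix.cons_val]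
  rw [area_swap, neg_nonneg]
  exact h₂

end NearScales

namespace NearScales

variable {k E T U S y w v z a b : ℝ} {P R : ℝ × ℝ}

theorem bounds (h : NearScales k E T U S y w v P R z) : 22 ≤ E ∧ 2200 * E ≤ T ∧
    100 * (E * E) = T ∧ 2200 * (E * T) ≤ U ∧ 100 * (E * E * T) ≤ U ∧ 10 * T ≤ k * T ∧
    2 * (k * T + T) ≤ E * T ∧ 10 * U ≤ S := by
  have hE := h.E_ge
  have hk := h.ten_le
  have hT := h.T_ge
  have hT0 : 0 < T := by linarith
  have hU := h.ET_le
  have hU0 : 0 < U := by nlinarith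
  refine ⟨hE, hT, by rw [h.T_eq]; ring, hU, h.EET_le, by nlinarith, by linarith [h.kT_le], ?_⟩
  rw [h.S_eq]; nlinarith

theorem abs_mul_le {x y A B : ℝ} (hx : |x| ≤ A) (hy : |y| ≤ B) : |x * y| ≤ A * B := by
  rw [abs_mul]; exact mul_le_mul hx hy (abs_nonneg _) ((abs_nonneg _).trans hx)

theorem abs_sub_le_of_mem {x y A : ℝ} (hx : 0 ≤ x) (hx' : x ≤ A) (hy : 0 ≤ y) (hy' : y ≤ A) :
    |x - y| ≤ A := abs_le.2 ⟨by linarith, by linarith⟩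

/-! #### Contact at the front vertex -/

/-- The signed areas of `P` with the two edges at the front vertex are `T` times the linear forms in
`h₁` and `h₂`, up to errors of order `E ^ 2`. A margin of 1 suffices as `T = 100 * E ^ 2`. The third
edge is far away, so `P` lies in the small triangle. -/
theorem meet_front (h : NearScales k E T U S y w v P R z) (ha : 0 ≤ a) (ha' : a ≤ E) (hb : 0 ≤ b)
    (hb' : b ≤ E) (hP : P = (S + a, b)) (h₁ : k * b - k * y - (k + 1) * a ≤ -1)
    (h₂ : 1 ≤ k * b - k * y + (k + 1) * a) :
    Meet (smallTriangle k T S y w v) (largeTriangle P R z) := by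
  obtain ⟨hE, hT, hEE, hET, -, hkT, -, -⟩ := h.bounds
  have hk := h.ten_le
  have hT0 : 0 < T := by linarith
  have e1 := abs_le.1 (abs_mul_le (abs_sub_le_of_mem hb hb' h.y_nonneg h.y_le)
    (abs_le.2 ⟨by linarith [h.v_nonneg], h.v_le⟩ : |v| ≤ E))
  have e2 := abs_le.1 (abs_mul_le (abs_sub_le_of_mem h.v_nonneg h.v_le h.y_nonneg h.y_le)
    (abs_le.2 ⟨by linarith, ha'⟩ : |a| ≤ E))
  have e3 := abs_le.1 (abs_mul_le (abs_sub_le_of_mem hb hb' h.y_nonneg h.y_le)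
    (abs_le.2 ⟨by linarith [h.w_nonneg], h.w_le⟩ : |w| ≤ E))
  have e4 := abs_le.1 (abs_mul_le (abs_sub_le_of_mem h.y_nonneg h.y_le h.w_nonneg h.w_le)
    (abs_le.2 ⟨by linarith, ha'⟩ : |a| ≤ E))
  refine h.meet_of_P_mem ?_ ?_ ?_
  · rw [hP]
    simp only [area]
    have f1 : 0 ≤ (v + w) * (b + (k + 1) * T - w) :=
      mul_nonneg (by linarith [h.v_nonneg, h.w_nonneg]) (by linarith [h.w_le])
    have f2 : 0 ≤ (2 * (k + 1) * T + v - w) * (k * T - w - a) :=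
      mul_nonneg (by linarith [h.v_nonneg, h.w_le]) (by linarith [h.w_le])
    linarith
  · rw [hP]
    simp only [area]
    have f1 := mul_le_mul_of_nonneg_left h₁ hT0.le
    linarith
  · rw [hP]
    simp only [area]
    have f1 := mul_le_mul_of_nonneg_left h₂ hT0.le
    linarith

/-- If one of the linear forms has the wrong sign, the line of the corresponding edge of the small
triangle separates. -/
theorem not_meet_front (h : NearScales k E T U S y w v P R z) (ha : 0 ≤ a) (ha' : a ≤ E)
    (hb : 0 ≤ b) (hb' : b ≤ E) (hP : P = (S + a, b))
    (hg : 1 ≤ k * b - k * y - (k + 1) * a ∨ k * b - k * y + (k + 1) * a ≤ -1) :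
    ¬ Meet (smallTriangle k T S y w v) (largeTriangle P R z) := by
  obtain ⟨hE, hT, hEE, hET, -, hkT, -, -⟩ := h.bounds
  have hk := h.ten_le
  have hT0 : 0 < T := by linarith
  have e1 := abs_le.1 (abs_mul_le (abs_sub_le_of_mem hb hb' h.y_nonneg h.y_le)
    (abs_le.2 ⟨by linarith [h.v_nonneg], h.v_le⟩ : |v| ≤ E))
  have e2 := abs_le.1 (abs_mul_le (abs_sub_le_of_mem h.v_nonneg h.v_le h.y_nonneg h.y_le)
    (abs_le.2 ⟨by linarith, ha'⟩ : |a| ≤ E))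
  have e3 := abs_le.1 (abs_mul_le (abs_sub_le_of_mem hb hb' h.y_nonneg h.y_le)
    (abs_le.2 ⟨by linarith [h.w_nonneg], h.w_le⟩ : |w| ≤ E))
  have e4 := abs_le.1 (abs_mul_le (abs_sub_le_of_mem h.y_nonneg h.y_le h.w_nonneg h.w_le)
    (abs_le.2 ⟨by linarith, ha'⟩ : |a| ≤ E))
  rcases hg with hg | hg
  · refine h.not_meet_of_upper ?_
    rw [hP]
    simp only [area]
    have f1 := mul_le_mul_of_nonneg_left hg hT0.le
    linarith
  · refine h.not_meet_of_lower ?_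
    rw [hP]
    simp only [area]
    have f1 := mul_le_mul_of_nonneg_left hg hT0.le
    linarith

/-! #### Contact at the upper vertex -/

/-- The vertex moves by `(v, v)` while the edge has slope about `(k + 1) / k`; only the difference
of the slopes counts, which gives `v` the coefficient 1. -/
theorem area_upper_le (h : NearScales k E T U S y w v P R z) (ha : 0 ≤ a) (ha' : a ≤ E)
    (hb : 0 ≤ b) (hb' : b ≤ E) :
    |area (S, y) (S + k * T + v, (k + 1) * T + v) (S + k * T + a, (k + 1) * T + b) -
      T * (v + k * b - (k + 1) * a)| ≤ 2 * (E * E) := by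
  have e1 := abs_le.1 (abs_mul_le (abs_sub_le_of_mem hb hb' h.v_nonneg h.v_le)
    (abs_le.2 ⟨by linarith [h.v_nonneg, h.E_ge], h.v_le⟩ : |v| ≤ E))
  have e2 := abs_le.1 (abs_mul_le (abs_sub_le_of_mem h.v_nonneg h.v_le h.y_nonneg h.y_le)
    (abs_sub_le_of_mem ha ha' h.v_nonneg h.v_le))
  simp only [area]
  rw [abs_le]
  constructor <;> linarith

/-- By `h₁` the upper vertex lies above the bottom edge of the large triangle, by `h₂` the point `P`
lies below the line of the upper edge. Either `P` is to the left of the right edge and hence in the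
small triangle, or the bottom edge crosses the right edge. -/
theorem meet_upper (h : NearScales k E T U S y w v P R z) (ha : 0 ≤ a) (ha' : a ≤ E)
    (hb : 0 ≤ b) (hb' : b ≤ E) (hP : P = (S + k * T + a, (k + 1) * T + b))
    (h₁ : b + 1 ≤ v) (h₂ : v + k * b - (k + 1) * a ≤ -1) (hva : 1 ≤ v - a ∨ v ≤ a) :
    Meet (smallTriangle k T S y w v) (largeTriangle P R z) := by
  obtain ⟨hE, hT, hEE, hET, hEET, hkT, hkT', hS⟩ := h.bounds
  have hk := h.ten_le
  have hT0 : 0 < T := by linarith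
  have e1 := abs_le.1 (h.area_upper_le ha ha' hb hb')
  have f1 := mul_le_mul_of_nonneg_left h₂ hT0.le
  have hRl : R.1 ≤ -S := h.R_le
  have hPx : P.1 = S + k * T + a := by rw [hP]
  have hPy : P.2 = (k + 1) * T + b := by rw [hP]
  rcases hva with hva | hva
  · refine h.meet_of_P_mem ?_ ?_ ?_
    · rw [hP]
      simp only [area]
      have g1 : 0 ≤ (2 * (k + 1) * T + v - w) * (v - a - 1) :=
        mul_nonneg (by linarith [h.v_nonneg, h.w_le]) (by linarith)
      have g2 := abs_le.1 (abs_mul_le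
        (abs_le.2 ⟨by linarith [h.v_nonneg, h.w_nonneg], by linarith [h.v_le, h.w_le]⟩ :
          |v + w| ≤ 2 * E) (abs_sub_le_of_mem hb hb' h.v_nonneg h.v_le))
      linarith [h.v_nonneg, h.w_le]
    · rw [hP]; linarith
    · rw [hP]
      simp only [area]
      have g1 : 0 ≤ (k * T - w) * ((k + 1) * T + b - y) :=
        mul_nonneg (by linarith [h.w_le]) (by linarith [h.y_le])
      have g2 : 0 ≤ ((k + 1) * T - w + y) * (k * T + a) :=
        mul_nonneg (by linarith [h.w_le, h.y_nonneg]) (by linarith)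
      linarith
  · have hw0 : 2 * S ≤ P.1 - R.1 := by linarith
    have hsl : |P.2 - R.2| ≤ 2 * (E * T) :=
      abs_le.2 ⟨by linarith [h.P_low, h.R_high], by linarith [h.P_high, h.R_low]⟩
    have h2 : 0 ≤ area R P (S + k * T + v, (k + 1) * T + v) := by
      have e : area R P (S + k * T + v, (k + 1) * T + v) =
          (P.1 - R.1) * (v - b) - (P.2 - R.2) * (v - a) := by
        rw [hPx, hPy]; simp only [area]; rw [hPx, hPy]; ring
      have g1 : 2 * S * 1 ≤ (P.1 - R.1) * (v - b) :=
        mul_le_mul hw0 (by linarith) (by norm_num) (by linarith)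
      have g2 := abs_le.1 (abs_mul_le hsl (abs_sub_le_of_mem h.v_nonneg h.v_le ha ha'))
      rw [e]; linarith
    have h1 : area R P (S + k * T - w, -(k + 1) * T + w) < 0 := by
      have e : area R P (S + k * T - w, -(k + 1) * T + w) =
          -((P.1 - R.1) * (2 * (k + 1) * T + b - w)) + (P.2 - R.2) * (w + a) := by
        simp only [area]; rw [hPx, hPy]; ring
      have g1 : 2 * S * 1 ≤ (P.1 - R.1) * (2 * (k + 1) * T + b - w) :=
        mul_le_mul hw0 (by linarith [h.w_le]) (by norm_num) (by linarith)
      have g2 := abs_le.1 (abs_mul_le hsl (abs_le.2 ⟨by linarith [h.w_nonneg],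
        by linarith [h.w_le]⟩ : |w + a| ≤ 2 * E))
      rw [e]; linarith
    refine meet_of_crossing h2 h1 ?_ ?_ ?_ ?_
    · simp [smallTriangle, largeTriangle]; linarith [h.w_le]
    · simp [smallTriangle, largeTriangle]; linarith [h.v_nonneg]
    · simp [largeTriangle]; linarith
    · simp only [smallTriangle, largeTriangle, Matrix.cons_val]
      rw [hPx]
      have g1 := mul_nonneg h2 (by linarith [h.w_nonneg] : 0 ≤ w + a)
      have g2 := mul_nonneg (neg_nonneg.2 h1.le) (by linarith : 0 ≤ a - v)
      linarith

/-- In the first case the small triangle lies below the bottom edge of the large one; in the second,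
the line of its own upper edge separates. -/
theorem not_meet_upper (h : NearScales k E T U S y w v P R z) (ha : 0 ≤ a) (ha' : a ≤ E)
    (hb : 0 ≤ b) (hb' : b ≤ E) (hP : P = (S + k * T + a, (k + 1) * T + b))
    (hg : v + 1 ≤ b ∨ 1 ≤ v + k * b - (k + 1) * a) :
    ¬ Meet (smallTriangle k T S y w v) (largeTriangle P R z) := by
  obtain ⟨hE, hT, hEE, hET, hEET, hkT, hkT', hS⟩ := h.bounds
  have hk := h.ten_le
  have hT0 : 0 < T := by linarith
  have hRl : R.1 ≤ -S := h.R_le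
  have hPx : P.1 = S + k * T + a := by rw [hP]
  have hPy : P.2 = (k + 1) * T + b := by rw [hP]
  rcases hg with hg | hg
  · have hw0 : 2 * S ≤ P.1 - R.1 := by linarith
    have hsl : |P.2 - R.2| ≤ 2 * (E * T) :=
      abs_le.2 ⟨by linarith [h.P_low, h.R_high], by linarith [h.P_high, h.R_low]⟩
    intro hm
    refine not_meet_of_area P R (fun i => ?_) (fun i => ?_) hm
    · rw [area_swap, neg_pos]
      fin_cases i
      · simp only [smallTriangle, Fin.zero_eta, Matrix.cons_val_zero]
        have e : area R P (S, y) =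
            -((P.1 - R.1) * ((k + 1) * T + b - y)) + (P.2 - R.2) * (k * T + a) := by
          simp only [area]; rw [hPx, hPy]; ring
        have g1 : 2 * S * (k * T + a) ≤ (P.1 - R.1) * ((k + 1) * T + b - y) :=
          mul_le_mul hw0 (by linarith [h.y_le]) (by linarith) (by linarith)
        have g2 := mul_le_mul_of_nonneg_right (abs_le.1 hsl).2 (by linarith : 0 ≤ k * T + a)
        have g3 : 0 < (2 * S - 2 * (E * T)) * (k * T + a) :=
          mul_pos (by linarith) (by linarith)
        rw [e]; linarith
      · have e : area R P (S + k * T - w, -(k + 1) * T + w) =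
            -((P.1 - R.1) * (2 * (k + 1) * T + b - w)) + (P.2 - R.2) * (w + a) := by
          simp only [area]; rw [hPx, hPy]; ring
        have g1 : 2 * S * 1 ≤ (P.1 - R.1) * (2 * (k + 1) * T + b - w) :=
          mul_le_mul hw0 (by linarith [h.w_le]) (by norm_num) (by linarith)
        have g2 := abs_le.1 (abs_mul_le hsl (abs_le.2 ⟨by linarith [h.w_nonneg],
          by linarith [h.w_le]⟩ : |w + a| ≤ 2 * E))
        have : area R P (S + k * T - w, -(k + 1) * T + w) < 0 := by rw [e]; linarith
        simpa [smallTriangle] using this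
      · have e : area R P (S + k * T + v, (k + 1) * T + v) =
            -((P.1 - R.1) * (b - v)) - (P.2 - R.2) * (v - a) := by
          simp only [area]; rw [hPx, hPy]; ring
        have g1 : 2 * S * 1 ≤ (P.1 - R.1) * (b - v) :=
          mul_le_mul hw0 (by linarith) (by norm_num) (by linarith)
        have g2 := abs_le.1 (abs_mul_le hsl (abs_sub_le_of_mem h.v_nonneg h.v_le ha ha'))
        have : area R P (S + k * T + v, (k + 1) * T + v) < 0 := by rw [e]; linarith
        simpa [smallTriangle] using this
    · rw [area_swap, neg_nonpos]
      fin_cases i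
      · simp [largeTriangle, area]; linarith
      · exact h.area_R_P_Z.le
      · simp [largeTriangle, area]
  · refine h.not_meet_of_upper ?_
    have e1 := abs_le.1 (h.area_upper_le ha ha' hb hb')
    have f1 := mul_le_mul_of_nonneg_left hg hT0.le
    rw [hP]; linarith

end NearScales

namespace NearScales

variable {k E T U S y w v z a b : ℝ} {P R : ℝ × ℝ}

/-! #### Contact at the lower vertex -/

theorem area_lower_le (h : NearScales k E T U S y w v P R z) (ha : 0 ≤ a) (ha' : a ≤ E)
    (hb : 0 ≤ b) (hb' : b ≤ E) :
    |area (S, y) (S + k * T - w, -(k + 1) * T + w) (S + k * T - a, -(k + 1) * T + b) -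
      T * (w + k * b - (k + 1) * a)| ≤ 2 * (E * E) := by
  have e1 := abs_le.1 (abs_mul_le (abs_sub_le_of_mem hb hb' h.w_nonneg h.w_le)
    (abs_le.2 ⟨by linarith [h.w_nonneg, h.E_ge], h.w_le⟩ : |w| ≤ E))
  have e2 := abs_le.1 (abs_mul_le (abs_sub_le_of_mem h.y_nonneg h.y_le h.w_nonneg h.w_le)
    (abs_sub_le_of_mem h.w_nonneg h.w_le ha ha'))
  simp only [area]
  rw [abs_le]
  constructor <;> linarith

/-- The position of the lower vertex relative to the right edge of a large triangle. -/
theorem area_right_le (h : NearScales k E T U S y w v P R z) (ha : 0 ≤ a) (ha' : a ≤ E)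
    (hb : 0 ≤ b) (hb' : b ≤ E) (hP : P = (S + k * T - a, -(k + 1) * T + b)) :
    |area P (0, z) (S + k * T - w, -(k + 1) * T + w) + U * (w - k * b + (k - 1) * a)| ≤
      2 * (E * E * T) := by
  obtain ⟨hE, hT, hEE, hET, hEET, hkT, hkT', hS⟩ := h.bounds
  have e1 := abs_le.1 (abs_mul_le (abs_le.2 ⟨by linarith, by linarith⟩ : |k * T - a| ≤ E * T)
    (abs_sub_le_of_mem hb hb' h.w_nonneg h.w_le))
  -- The height of the right edge is about `(k - 1) * U` over a width of about `k * U`; its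
  -- deviation from these values only produces an error of order `E * E * T`.
  have e2 := abs_le.1 (abs_mul_le (abs_le.2 ⟨by linarith [h.le_z], by linarith [h.z_le]⟩ :
    |z - (k - 1) * U + (k + 1) * T - b| ≤ E * T) (abs_sub_le_of_mem h.w_nonneg h.w_le ha ha'))
  rw [hP]
  simp only [area]
  rw [h.S_eq, abs_le]
  constructor <;> linarith

/-- By `h₁` the point `P` lies above the lower edge of the small triangle, by `h₂` the lower vertex
lies below the right edge of the large one. For `w ≤ a` the small triangle contains `P`. Otherwise,
the lower vertex is either below the bottom edge, which then crosses the right edge of the small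
triangle, or inside the large triangle. -/
theorem meet_lower (h : NearScales k E T U S y w v P R z) (ha : 0 ≤ a) (ha' : a ≤ E)
    (hab : a ≤ b) (hb' : b ≤ E) (hP : P = (S + k * T - a, -(k + 1) * T + b))
    (h₁ : 1 ≤ w + k * b - (k + 1) * a) (h₂ : w - k * b + (k - 1) * a ≤ -1)
    (hwa : w ≤ a ∨ a + 1 ≤ w) :
    Meet (smallTriangle k T S y w v) (largeTriangle P R z) := by
  obtain ⟨hE, hT, hEE, hET, hEET, hkT, hkT', hS⟩ := h.bounds
  have hk := h.ten_le
  have hT0 : 0 < T := by linarith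
  have hb : 0 ≤ b := ha.trans hab
  have e1 := abs_le.1 (h.area_lower_le ha ha' hb hb')
  have f1 := mul_le_mul_of_nonneg_left h₁ hT0.le
  have hRl : R.1 ≤ -S := h.R_le
  have hPx : P.1 = S + k * T - a := by rw [hP]
  have hPy : P.2 = -(k + 1) * T + b := by rw [hP]
  rcases hwa with hwa | hwa
  · refine h.meet_of_P_mem ?_ ?_ ?_
    · rw [hP]
      simp only [area]
      have g1 : 0 ≤ (v + w) * (b - w) :=
        mul_nonneg (by linarith [h.v_nonneg, h.w_nonneg]) (by linarith)
      have g2 : 0 ≤ (2 * (k + 1) * T + v - w) * (a - w) :=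
        mul_nonneg (by linarith [h.v_nonneg, h.w_le]) (by linarith)
      linarith
    · rw [hP]
      simp only [area]
      have g1 : 0 ≤ (k * T + v) * ((k + 1) * T + y - b) :=
        mul_nonneg (by linarith [h.v_nonneg]) (by linarith [h.y_nonneg])
      have g2 : 0 ≤ ((k + 1) * T + v - y) * (k * T - a) :=
        mul_nonneg (by linarith [h.v_nonneg, h.y_le]) (by linarith)
      linarith
    · rw [hP]; linarith
  · have hw0 : 2 * S ≤ P.1 - R.1 := by linarith
    have hsl : |P.2 - R.2| ≤ 2 * (E * T) :=
      abs_le.2 ⟨by linarith [h.P_low, h.R_high], by linarith [h.P_high, h.R_low]⟩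
    have eV3 : area R P (S + k * T - w, -(k + 1) * T + w) =
        -((P.1 - R.1) * (b - w)) + (P.2 - R.2) * (w - a) := by
      simp only [area]; rw [hPx, hPy]; ring
    have g2 := abs_le.1 (abs_mul_le hsl (abs_sub_le_of_mem h.w_nonneg h.w_le ha ha'))
    rcases lt_or_ge (area R P (S + k * T - w, -(k + 1) * T + w)) 0 with h1 | h1
    · have eV2 : area R P (S + k * T + v, (k + 1) * T + v) =
          (P.1 - R.1) * (2 * (k + 1) * T + v - b) - (P.2 - R.2) * (v + a) := by
        simp only [area]; rw [hPx, hPy]; ring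
      have g3 := abs_le.1 (abs_mul_le hsl (abs_le.2 ⟨by linarith [h.v_nonneg],
          by linarith [h.v_le]⟩ : |v + a| ≤ 2 * E))
      have g4 : (P.1 - R.1) * (b - w) ≤ (P.1 - R.1) * E :=
        mul_le_mul_of_nonneg_left (by linarith [h.w_nonneg]) (by linarith)
      have g5 : (P.1 - R.1) * T ≤ (P.1 - R.1) * (2 * (k + 1) * T + v - b) :=
        mul_le_mul_of_nonneg_left (by linarith [h.v_nonneg]) (by linarith)
      have g6 : 2 * S * (T - 2 * (E * E)) ≤ (P.1 - R.1) * (T - 2 * (E * E)) :=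
        mul_le_mul_of_nonneg_right hw0 (by linarith)
      have g7 : 2 * S * 1 ≤ 2 * S * (T - 2 * (E * E) - 10 * E) :=
        mul_le_mul_of_nonneg_left (by linarith) (by linarith)
      have g8 : 0 ≤ (S - E * E * T) * E := mul_nonneg (by linarith) (by linarith)
      -- The upper vertex is about `2 * (k + 1) * T` above the bottom edge, the lower one only by
      -- order `E` below it. As `T = 100 * E ^ 2`, the ratio exceeds `2 * E`, so the crossing is
      -- close enough to the lower vertex to be left of `P`.
      have key : 2 * E * -area R P (S + k * T - w, -(k + 1) * T + w) ≤
          area R P (S + k * T + v, (k + 1) * T + v) := by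
        have i1 : -area R P (S + k * T - w, -(k + 1) * T + w) ≤
            (P.1 - R.1) * E + 2 * (E * T) * E := by rw [eV3]; linarith
        have i2 := mul_le_mul_of_nonneg_left i1 (by linarith : 0 ≤ 2 * E)
        have i3 : 0 ≤ E * S := mul_nonneg (by linarith) (by linarith)
        rw [eV2]; linarith
      have hpos : 0 ≤ -area R P (S + k * T - w, -(k + 1) * T + w) := by linarith
      have h2 : 0 ≤ area R P (S + k * T + v, (k + 1) * T + v) :=
        le_trans (mul_nonneg (by linarith) hpos) key
      refine meet_of_crossing h2 h1 ?_ ?_ ?_ ?_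
      · simp [smallTriangle, largeTriangle]; linarith [h.w_le]
      · simp [smallTriangle, largeTriangle]; linarith [h.v_nonneg]
      · simp [largeTriangle]; linarith
      · simp only [smallTriangle, largeTriangle, Matrix.cons_val]
        rw [hPx]
        have i1 := mul_nonneg h2 (by linarith : 0 ≤ w - a - 1)
        have i2 := mul_nonneg hpos (by linarith [h.v_le, h.w_le] : 0 ≤ 2 * E - v - w)
        have i3 := mul_nonneg hpos (by linarith : 0 ≤ w - a)
        linarith
    · refine Meet.symm (meet_of_vertex_mem 1 h.area_P_Z_R ?_ ?_ ?_)
      · simp only [smallTriangle, largeTriangle, Matrix.cons_val, area]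
        have i1 : 0 ≤ -R.1 * (z + (k + 1) * T - w) := mul_nonneg (by linarith) (by
          have : 0 ≤ (k - 1) * U := mul_nonneg (by linarith) (by linarith)
          linarith [h.le_z, h.w_le])
        have i2 : 0 ≤ (z - R.2) * (S + k * T - w) := mul_nonneg (by
          have : 0 ≤ (k - 2) * U := mul_nonneg (by linarith) (by linarith)
          linarith [h.le_z, h.R_high]) (by linarith [h.w_le])
        linarith
      · exact h1
      · have i1 := abs_le.1 (h.area_right_le ha ha' hb hb' hP)
        have i2 := mul_le_mul_of_nonneg_left h₂ (by linarith : 0 ≤ U)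
        simp only [smallTriangle, largeTriangle, Matrix.cons_val]
        linarith

/-- The line of the lower edge of the small triangle separates in the first case, that of the right
edge of the large triangle in the second. The latter has slope about `-(k - 1) / k`, flatter than
the lower edge, so the front vertex is beyond it too. -/
theorem not_meet_lower (h : NearScales k E T U S y w v P R z) (ha : 0 ≤ a) (ha' : a ≤ E)
    (hb : 0 ≤ b) (hb' : b ≤ E) (hP : P = (S + k * T - a, -(k + 1) * T + b))
    (hg : w + k * b - (k + 1) * a ≤ -1 ∨ 1 ≤ w - k * b + (k - 1) * a) :
    ¬ Meet (smallTriangle k T S y w v) (largeTriangle P R z) := by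
  obtain ⟨hE, hT, hEE, hET, hEET, hkT, hkT', hS⟩ := h.bounds
  have hk := h.ten_le
  have hT0 : 0 < T := by linarith
  have hPx : P.1 = S + k * T - a := by rw [hP]
  have hPy : P.2 = -(k + 1) * T + b := by rw [hP]
  rcases hg with hg | hg
  · refine h.not_meet_of_lower ?_
    have e1 := abs_le.1 (h.area_lower_le ha ha' hb hb')
    have f1 := mul_le_mul_of_nonneg_left hg hT0.le
    rw [hP]; linarith
  · intro hm
    have hzP : 0 ≤ z - P.2 := by
      have : 0 ≤ (k - 2) * U := mul_nonneg (by linarith) (by linarith)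
      linarith [h.le_z, h.P_high]
    refine not_meet_of_area (0, z) P (fun i => ?_) (fun i => ?_) hm
    · rw [area_swap, neg_pos]
      fin_cases i
      · have e : area P (0, z) (S, y) =
            -(P.1 * ((k + 1) * T + y - b)) + (z - P.2) * (k * T - a) := by
          simp only [area]; rw [hPx, hPy]; ring
        have g1 : S * (k * T + T - E) ≤ P.1 * ((k + 1) * T + y - b) :=
          mul_le_mul (by linarith) (by linarith [h.y_nonneg]) (by linarith) (by linarith)
        have g2 : (z - P.2) * (k * T - a) ≤ (z - P.2) * (k * T) :=
          mul_le_mul_of_nonneg_left (by linarith) hzP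
        have g3 : (z - P.2) * (k * T) ≤ ((k - 1) * U + E * T) * (k * T) :=
          mul_le_mul_of_nonneg_right (by linarith [h.z_le]) (by linarith)
        have g4 : 0 < (U - E * T) * (k * T) := mul_pos (by linarith) (by linarith)
        have g5 : 0 ≤ S * (T - E) := mul_nonneg (by linarith) (by linarith)
        have eS : S * (k * T) = k * U * (k * T) := by rw [h.S_eq]
        have : area P (0, z) (S, y) < 0 := by rw [e]; linarith
        simpa [smallTriangle] using this
      · have i1 := abs_le.1 (h.area_right_le ha ha' hb hb' hP)
        have i2 := mul_le_mul_of_nonneg_left hg (by linarith : 0 ≤ U)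
        have : area P (0, z) (S + k * T - w, -(k + 1) * T + w) < 0 := by linarith
        simpa [smallTriangle] using this
      · have e : area P (0, z) (S + k * T + v, (k + 1) * T + v) =
            -(P.1 * (2 * (k + 1) * T + v - b)) - (z - P.2) * (v + a) := by
          simp only [area]; rw [hPx, hPy]; ring
        have g1 : 0 < P.1 * (2 * (k + 1) * T + v - b) :=
          mul_pos (by linarith) (by linarith [h.v_nonneg])
        have g2 : 0 ≤ (z - P.2) * (v + a) := mul_nonneg hzP (by linarith [h.v_nonneg])
        have : area P (0, z) (S + k * T + v, (k + 1) * T + v) < 0 := by rw [e]; linarith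
        simpa [smallTriangle] using this
    · rw [area_swap, neg_nonpos]
      fin_cases i
      · simp [largeTriangle, area]
      · simp [largeTriangle, area]; linarith
      · exact h.area_P_Z_R.le

end NearScales

/-! ### The scales as functions of the size -/

/-- The bound for the perturbations of the vertices. -/
def scaleE (k n : ℕ) : ℕ := 2 * (k + 1) * n ^ 3

/-- The size of the small triangles. -/
def scaleT (k n : ℕ) : ℕ := 100 * scaleE k n ^ 2

/-- The size of the large triangles, divided by `k`. -/
def scaleU (k n : ℕ) : ℕ := scaleT k n ^ 2

/-- The size of the large triangles. -/
def scaleS (k n : ℕ) : ℕ := k * scaleU k n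

theorem scales (k n : ℕ) (hk : 10 ≤ k) (hn : 1 ≤ n) :
    Scales (k : ℝ) (scaleE k n) (scaleT k n) (scaleU k n) (scaleS k n) where
  ten_le := by exact_mod_cast hk
  le_E := by
    have : 2 * (k + 1) * 1 ≤ scaleE k n := Nat.mul_le_mul_left _ (Nat.one_le_pow _ _ hn)
    rw [mul_one] at this
    exact_mod_cast this
  T_eq := by simp [scaleT]
  U_eq := by simp [scaleU]
  S_eq := by simp [scaleS]

/-- The number with base-`n` digits `x, y, z`, cyclically shifted by `i`. -/
def rot (n i x y z : ℕ) : ℕ :=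
  if i = 0 then (x * n + y) * n + z else if i = 1 then (y * n + z) * n + x else (z * n + x) * n + y

theorem digits_lt {n x y z : ℕ} (hx : x < n) (hy : y < n) (hz : z < n) :
    (x * n + y) * n + z < n ^ 3 := by
  have h1 : x * n + y + 1 ≤ n * n := by
    have := Nat.mul_le_mul_right n (Nat.succ_le_of_lt hx); rw [Nat.succ_mul] at this; omega
  have h2 := Nat.mul_le_mul_right n h1
  rw [Nat.add_mul, one_mul] at h2
  rw [show n ^ 3 = n * n * n by ring]; omega

theorem rot_lt {n x y z : ℕ} (i : ℕ) (hx : x < n) (hy : y < n) (hz : z < n) :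
    rot n i x y z < n ^ 3 := by
  unfold rot
  split_ifs
  · exact digits_lt hx hy hz
  · exact digits_lt hy hz hx
  · exact digits_lt hz hx hy

/-- The small triangle on the right with label `(x, y, z)`. -/
noncomputable def smallTri (k n x y z : ℕ) : Fin 3 → ℝ × ℝ :=
  smallTriangle k (scaleT k n) (scaleS k n) ((k + 1) * (2 * rot n 0 x y z + 1))
    (k * (2 * rot n 1 x y z + 1)) ((k + 1) * (2 * rot n 2 x y z + 1))

/-- The vertex of a large triangle that touches vertex `i` of those small triangles on the right
whose label, shifted by `i`, lies in `[l, l + c)`. -/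
noncomputable def tip (k n i l c : ℕ) : ℝ × ℝ :=
  if i = 0 then (scaleS k n + k * c, (k + 1) * (2 * l + c))
  else if i = 1 then (scaleS k n + k * scaleT k n - k * (2 * l + c),
    -(k + 1) * scaleT k n + (k * (2 * l + c) + c))
  else (scaleS k n + k * scaleT k n + (2 * k * l + 2 * (l + c)),
    (k + 1) * scaleT k n + 2 * (k + 1) * l)

/-- The reflection at the second coordinate axis. -/
def mirror (p : ℝ × ℝ) : ℝ × ℝ := (-p.1, p.2)

/-- The upper vertex of the large triangle with number `m`. -/
noncomputable def apex (k n m : ℕ) : ℝ := (k - 1) * scaleU k n + m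

/-- The large triangle with number `m` that touches intervals of small triangles on both sides. -/
noncomputable def largeTri (k n i l c j l' c' m : ℕ) : Fin 3 → ℝ × ℝ :=
  largeTriangle (tip k n i l c) (mirror (tip k n j l' c')) (apex k n m)

section
variable {k n : ℕ}

theorem pert_bounds {l c : ℕ} (h : l + c ≤ n ^ 3) :
    (2 * (k + 1) * (l + c) : ℝ) ≤ scaleE k n := by
  have : 2 * (k + 1) * (l + c) ≤ scaleE k n := Nat.mul_le_mul_left _ h
  exact_mod_cast this

theorem tip_bounds (hk : 10 ≤ k) (hn : 1 ≤ n) (i : ℕ) {l c : ℕ} (h : l + c ≤ n ^ 3) :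
    (scaleS k n : ℝ) ≤ (tip k n i l c).1 ∧
    (tip k n i l c).1 ≤ scaleS k n + k * scaleT k n + scaleE k n ∧
    |(tip k n i l c).2| ≤ (k + 1) * scaleT k n + scaleE k n ∧
    |(tip k n i l c).2| ≤ scaleE k n * scaleT k n := by
  have hs := scales k n hk hn
  have hb := pert_bounds (k := k) h
  have hkr := hs.ten_le
  have hT := hs.T_ge
  have hE := hs.E_ge
  have hkT := hs.kT_le
  have hET : (scaleE k n : ℝ) ≤ scaleE k n * scaleT k n / 2 := by nlinarith
  have hl : (0 : ℝ) ≤ l := Nat.cast_nonneg l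
  have hc : (0 : ℝ) ≤ c := Nat.cast_nonneg c
  have kl : 0 ≤ (k : ℝ) * l := by positivity
  have kc : 0 ≤ (k : ℝ) * c := by positivity
  have kT : (scaleT k n : ℝ) ≤ k * scaleT k n := by nlinarith
  have key : |(tip k n i l c).2| ≤ (k + 1) * scaleT k n + scaleE k n := by
    rw [abs_le]
    unfold tip
    split_ifs <;> constructor <;> dsimp only <;> nlinarith
  refine ⟨?_, ?_, key, by linarith⟩
  · unfold tip; split_ifs <;> dsimp only <;> nlinarith
  · unfold tip; split_ifs <;> dsimp only <;> nlinarith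

theorem nearScales (hk : 10 ≤ k) (hn : 1 ≤ n) {x y z : ℕ} (hx : x < n) (hy : y < n) (hz : z < n)
    (i j : ℕ) {l c l' c' m : ℕ} (h : l + c ≤ n ^ 3) (h' : l' + c' ≤ n ^ 3) (hm : m ≤ scaleE k n) :
    NearScales k (scaleE k n) (scaleT k n) (scaleU k n) (scaleS k n)
      ((k + 1) * (2 * rot n 0 x y z + 1)) (k * (2 * rot n 1 x y z + 1))
      ((k + 1) * (2 * rot n 2 x y z + 1)) (tip k n i l c) (mirror (tip k n j l' c'))
      (apex k n m) := by
  have e : ∀ i, (2 * rot n i x y z + 1 : ℝ) ≤ 2 * (n : ℝ) ^ 3 := fun i => by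
    have := rot_lt i hx hy hz
    exact_mod_cast (by omega : 2 * rot n i x y z + 1 ≤ 2 * n ^ 3)
  have hE : (scaleE k n : ℝ) = (k + 1) * (2 * (n : ℝ) ^ 3) := by simp [scaleE]; ring
  have up : ∀ i, (k + 1) * (2 * rot n i x y z + 1 : ℝ) ≤ scaleE k n := fun i => by
    rw [hE]; exact mul_le_mul_of_nonneg_left (e i) (by positivity)
  have t1 := tip_bounds hk hn i h
  have t2 := tip_bounds hk hn j h'
  exact
  { scales k n hk hn with
    y_nonneg := by positivity
    y_le := up 0
    w_nonneg := by positivity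
    w_le := le_trans (by gcongr; linarith) (up 1)
    v_nonneg := by positivity
    v_le := up 2
    le_P := t1.1
    P_low := (abs_le.1 t1.2.2.2).1
    P_high := (abs_le.1 t1.2.2.2).2
    R_le := by simp only [mirror]; linarith [t2.1]
    R_low := (abs_le.1 t2.2.2.2).1
    R_high := (abs_le.1 t2.2.2.2).2
    le_z := by simp [apex]
    z_le := by simp only [apex]; gcongr }

/-- With `r = rot n i x y z`, the two quantities that decide a contact become, up to sign, `2 * l -
2 * r - 1` and `2 * l + 2 * c - 2 * r - 1`, multiplied by `k * (k + 1)`, `k` or `k + 1`. Being odd,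
these integers differ from 0 by at least the margin 1 that the contact lemmas require, and their
signs compare `r` with the two ends of the interval. -/
theorem meet_small_large_iff (hk : 10 ≤ k) (hn : 1 ≤ n) {x y z : ℕ} (hx : x < n) (hy : y < n)
    (hz : z < n) {i : ℕ} (j : ℕ) (hi : i < 3) {l c l' c' m : ℕ} (h : l + c ≤ n ^ 3)
    (h' : l' + c' ≤ n ^ 3) (hm : m ≤ scaleE k n) :
    Meet (smallTri k n x y z) (largeTri k n i l c j l' c' m) ↔
      l ≤ rot n i x y z ∧ rot n i x y z < l + c := by
  have H := nearScales hk hn hx hy hz i j h h' hm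
  have hb := pert_bounds (k := k) h
  have hkr := H.ten_le
  have hl : (0 : ℝ) ≤ l := Nat.cast_nonneg l
  have hc : (0 : ℝ) ≤ c := Nat.cast_nonneg c
  have kl : 0 ≤ (k : ℝ) * l := by positivity
  have kc : 0 ≤ (k : ℝ) * c := by positivity
  have up : ∀ a b : ℕ, a < b → (a : ℝ) + 1 ≤ b := fun a b hab => by exact_mod_cast hab
  have mulpos : ∀ κ s : ℝ, 1 ≤ κ → 1 ≤ s → 1 ≤ κ * s := fun κ s h1 h2 =>
    one_le_mul_of_one_le_of_one_le h1 h2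
  have hkk : 1 ≤ (k : ℝ) * (k + 1) := by nlinarith
  interval_cases i
  · have hP : tip k n 0 l c = ((scaleS k n + k * c : ℝ), ((k + 1) * (2 * l + c) : ℝ)) := rfl
    have a1 : (0 : ℝ) ≤ k * c := kc
    have a2 : (k * c : ℝ) ≤ scaleE k n := by nlinarith
    have a3 : (0 : ℝ) ≤ (k + 1) * (2 * l + c) := by positivity
    have a4 : ((k + 1) * (2 * l + c) : ℝ) ≤ scaleE k n := by nlinarith
    constructor
    · intro hmeet
      by_contra hcon
      refine H.not_meet_front a1 a2 a3 a4 hP ?_ hmeet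
      rcases Nat.lt_or_ge (rot n 0 x y z) l with h1 | h1
      · have := mulpos _ (2 * l - 2 * rot n 0 x y z - 1) hkk (by linarith [up _ _ h1])
        left; linarith
      · have h2 : l + c ≤ rot n 0 x y z := by omega
        have h2' : (l + c : ℝ) ≤ rot n 0 x y z := by exact_mod_cast h2
        have := mulpos _ (2 * rot n 0 x y z + 1 - 2 * l - 2 * c) hkk (by linarith)
        right; linarith
    · rintro ⟨h1, h2⟩
      have h1' : (l : ℝ) ≤ rot n 0 x y z := by exact_mod_cast h1
      have h2' : (rot n 0 x y z : ℝ) + 1 ≤ l + c := by exact_mod_cast h2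
      refine H.meet_front a1 a2 a3 a4 hP ?_ ?_
      · have := mulpos _ (2 * rot n 0 x y z + 1 - 2 * l) hkk (by linarith)
        linarith
      · have := mulpos _ (2 * l + 2 * c - 2 * rot n 0 x y z - 1) hkk (by linarith)
        linarith
  · have hP : tip k n 1 l c = ((scaleS k n + k * scaleT k n - k * (2 * l + c) : ℝ),
      (-(k + 1) * scaleT k n + (k * (2 * l + c) + c) : ℝ)) := rfl
    have a1 : (0 : ℝ) ≤ k * (2 * l + c) := by positivity
    have a2 : (k * (2 * l + c) : ℝ) ≤ scaleE k n := by nlinarith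
    have a3 : (k * (2 * l + c) : ℝ) ≤ k * (2 * l + c) + c := by linarith
    have a4 : (k * (2 * l + c) + c : ℝ) ≤ scaleE k n := by nlinarith
    constructor
    · intro hmeet
      by_contra hcon
      refine H.not_meet_lower a1 a2 (a1.trans a3) a4 hP ?_ hmeet
      rcases Nat.lt_or_ge (rot n 1 x y z) l with h1 | h1
      · have := mulpos _ (2 * l - 2 * rot n 1 x y z - 1) (by linarith : 1 ≤ (k : ℝ))
          (by linarith [up _ _ h1])
        left; linarith
      · have h2 : l + c ≤ rot n 1 x y z := by omega
        have h2' : (l + c : ℝ) ≤ rot n 1 x y z := by exact_mod_cast h2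
        have := mulpos _ (2 * rot n 1 x y z + 1 - 2 * l - 2 * c) (by linarith : 1 ≤ (k : ℝ))
          (by linarith)
        right; linarith
    · rintro ⟨h1, h2⟩
      have h1' : (l : ℝ) ≤ rot n 1 x y z := by exact_mod_cast h1
      have h2' : (rot n 1 x y z : ℝ) + 1 ≤ l + c := by exact_mod_cast h2
      refine H.meet_lower a1 a2 a3 a4 hP ?_ ?_ ?_
      · have := mulpos _ (2 * rot n 1 x y z + 1 - 2 * l) (by linarith : 1 ≤ (k : ℝ)) (by linarith)
        linarith
      · have := mulpos _ (2 * l + 2 * c - 2 * rot n 1 x y z - 1) (by linarith : 1 ≤ (k : ℝ))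
          (by linarith)
        linarith
      -- The two cases of the contact lemma are exhaustive because the perturbations are integers.
      · rcases Nat.lt_or_ge (k * (2 * l + c)) (k * (2 * rot n 1 x y z + 1)) with h3 | h3
        · right; exact_mod_cast h3
        · left; exact_mod_cast h3
  · have hP : tip k n 2 l c = ((scaleS k n + k * scaleT k n + (2 * k * l + 2 * (l + c)) : ℝ),
      ((k + 1) * scaleT k n + 2 * (k + 1) * l : ℝ)) := rfl
    have a1 : (0 : ℝ) ≤ 2 * k * l + 2 * (l + c) := by positivity
    have a2 : (2 * k * l + 2 * (l + c) : ℝ) ≤ scaleE k n := by nlinarith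
    have a3 : (0 : ℝ) ≤ 2 * (k + 1) * l := by positivity
    have a4 : (2 * (k + 1) * l : ℝ) ≤ scaleE k n := by nlinarith
    constructor
    · intro hmeet
      by_contra hcon
      refine H.not_meet_upper a1 a2 a3 a4 hP ?_ hmeet
      rcases Nat.lt_or_ge (rot n 2 x y z) l with h1 | h1
      · have := mulpos (k + 1) (2 * l - 2 * rot n 2 x y z - 1) (by linarith)
          (by linarith [up _ _ h1])
        left; linarith
      · have h2 : l + c ≤ rot n 2 x y z := by omega
        have h2' : (l + c : ℝ) ≤ rot n 2 x y z := by exact_mod_cast h2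
        have := mulpos (k + 1) (2 * rot n 2 x y z + 1 - 2 * l - 2 * c) (by linarith) (by linarith)
        right; linarith
    · rintro ⟨h1, h2⟩
      have h1' : (l : ℝ) ≤ rot n 2 x y z := by exact_mod_cast h1
      have h2' : (rot n 2 x y z : ℝ) + 1 ≤ l + c := by exact_mod_cast h2
      refine H.meet_upper a1 a2 a3 a4 hP ?_ ?_ ?_
      · have := mulpos (k + 1) (2 * rot n 2 x y z + 1 - 2 * l) (by linarith) (by linarith)
        linarith
      · have := mulpos (k + 1) (2 * l + 2 * c - 2 * rot n 2 x y z - 1) (by linarith)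
          (by linarith)
        linarith
      · rcases Nat.lt_or_ge (2 * k * l + 2 * (l + c)) ((k + 1) * (2 * rot n 2 x y z + 1)) with
          h3 | h3
        · left
          have : (2 * k * l + 2 * (l + c) : ℝ) + 1 ≤ (k + 1) * (2 * rot n 2 x y z + 1) := by
            exact_mod_cast h3
          linarith
        · right; exact_mod_cast h3

end

/-! ### The triangles of the reduction -/

/-- The three kinds of triangles. The small ones are on the right (`true`) or on the left and are
labelled by three digits, the large ones have a number and touch intervals of small triangles on
both sides, and the hubs contain all small triangles on one side. -/
inductive Item where
  | small (s : Bool) (x y z : ℕ)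
  | large (i l c j l' c' m : ℕ)
  | hub (s : Bool) (m : ℕ)

/-- Reflect if `s` is false. -/
def sided (s : Bool) (p : ℝ × ℝ) : ℝ × ℝ := if s then p else mirror p

/-- The hub with number `m` on the right. -/
noncomputable def hubTri (k n m : ℕ) : Fin 3 → ℝ × ℝ :=
  ![(0, scaleS k n), (0, -(3 * scaleS k n + m)), (4 * scaleS k n + m, scaleS k n)]

namespace Item

/-- The vertices of a triangle. -/
noncomputable def tri (k n : ℕ) : Item → Fin 3 → ℝ × ℝ
  | small s x y z => fun j => sided s (smallTri k n x y z j)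
  | large i l c j l' c' m => largeTri k n i l c j l' c' m
  | hub s m => fun j => sided s (hubTri k n m j)

/-- The parameters of a triangle are in the admissible range. -/
def Valid (k n : ℕ) : Item → Prop
  | small _ x y z => x < n ∧ y < n ∧ z < n
  | large i l c j l' c' m => i < 3 ∧ j < 3 ∧ l + c ≤ n ^ 3 ∧ l' + c' ≤ n ^ 3 ∧ m ≤ scaleE k n
  | hub _ m => m ≤ scaleE k n

/-- Two triangles have different labels. -/
def Apart : Item → Item → Prop
  | small s x y z, small s' x' y' z' => ¬ (s = s' ∧ x = x' ∧ y = y' ∧ z = z')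
  | large _ _ _ _ _ _ m, large _ _ _ _ _ _ m' => m ≠ m'
  | hub s m, hub s' m' => ¬ (s = s' ∧ m = m')
  | _, _ => True

end Item

theorem meet_mirror_iff (p q : Fin 3 → ℝ × ℝ) :
    Meet (fun i => mirror (p i)) (fun i => mirror (q i)) ↔ Meet p q := by
  rw [← meet_place_iff (a := 0) (b := 0) (c := -1) (by norm_num) p q]
  simp [place, mirror]

theorem mirror_mirror (p : ℝ × ℝ) : mirror (mirror p) = p := by simp [mirror]

/-- The reflection of a large triangle exchanges its two ends; this undoes the resulting reversal of
the vertices. -/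
theorem meet_rev_iff (p q : Fin 3 → ℝ × ℝ) : Meet p ![q 2, q 1, q 0] ↔ Meet p q := by
  constructor
  · rintro ⟨u, v, hu, hv, hu1, hv1, h1, h2⟩
    refine ⟨u, ![v 2, v 1, v 0], hu, fun i => ?_, hu1, ?_, ?_, ?_⟩
    · fin_cases i <;> simp [hv]
    · simp only [Matrix.cons_val]; linarith
    · simp only [Matrix.cons_val] at *; linarith
    · simp only [Matrix.cons_val] at *; linarith
  · rintro ⟨u, v, hu, hv, hu1, hv1, h1, h2⟩
    refine ⟨u, ![v 2, v 1, v 0], hu, fun i => ?_, hu1, ?_, ?_, ?_⟩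
    · fin_cases i <;> simp [hv]
    · simp only [Matrix.cons_val]; linarith
    · simp only [Matrix.cons_val] at *; linarith
    · simp only [Matrix.cons_val] at *; linarith

section
variable {k n : ℕ}

theorem scale_bounds (hk : 10 ≤ k) (hn : 1 ≤ n) : (22 : ℝ) ≤ scaleE k n ∧
    2200 * (scaleE k n : ℝ) ≤ scaleT k n ∧
    10 * (scaleT k n : ℝ) ≤ k * scaleT k n ∧
    2 * (k * scaleT k n + scaleT k n : ℝ) ≤ scaleE k n * scaleT k n ∧
    2200 * (scaleE k n * scaleT k n : ℝ) ≤ scaleU k n ∧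
    10 * (scaleU k n : ℝ) ≤ scaleS k n := by
  have h := scales k n hk hn
  have hE := h.E_ge
  have hk := h.ten_le
  have hT := h.T_ge
  have hU := h.ET_le
  have hT0 : (0 : ℝ) < scaleT k n := by linarith
  have hU0 : (0 : ℝ) < scaleU k n := by nlinarith
  refine ⟨hE, hT, by nlinarith, by linarith [h.kT_le], hU, ?_⟩
  rw [h.S_eq]; nlinarith

theorem pert_le {x y z : ℕ} (hx : x < n) (hy : y < n) (hz : z < n) (i : ℕ) :
    ((k + 1) * (2 * rot n i x y z + 1) : ℝ) ≤ scaleE k n ∧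
    (k * (2 * rot n i x y z + 1) : ℝ) ≤ scaleE k n := by
  have := rot_lt i hx hy hz
  have e : (2 * rot n i x y z + 1 : ℝ) ≤ 2 * (n : ℝ) ^ 3 := by
    exact_mod_cast (by omega : 2 * rot n i x y z + 1 ≤ 2 * n ^ 3)
  have hE : (scaleE k n : ℝ) = (k + 1) * (2 * (n : ℝ) ^ 3) := by simp [scaleE]; ring
  have h1 : ((k + 1) * (2 * rot n i x y z + 1) : ℝ) ≤ scaleE k n := by
    rw [hE]; exact mul_le_mul_of_nonneg_left e (by positivity)
  exact ⟨h1, le_trans (by gcongr; linarith) h1⟩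

theorem small_fst_pos (hk : 10 ≤ k) (hn : 1 ≤ n) {x y z : ℕ} (hx : x < n) (hy : y < n)
    (hz : z < n) (i : Fin 3) : 0 < (smallTri k n x y z i).1 := by
  obtain ⟨hE, hT, hkT, hET, hU, hS⟩ := scale_bounds hk hn
  have h1 := (pert_le (k := k) hx hy hz 1).2
  have h2 : (0 : ℝ) ≤ (k + 1) * (2 * rot n 2 x y z + 1) := by positivity
  fin_cases i
  · show (0 : ℝ) < scaleS k n
    linarith
  · simp [smallTri, smallTriangle]; linarith
  · simp [smallTri, smallTriangle]; linarith

theorem hub_fst_nonneg (m : ℕ) (i : Fin 3) : 0 ≤ (hubTri k n m i).1 := by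
  fin_cases i
  · simp [hubTri]
  · simp [hubTri]
  · simp [hubTri]; positivity

/-- The hub contains the front vertex, whose height is at most `E`, much less than `S`. -/
theorem meet_small_hub (hk : 10 ≤ k) (hn : 1 ≤ n) {x y z : ℕ} (hx : x < n) (hy : y < n)
    (hz : z < n) (m : ℕ) : Meet (smallTri k n x y z) (hubTri k n m) := by
  obtain ⟨hE, hT, hkT, hET, hU, hS⟩ := scale_bounds hk hn
  have h0 := (pert_le (k := k) hx hy hz 0).1
  have h1 : (0 : ℝ) ≤ (k + 1) * (2 * rot n 0 x y z + 1) := by positivity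
  have hm : (0 : ℝ) ≤ m := Nat.cast_nonneg m
  have hS0 : (0 : ℝ) < scaleS k n := by linarith
  refine Meet.symm (meet_of_vertex_mem 0 ?_ ?_ ?_ ?_)
  · simp only [hubTri, Matrix.cons_val, area]; nlinarith
  · simp only [hubTri, smallTri, smallTriangle, Matrix.cons_val, area]
    have := mul_nonneg (by linarith : 0 ≤ 4 * (scaleS k n : ℝ) + m)
      (by linarith : 0 ≤ (k + 1) * (2 * rot n 0 x y z + 1) + 3 * (scaleS k n : ℝ) + m - scaleS k n)
    linarith
  · simp only [hubTri, smallTri, smallTriangle, Matrix.cons_val, area]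
    have := mul_nonneg (by linarith : 0 ≤ 4 * (scaleS k n : ℝ) + m)
      (by linarith : 0 ≤ (scaleS k n : ℝ) - (k + 1) * (2 * rot n 0 x y z + 1))
    linarith
  · simp only [hubTri, smallTri, smallTriangle, Matrix.cons_val, area]
    have := mul_nonneg (by linarith : 0 ≤ 4 * (scaleS k n : ℝ) + m) hS0.le
    linarith

/-- All hubs share the vertex `(0, S)`. -/
theorem meet_hub_hub (s s' : Bool) (m m' : ℕ) :
    Meet ((Item.hub s m).tri k n) ((Item.hub s' m').tri k n) := by
  refine ⟨![1, 0, 0], ![1, 0, 0], fun i => ?_, fun i => ?_, ?_, ?_, ?_, ?_⟩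
  · fin_cases i <;> simp
  · fin_cases i <;> simp
  · simp
  · simp
  · cases s <;> cases s' <;> simp [Item.tri, sided, mirror, hubTri]
  · cases s <;> cases s' <;> simp [Item.tri, sided, mirror, hubTri]

theorem apex_bounds (hk : 10 ≤ k) (hn : 1 ≤ n) {m : ℕ} (hm : m ≤ scaleE k n) :
    0 ≤ apex k n m ∧ apex k n m ≤ scaleS k n ∧
      (scaleE k n * scaleT k n : ℝ) < apex k n m ∧ scaleS k n - scaleU k n ≤ apex k n m := by
  obtain ⟨hE, hT, hkT, hET, hU, hS⟩ := scale_bounds hk hn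
  have h := scales k n hk hn
  have hm' : (m : ℝ) ≤ scaleE k n := by exact_mod_cast hm
  have hm0 : (0 : ℝ) ≤ m := Nat.cast_nonneg m
  have e := h.S_eq
  have : (scaleE k n : ℝ) ≤ scaleU k n := by nlinarith
  have hET0 : (0 : ℝ) < scaleE k n * scaleT k n := by nlinarith
  unfold apex
  refine ⟨?_, ?_, ?_, ?_⟩ <;> nlinarith

/-- The apex has height between 0 and `S` on the axis, hence lies on the vertical edge of every hub
on either side. -/
theorem meet_large_hub (hk : 10 ≤ k) (hn : 1 ≤ n) (s : Bool) (i l c j l' c' m m' : ℕ)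
    (hm : m ≤ scaleE k n) :
    Meet (largeTri k n i l c j l' c' m) ((Item.hub s m').tri k n) := by
  obtain ⟨h0, h1, -, -⟩ := apex_bounds hk hn hm
  obtain ⟨hE, hT, hkT, hET, hU, hS⟩ := scale_bounds hk hn
  have hm : (0 : ℝ) ≤ m' := Nat.cast_nonneg m'
  have hd : 0 < 4 * (scaleS k n : ℝ) + m' := by nlinarith
  have hd' := hd.ne'
  refine ⟨![0, 1, 0], ![(apex k n m + 3 * scaleS k n + m') / (4 * scaleS k n + m'),
    (scaleS k n - apex k n m) / (4 * scaleS k n + m'), 0], fun i => ?_, fun i => ?_, ?_, ?_, ?_, ?_⟩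
  · fin_cases i <;> simp
  · fin_cases i
    · exact div_nonneg (by linarith) hd.le
    · exact div_nonneg (by linarith) hd.le
    · simp
  · simp
  · simp only [Matrix.cons_val]
    rw [← add_div, add_zero, div_eq_one_iff_eq hd']
    ring
  · cases s <;> simp [Item.tri, sided, mirror, hubTri, largeTri, largeTriangle]
  · have : ∀ t : Bool, (((Item.hub t m').tri k n) 0).2 = scaleS k n ∧
        (((Item.hub t m').tri k n) 1).2 = -(3 * scaleS k n + m') := fun t => by
      cases t <;> simp [Item.tri, sided, mirror, hubTri]
    rw [(this s).1, (this s).2]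
    simp only [Matrix.cons_val, largeTri, largeTriangle]
    rw [zero_mul, zero_mul, zero_mul, add_zero, add_zero, zero_add, one_mul, div_mul_eq_mul_div,
      div_mul_eq_mul_div, ← add_div, eq_div_iff hd']
    ring

theorem not_meet_opposite {p q : Fin 3 → ℝ × ℝ} (hp : ∀ i, 0 < (p i).1)
    (hq : ∀ i, (q i).1 ≤ 0) : ¬ Meet p q :=
  not_meet_of_separated 1 0 0 (fun i => by linarith [hp i]) (fun i => by linarith [hq i])

/-! #### The intersection pattern -/

/-- The intersection pattern of the triangles. -/
def Item.Touch (n : ℕ) : Item → Item → Prop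
  | .small true _ _ _, .small false _ _ _ => False
  | .small true x y z, .large i l c _ _ _ _ => l ≤ rot n i x y z ∧ rot n i x y z < l + c
  | .small false x y z, .large _ _ _ j l' c' _ => l' ≤ rot n j x y z ∧ rot n j x y z < l' + c'
  | .small s _ _ _, .hub s' _ => s = s'
  | .large _ _ _ _ _ _ _, .hub _ _ => True
  | .hub _ _, .hub _ _ => True
  | _, _ => False

/-- The pairs of kinds of triangles whose intersections are described by `Touch`. -/
def Item.Regular : Item → Item → Prop
  | .small true _ _ _, .small false _ _ _ => True
  | .small _ _ _ _, .large _ _ _ _ _ _ _ => True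
  | .small _ _ _ _, .hub _ _ => True
  | .large _ _ _ _ _ _ _, .hub _ _ => True
  | .hub _ _, .hub _ _ => True
  | _, _ => False

theorem largeTri_mirror (i l c j l' c' m : ℕ) :
    (fun a => mirror (largeTri k n i l c j l' c' m a)) =
      ![largeTri k n j l' c' i l c m 2, largeTri k n j l' c' i l c m 1,
        largeTri k n j l' c' i l c m 0] := by
  funext a
  fin_cases a <;> simp [largeTri, largeTriangle, mirror]

/-- Contacts on the left are reflected to contacts on the right, with the two ends of the large
triangle exchanged. -/
theorem meet_iff_touch (hk : 10 ≤ k) (hn : 1 ≤ n) {a b : Item} (ha : a.Valid k n)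
    (hb : b.Valid k n) (hab : a.Regular b) : Meet (a.tri k n) (b.tri k n) ↔ a.Touch n b := by
  have mir : ∀ p q : Fin 3 → ℝ × ℝ, Meet (fun i => mirror (p i)) q ↔
      Meet p (fun i => mirror (q i)) := fun p q => by
    rw [← meet_mirror_iff p]; simp only [mirror_mirror]
  match a, b, ha, hb, hab with
  | .small true x y z, .small false x' y' z', ha, hb, _ =>
    refine iff_of_false (not_meet_opposite (fun i => small_fst_pos hk hn ha.1 ha.2.1 ha.2.2 i)
      fun i => ?_) id
    have := small_fst_pos hk hn hb.1 hb.2.1 hb.2.2 i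
    simp [Item.tri, sided, mirror, this.le]
  | .small true x y z, .large i l c j l' c' m, ha, hb, _ =>
    exact meet_small_large_iff hk hn ha.1 ha.2.1 ha.2.2 j hb.1 hb.2.2.1 hb.2.2.2.1 hb.2.2.2.2
  | .small false x y z, .large i l c j l' c' m, ha, hb, _ =>
    have := meet_small_large_iff hk hn ha.1 ha.2.1 ha.2.2 i hb.2.1 hb.2.2.2.1 hb.2.2.1
      hb.2.2.2.2
    refine Iff.trans ?_ this
    show Meet (fun a => mirror (smallTri k n x y z a)) (largeTri k n i l c j l' c' m) ↔ _
    rw [mir, largeTri_mirror, meet_rev_iff]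
  | .small true x y z, .hub true m, ha, _, _ =>
    exact iff_of_true (meet_small_hub hk hn ha.1 ha.2.1 ha.2.2 m) rfl
  | .small false x y z, .hub false m, ha, _, _ =>
    exact iff_of_true ((meet_mirror_iff _ _).2 (meet_small_hub hk hn ha.1 ha.2.1 ha.2.2 m)) rfl
  | .small true x y z, .hub false m, ha, _, _ =>
    refine iff_of_false (not_meet_opposite (fun i => small_fst_pos hk hn ha.1 ha.2.1 ha.2.2 i)
      fun i => ?_) (by simp [Item.Touch])
    have := hub_fst_nonneg (k := k) (n := n) m i
    simp [Item.tri, sided, mirror, this]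
  | .small false x y z, .hub true m, ha, _, _ =>
    refine iff_of_false ?_ (by simp [Item.Touch])
    show ¬ Meet (fun a => mirror (smallTri k n x y z a)) (hubTri k n m)
    rw [mir]
    refine not_meet_opposite (fun i => small_fst_pos hk hn ha.1 ha.2.1 ha.2.2 i) fun i => ?_
    have := hub_fst_nonneg (k := k) (n := n) m i
    simp [mirror, this]
  | .large i l c j l' c' m, .hub s m', ha, _, _ =>
    exact iff_of_true (meet_large_hub hk hn s i l c j l' c' m m' ha.2.2.2.2) trivial
  | .hub s m, .hub s' m', _, _, _ => exact iff_of_true (meet_hub_hub s s' m m') trivial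

end

/-! ### Shapes of the triangles -/

theorem IsHalfSquare.congr {δ : ℝ} {p q : Fin 3 → Plane}
    (h : ∀ i j, dist (p i) (p j) = dist (q i) (q j)) (hp : IsHalfSquare δ p) :
    IsHalfSquare δ q := by
  obtain ⟨s, hs, i, j, k, hij, hik, hjk, h1, h2, h3, h4, h5⟩ := hp
  simp only [h] at h1 h2 h3 h4 h5
  exact ⟨s, hs, i, j, k, hij, hik, hjk, h1, h2, h3, h4, h5⟩

theorem dist_place (a b : ℝ) (x y : ℝ × ℝ) :
    dist (toPlane (place a b 1 x)) (toPlane (place a b 1 y)) = dist (toPlane x) (toPlane y) := by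
  rw [dist_toPlane, dist_toPlane]
  simp only [place]
  congr 1
  ring

theorem dist_sided (s : Bool) (x y : ℝ × ℝ) :
    dist (toPlane (sided s x)) (toPlane (sided s y)) = dist (toPlane x) (toPlane y) := by
  cases s
  · rw [dist_toPlane, dist_toPlane]
    simp only [sided, mirror]
    congr 1
    simp only [Bool.false_eq_true, if_false]
    ring
  · rfl

theorem dist_toPlane_eq {x y : ℝ × ℝ} {d : ℝ} (hd : 0 ≤ d)
    (h : (x.1 - y.1) ^ 2 + (x.2 - y.2) ^ 2 = d ^ 2) : dist (toPlane x) (toPlane y) = d := by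
  rw [dist_toPlane, h, Real.sqrt_sq hd]

theorem one_le_sqrt_two : (1 : ℝ) ≤ √2 := Real.one_le_sqrt.2 (by norm_num)

section
variable {k n : ℕ} {ρ δ : ℝ}

/-- The front vertex is at distance about `T` from its position in an exact half-square with
hypotenuse `2 * (k + 1) * T`; the other deviations are of order `E`. The relative error is thus of
order `1 / k`. -/
theorem isHalfSquare_small (hk : 10 ≤ k) (hn : 1 ≤ n) (hρ : 0 < ρ) (hρδ : 2 * ρ ≤ δ)
    (hρ' : ρ ≤ 1 / 10) (hkρ : 2 ≤ ρ * k) {x y z : ℕ} (hx : x < n) (hy : y < n) (hz : z < n) :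
    IsHalfSquare δ fun j => toPlane (smallTri k n x y z j) := by
  obtain ⟨hE, hT, hkT, hET, hU, hS⟩ := scale_bounds hk hn
  have s2 : √2 ^ 2 = 2 := Real.sq_sqrt (by norm_num)
  have s1 := one_le_sqrt_two
  have hT0 : (0 : ℝ) < scaleT k n := by linarith
  have hd : 0 < √2 * ((k + 1) * scaleT k n : ℝ) := by positivity
  set S : ℝ := ((scaleS k n : ℕ) : ℝ)
  set T : ℝ := ((scaleT k n : ℕ) : ℝ)
  have err : 2 * T ≤ ρ * (√2 * ((k + 1) * T)) := by
    have h1 : 2 * T ≤ ρ * k * T := mul_le_mul_of_nonneg_right hkρ hT0.le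
    have h2 : 1 * (ρ * k * T) ≤ √2 * (ρ * (k + 1) * T) := by gcongr; linarith
    linarith
  refine isHalfSquare_of_near (e := fun j => toPlane ((![(S - T, 0),
    (S + k * T, -((k + 1) * T)), (S + k * T, (k + 1) * T)] : Fin 3 → ℝ × ℝ) j)) hd hρδ hρ'
    (i := 1) (j := 2) (k := 0) (by decide) (by decide) (by decide) ?_ ?_ ?_ fun l => ?_
  · refine dist_toPlane_eq (by positivity) ?_
    simp only [Matrix.cons_val, mul_pow, s2]; ring
  · refine dist_toPlane_eq (by positivity) ?_
    simp only [Matrix.cons_val, mul_pow, s2]; ring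
  · refine dist_toPlane_eq (by positivity) ?_
    simp only [Matrix.cons_val, mul_pow, s2]; ring
  · refine (dist_toPlane_le _ _).trans (le_trans ?_ err)
    have h0 := (pert_le (k := k) hx hy hz 0).1
    have h1 := (pert_le (k := k) hx hy hz 1).2
    have h2 := (pert_le (k := k) hx hy hz 2).1
    have p0 : (0 : ℝ) ≤ (k + 1) * (2 * rot n 0 x y z + 1) := by positivity
    have p1 : (0 : ℝ) ≤ k * (2 * rot n 1 x y z + 1) := by positivity
    have p2 : (0 : ℝ) ≤ (k + 1) * (2 * rot n 2 x y z + 1) := by positivity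
    fin_cases l
    · simp only [smallTri, smallTriangle, Fin.zero_eta, Matrix.cons_val_zero]
      rw [show S - (S - T) = T by ring, abs_of_pos hT0, sub_zero, abs_of_nonneg p0]
      linarith
    · simp only [smallTri, smallTriangle, Fin.mk_one, Matrix.cons_val_one, Matrix.cons_val_zero]
      rw [abs_of_nonpos (by linarith), abs_of_nonneg (by linarith)]
      linarith
    · simp only [smallTri, smallTriangle, Fin.reduceFinMk, Matrix.cons_val]
      rw [abs_of_nonneg (by linarith), abs_of_nonneg (by linarith)]
      linarith

/-- Compared with the exact half-square of height `S = k * U`, the apex is too low by about `U` and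
the ends are off by at most order `E * T`. -/
theorem isHalfSquare_large (hk : 10 ≤ k) (hn : 1 ≤ n) (hρ : 0 < ρ) (hρδ : 2 * ρ ≤ δ)
    (hρ' : ρ ≤ 1 / 10) (hkρ : 2 ≤ ρ * k) (i j : ℕ) {l c l' c' m : ℕ} (h : l + c ≤ n ^ 3)
    (h' : l' + c' ≤ n ^ 3) (hm : m ≤ scaleE k n) :
    IsHalfSquare δ fun a => toPlane (largeTri k n i l c j l' c' m a) := by
  obtain ⟨hE, hT, hkT, hET, hU, hS⟩ := scale_bounds hk hn
  obtain ⟨-, z1, -, z2⟩ := apex_bounds hk hn hm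
  have t1 := tip_bounds hk hn i h
  have t2 := tip_bounds hk hn j h'
  have hsc := scales k n hk hn
  have s2 : √2 ^ 2 = 2 := Real.sq_sqrt (by norm_num)
  have s1 := one_le_sqrt_two
  set S : ℝ := ((scaleS k n : ℕ) : ℝ)
  set T : ℝ := ((scaleT k n : ℕ) : ℝ)
  set U : ℝ := ((scaleU k n : ℕ) : ℝ)
  set E : ℝ := ((scaleE k n : ℕ) : ℝ)
  have hE0 : 0 < E := by linarith
  have hT0 : 0 < T := by linarith
  have hU0 : 0 < U := by nlinarith
  have hS0 : 0 < S := by linarith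
  have hd : 0 < √2 * S := by positivity
  have err : 2 * U ≤ ρ * (√2 * S) := by
    have h1 : 2 * U ≤ ρ * k * U := mul_le_mul_of_nonneg_right hkρ hU0.le
    have h2 : 1 * (ρ * (k * U)) ≤ √2 * (ρ * S) := by
      rw [hsc.S_eq]; gcongr
    linarith
  have e1 : 3 * (E * T) ≤ 2 * U := by nlinarith
  have e2 : (k * T + E) + ((k + 1) * T + E) ≤ 3 * (E * T) := by nlinarith
  refine isHalfSquare_of_near (e := fun j => toPlane ((![(S, 0), (0, S), (-S, 0)] :
    Fin 3 → ℝ × ℝ) j)) hd hρδ hρ' (i := 0) (j := 2) (k := 1) (by decide) (by decide) (by decide)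
    ?_ ?_ ?_ fun l => ?_
  · refine dist_toPlane_eq (by positivity) ?_
    simp only [Matrix.cons_val, mul_pow, s2]; ring
  · refine dist_toPlane_eq (by positivity) ?_
    simp only [Matrix.cons_val, mul_pow, s2]; ring
  · refine dist_toPlane_eq (by positivity) ?_
    simp only [Matrix.cons_val, mul_pow, s2]; ring
  · refine (dist_toPlane_le _ _).trans (le_trans ?_ err)
    fin_cases l
    · simp only [largeTri, largeTriangle, Fin.zero_eta, Matrix.cons_val_zero, sub_zero]
      rw [abs_of_nonneg (by linarith)]
      linarith
    · simp only [largeTri, largeTriangle, Fin.mk_one, Matrix.cons_val_one, Matrix.cons_val_zero,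
        sub_zero, abs_zero]
      rw [abs_of_nonpos (by linarith)]
      linarith
    · simp only [largeTri, largeTriangle, mirror, Fin.reduceFinMk, Matrix.cons_val, sub_zero]
      rw [abs_of_nonpos (by linarith)]
      linarith

/-- Hubs are exact half-squares with legs `4 * S + m`, so `ρ = 0` is possible. -/
theorem isHalfSquare_hub (hk : 10 ≤ k) (hn : 1 ≤ n) (hδ : 0 < δ) (m : ℕ) :
    IsHalfSquare δ fun a => toPlane (hubTri k n m a) := by
  obtain ⟨hE, hT, hkT, hET, hU, hS⟩ := scale_bounds hk hn
  have s2 : √2 ^ 2 = 2 := Real.sq_sqrt (by norm_num)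
  have hm : (0 : ℝ) ≤ m := Nat.cast_nonneg m
  have hd : (0 : ℝ) < 4 * scaleS k n + m := by nlinarith
  refine isHalfSquare_of_near (ρ := 0) (e := fun a => toPlane (hubTri k n m a)) hd (by linarith)
    (by norm_num) (i := 1) (j := 2) (k := 0) (by decide) (by decide) (by decide) ?_ ?_ ?_
    fun l => by simp
  · refine dist_toPlane_eq (by positivity) ?_
    simp only [hubTri, Matrix.cons_val, mul_pow, s2]; ring
  · refine dist_toPlane_eq (by positivity) ?_
    simp only [hubTri, Matrix.cons_val]; ring
  · refine dist_toPlane_eq (by positivity) ?_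
    simp only [hubTri, Matrix.cons_val]; ring

theorem Item.isHalfSquare (hk : 10 ≤ k) (hn : 1 ≤ n) (hρ : 0 < ρ) (hρδ : 2 * ρ ≤ δ)
    (hρ' : ρ ≤ 1 / 10) (hkρ : 2 ≤ ρ * k) (a b : ℝ) (it : Item) (hit : it.Valid k n) :
    IsHalfSquare δ fun j => toPlane (place a b 1 (it.tri k n j)) := by
  match it, hit with
  | .small s x y z, hit =>
    exact (isHalfSquare_small hk hn hρ hρδ hρ' hkρ hit.1 hit.2.1 hit.2.2).congr fun i j => by
      rw [dist_place]; exact (dist_sided s _ _).symm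
  | .large i l c j l' c' m, hit =>
    exact (isHalfSquare_large hk hn hρ hρδ hρ' hkρ i j hit.2.2.1 hit.2.2.2.1 hit.2.2.2.2).congr
      fun i j => by rw [dist_place]; rfl
  | .hub s m, hit =>
    exact (isHalfSquare_hub hk hn (by linarith) m).congr fun i j => by
      rw [dist_place]; exact (dist_sided s _ _).symm

theorem area_place (a b : ℝ) (x y z : ℝ × ℝ) :
    area (place a b 1 x) (place a b 1 y) (place a b 1 z) = area x y z := by
  simp only [area, place]; ring

theorem area_sided (s : Bool) (x y z : ℝ × ℝ) (h : area x y z ≠ 0) :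
    area (sided s x) (sided s y) (sided s z) ≠ 0 := by
  cases s
  · have : area (mirror x) (mirror y) (mirror z) = -area x y z := by
      simp only [area, mirror]; ring
    simpa [sided, this] using h
  · exact h

theorem Item.area_ne_zero (hk : 10 ≤ k) (hn : 1 ≤ n) (it : Item) (hit : it.Valid k n) :
    area (it.tri k n 0) (it.tri k n 1) (it.tri k n 2) ≠ 0 := by
  match it, hit with
  | .small s x y z, hit =>
    exact area_sided s _ _ _ (nearScales (l := 0) (c := 0) (l' := 0) (c' := 0) (m := 0) hk hn
      hit.1 hit.2.1 hit.2.2 0 0 (Nat.zero_le _) (Nat.zero_le _)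
      (Nat.zero_le _)).area_small_pos.ne'
  | .large i l c j l' c' m, hit =>
    exact (nearScales hk hn hn hn hn i j hit.2.2.1 hit.2.2.2.1 hit.2.2.2.2).area_P_Z_R.ne'
  | .hub s m, hit =>
    refine area_sided s _ _ _ ?_
    obtain ⟨hE, hT, hkT, hET, hU, hS⟩ := scale_bounds hk hn
    have hm : (0 : ℝ) ≤ m := Nat.cast_nonneg m
    have hd : (0 : ℝ) < 4 * scaleS k n + m := by nlinarith
    have : area (hubTri k n m 0) (hubTri k n m 1) (hubTri k n m 2) =
        (4 * scaleS k n + m) * (4 * scaleS k n + m) := by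
      simp only [area, hubTri, Matrix.cons_val]; ring
    rw [this]
    positivity

/-! ### Different labels give different triangles -/

theorem eq_of_digits {n a b c d : ℕ} (hb : b < n) (hd : d < n) (h : a * n + b = c * n + d) :
    a = c ∧ b = d := by
  have h1 : (a * n + b) / n = a := by
    rw [mul_comm, Nat.mul_add_div (by omega), Nat.div_eq_of_lt hb, add_zero]
  have h2 : (c * n + d) / n = c := by
    rw [mul_comm, Nat.mul_add_div (by omega), Nat.div_eq_of_lt hd, add_zero]
  have : a = c := by rw [← h1, h, h2]
  subst this
  exact ⟨rfl, by omega⟩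

theorem eq_of_rot_eq {x y z x' y' z' : ℕ} (hx : x < n) (hz : z < n) (hx' : x' < n) (hz' : z' < n)
    (h : rot n 1 x y z = rot n 1 x' y' z') : x = x' ∧ y = y' ∧ z = z' := by
  simp only [rot] at h
  simp only [one_ne_zero, if_false, if_true] at h
  obtain ⟨h1, h2⟩ := eq_of_digits hx hx' h
  obtain ⟨h3, h4⟩ := eq_of_digits hz hz' h1
  exact ⟨h2, h3, h4⟩

/-- Some linear functional attains a larger maximum on the second triangle. -/
def Exceeds (p q : Fin 3 → ℝ × ℝ) : Prop :=
  ∃ (α β : ℝ) (j : Fin 3), ∀ i, α * (p i).1 + β * (p i).2 < α * (q j).1 + β * (q j).2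

theorem exceeds_fst {p q : Fin 3 → ℝ × ℝ} (j : Fin 3) (h : ∀ i, (p i).1 < (q j).1) :
    Exceeds p q := ⟨1, 0, j, fun i => by linarith [h i]⟩

theorem exceeds_neg_fst {p q : Fin 3 → ℝ × ℝ} (j : Fin 3) (h : ∀ i, (q j).1 < (p i).1) :
    Exceeds p q := ⟨-1, 0, j, fun i => by linarith [h i]⟩

theorem exceeds_snd {p q : Fin 3 → ℝ × ℝ} (j : Fin 3) (h : ∀ i, (p i).2 < (q j).2) :
    Exceeds p q := ⟨0, 1, j, fun i => by linarith [h i]⟩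

theorem exceeds_neg_snd {p q : Fin 3 → ℝ × ℝ} (j : Fin 3) (h : ∀ i, (q j).2 < (p i).2) :
    Exceeds p q := ⟨0, -1, j, fun i => by linarith [h i]⟩

theorem exceeds_mirror {p q : Fin 3 → ℝ × ℝ} (h : Exceeds p q) :
    Exceeds (fun i => mirror (p i)) (fun i => mirror (q i)) := by
  obtain ⟨α, β, j, h⟩ := h
  exact ⟨-α, β, j, fun i => by simpa [mirror] using h i⟩

/-- The lowest point is the vertex that encodes `rot n 1`, and its height increases with this
number, which determines the label. -/
theorem exceeds_small {x y z x' y' z' : ℕ} (hk : 10 ≤ k) (hn : 1 ≤ n) (hx : x < n) (hy : y < n)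
    (hz : z < n) (h : rot n 1 x y z < rot n 1 x' y' z') :
    Exceeds (smallTri k n x' y' z') (smallTri k n x y z) := by
  obtain ⟨hE, hT, hkT, hET, hU, hS⟩ := scale_bounds hk hn
  have h1 := (pert_le (k := k) hx hy hz 1).2
  have h0 : (0 : ℝ) ≤ (k + 1) * (2 * rot n 0 x' y' z' + 1) := by positivity
  have h2 : (0 : ℝ) ≤ (k + 1) * (2 * rot n 2 x' y' z' + 1) := by positivity
  have hk0 : (0 : ℝ) < k := by exact_mod_cast (by omega : 0 < k)
  have hlt : (k * (2 * rot n 1 x y z + 1) : ℝ) < k * (2 * rot n 1 x' y' z' + 1) := by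
    have : (rot n 1 x y z : ℝ) < rot n 1 x' y' z' := by exact_mod_cast h
    gcongr
  refine exceeds_neg_snd 1 fun i => ?_
  fin_cases i
  · simp [smallTri, smallTriangle]; linarith
  · simp [smallTri, smallTriangle] at *; linarith
  · simp [smallTri, smallTriangle]; linarith

/-- Triangles of different kinds or sides differ in their horizontal extent. Two large triangles
differ in the height of the apex, two hubs on the same side in their width; this is the purpose of
the numbers `m`. -/
theorem Item.exceeds (hk : 10 ≤ k) (hn : 1 ≤ n) {a b : Item} (ha : a.Valid k n)
    (hb : b.Valid k n) (hab : a.Apart b) :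
    Exceeds (a.tri k n) (b.tri k n) ∨ Exceeds (b.tri k n) (a.tri k n) := by
  obtain ⟨hE, hT, hkT, hET, hU, hS⟩ := scale_bounds hk hn
  have hS0 : (0 : ℝ) < scaleS k n := by nlinarith
  have sp : ∀ {x y z : ℕ}, x < n ∧ y < n ∧ z < n → ∀ i, 0 < (smallTri k n x y z i).1 :=
    fun h i => small_fst_pos hk hn h.1 h.2.1 h.2.2 i
  have lt : ∀ {i l c : ℕ}, l + c ≤ n ^ 3 → 0 < (tip k n i l c).1 :=
    fun {i l c} h => hS0.trans_le (tip_bounds hk hn i h).1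
  have small_large : ∀ {s x y z i l c j l' c' m}, (Item.small s x y z).Valid k n →
      (Item.large i l c j l' c' m).Valid k n → Exceeds ((Item.small s x y z).tri k n)
        ((Item.large i l c j l' c' m).tri k n) := by
    intro s x y z i l c j l' c' m h h'
    cases s
    · refine exceeds_fst 0 fun a => ?_
      have := sp h a
      have := lt (i := i) h'.2.2.1
      simp only [Item.tri, sided, mirror, largeTri, largeTriangle, Matrix.cons_val_zero]
      simp only [Bool.false_eq_true, if_false]
      linarith
    · refine exceeds_neg_fst 2 fun a => ?_
      have := sp h a
      simp only [Item.tri, sided, mirror, largeTri, largeTriangle, Matrix.cons_val, if_true]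
      linarith [lt (i := j) h'.2.2.2.1]
  have small_hub : ∀ {s x y z s' m}, (Item.small s x y z).Valid k n →
      Exceeds ((Item.small s x y z).tri k n) ((Item.hub s' m).tri k n) := by
    intro s x y z s' m h
    have e : (((Item.hub s' m).tri k n) 0).1 = 0 := by
      cases s' <;> simp [Item.tri, sided, mirror, hubTri]
    cases s
    · refine exceeds_fst 0 fun i => ?_
      rw [e]
      simpa [Item.tri, sided, mirror] using sp h i
    · refine exceeds_neg_fst 0 fun i => ?_
      rw [e]
      exact sp h i
  have hub_large : ∀ {s m i l c j l' c' m'}, (Item.large i l c j l' c' m').Valid k n →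
      Exceeds ((Item.hub s m).tri k n) ((Item.large i l c j l' c' m').tri k n) := by
    intro s m i l c j l' c' m' h
    cases s
    · refine exceeds_fst 0 fun a => ?_
      have := hub_fst_nonneg (k := k) (n := n) m a
      have h2 := lt (i := i) h.2.2.1
      simp only [Item.tri, sided, mirror, largeTri, largeTriangle, Matrix.cons_val_zero]
      simp only [Bool.false_eq_true, if_false]
      linarith
    · refine exceeds_neg_fst 2 fun a => ?_
      have := hub_fst_nonneg (k := k) (n := n) m a
      have h2 := lt (i := j) h.2.2.2.1
      simp only [Item.tri, sided, mirror, largeTri, largeTriangle, Matrix.cons_val, if_true]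
      linarith
  have large_large : ∀ {i l c j l' c' m i₁ l₁ c₁ j₁ l₁' c₁' m₁},
      (Item.large i l c j l' c' m).Valid k n → (Item.large i₁ l₁ c₁ j₁ l₁' c₁' m₁).Valid k n →
      m < m₁ → Exceeds ((Item.large i l c j l' c' m).tri k n)
        ((Item.large i₁ l₁ c₁ j₁ l₁' c₁' m₁).tri k n) := by
    intro i l c j l' c' m i₁ l₁ c₁ j₁ l₁' c₁' m₁ h h' hm
    refine exceeds_snd 1 fun a => ?_
    have z1 := (apex_bounds hk hn h'.2.2.2.2).2.2.1
    have t1 := (abs_le.1 (tip_bounds hk hn i h.2.2.1).2.2.2).2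
    have t2 := (abs_le.1 (tip_bounds hk hn j h.2.2.2.1).2.2.2).2
    show _ < apex k n m₁
    fin_cases a
    · show (tip k n i l c).2 < _
      linarith
    · show apex k n m < _
      have : (m : ℝ) < m₁ := by exact_mod_cast hm
      simp only [apex]; linarith
    · show (tip k n j l' c').2 < _
      linarith
  have hub_hub : ∀ {m m' : ℕ}, m < m' → Exceeds (hubTri k n m) (hubTri k n m') := by
    intro m m' hm
    have h1 : (m : ℝ) < m' := by exact_mod_cast hm
    have h0 : (0 : ℝ) ≤ m := Nat.cast_nonneg m
    refine exceeds_fst 2 fun a => ?_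
    fin_cases a
    · simp [hubTri]; linarith
    · simp [hubTri]; linarith
    · simp [hubTri]; linarith
  match a, b, ha, hb, hab with
  | .small true x y z, .small true x' y' z', ha, hb, hab =>
    rcases lt_trichotomy (rot n 1 x y z) (rot n 1 x' y' z') with h | h | h
    · exact .inr (exceeds_small hk hn ha.1 ha.2.1 ha.2.2 h)
    · exact absurd ⟨rfl, eq_of_rot_eq ha.1 ha.2.2 hb.1 hb.2.2 h⟩ hab
    · exact .inl (exceeds_small hk hn hb.1 hb.2.1 hb.2.2 h)
  | .small false x y z, .small false x' y' z', ha, hb, hab =>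
    rcases lt_trichotomy (rot n 1 x y z) (rot n 1 x' y' z') with h | h | h
    · exact .inr (exceeds_mirror (exceeds_small hk hn ha.1 ha.2.1 ha.2.2 h))
    · exact absurd ⟨rfl, eq_of_rot_eq ha.1 ha.2.2 hb.1 hb.2.2 h⟩ hab
    · exact .inl (exceeds_mirror (exceeds_small hk hn hb.1 hb.2.1 hb.2.2 h))
  | .small true x y z, .small false x' y' z', ha, hb, _ =>
    refine .inr (exceeds_fst 0 fun i => ?_)
    have h1 := sp hb i
    have h2 := sp ha 0
    simp only [Item.tri, sided, mirror, if_true, Bool.false_eq_true, if_false]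
    linarith
  | .small false x y z, .small true x' y' z', ha, hb, _ =>
    refine .inl (exceeds_fst 0 fun i => ?_)
    have h1 := sp ha i
    have h2 := sp hb 0
    simp only [Item.tri, sided, mirror, if_true, Bool.false_eq_true, if_false]
    linarith
  | .small _ _ _ _, .large _ _ _ _ _ _ _, ha, hb, _ => exact .inl (small_large ha hb)
  | .large _ _ _ _ _ _ _, .small _ _ _ _, ha, hb, _ => exact .inr (small_large hb ha)
  | .small _ _ _ _, .hub _ _, ha, hb, _ => exact .inl (small_hub ha)
  | .hub _ _, .small _ _ _ _, ha, hb, _ => exact .inr (small_hub hb)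
  | .hub _ _, .large _ _ _ _ _ _ _, ha, hb, _ => exact .inl (hub_large hb)
  | .large _ _ _ _ _ _ _, .hub _ _, ha, hb, _ => exact .inr (hub_large ha)
  | .large _ _ _ _ _ _ m, .large _ _ _ _ _ _ m', ha, hb, hab =>
    rcases Nat.lt_or_gt_of_ne hab with h | h
    · exact .inl (large_large ha hb h)
    · exact .inr (large_large hb ha h)
  | .hub true m, .hub true m', ha, hb, hab =>
    rcases lt_trichotomy m m' with h | h | h
    · exact .inl (hub_hub h)
    · exact absurd ⟨rfl, h⟩ hab
    · exact .inr (hub_hub h)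
  | .hub false m, .hub false m', ha, hb, hab =>
    rcases lt_trichotomy m m' with h | h | h
    · exact .inl (exceeds_mirror (hub_hub h))
    · exact absurd ⟨rfl, h⟩ hab
    · exact .inr (exceeds_mirror (hub_hub h))
  | .hub true m, .hub false m', ha, hb, _ =>
    refine .inr (exceeds_fst 2 fun i => ?_)
    have h1 := hub_fst_nonneg (k := k) (n := n) m' i
    have h2 : (0 : ℝ) ≤ m := Nat.cast_nonneg m
    simp only [Item.tri, sided, mirror, if_true, Bool.false_eq_true, if_false]
    simp only [hubTri, Matrix.cons_val] at *
    linarith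
  | .hub false m, .hub true m', ha, hb, _ =>
    refine .inl (exceeds_fst 2 fun i => ?_)
    have h1 := hub_fst_nonneg (k := k) (n := n) m i
    have h2 : (0 : ℝ) ≤ m' := Nat.cast_nonneg m'
    simp only [Item.tri, sided, mirror, if_true, Bool.false_eq_true, if_false]
    simp only [hubTri, Matrix.cons_val] at *
    linarith

theorem Item.convexHull_ne (hk : 10 ≤ k) (hn : 1 ≤ n) {a b : Item} (ha : a.Valid k n)
    (hb : b.Valid k n) (hab : a.Apart b) (X Y : ℝ) :
    convexHull ℝ (Set.range fun j => toPlane (place X Y 1 (a.tri k n j))) ≠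
      convexHull ℝ (Set.range fun j => toPlane (place X Y 1 (b.tri k n j))) := by
  have key : ∀ p q : Fin 3 → ℝ × ℝ, Exceeds p q →
      convexHull ℝ (Set.range fun j => toPlane (place X Y 1 (p j))) ≠
        convexHull ℝ (Set.range fun j => toPlane (place X Y 1 (q j))) := by
    rintro p q ⟨α, β, j, h⟩
    exact convexHull_ne_of_lt (p := fun j => place X Y 1 (p j)) (q := fun j => place X Y 1 (q j))
      α β j fun i => by simp only [place]; linarith [h i]
  rcases Item.exceeds hk hn ha hb hab with h | h
  · exact key _ _ h
  · exact (key _ _ h).symm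

end

/-! ### Coordinates in the natural numbers -/

/-- The first coordinate of a vertex of a small triangle on the right. -/
def smallX (k n x y z v : ℕ) : ℕ :=
  if v = 0 then scaleS k n
  else if v = 1 then scaleS k n + k * scaleT k n - k * (2 * rot n 1 x y z + 1)
  else scaleS k n + k * scaleT k n + (k + 1) * (2 * rot n 2 x y z + 1)

/-- The second coordinate of a vertex of a small triangle, shifted by `4 * scaleS k n`. -/
def smallY (k n x y z v : ℕ) : ℕ :=
  if v = 0 then 4 * scaleS k n + (k + 1) * (2 * rot n 0 x y z + 1)
  else if v = 1 then 4 * scaleS k n + k * (2 * rot n 1 x y z + 1) - (k + 1) * scaleT k n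
  else 4 * scaleS k n + (k + 1) * scaleT k n + (k + 1) * (2 * rot n 2 x y z + 1)

/-- The first coordinate of `tip`. -/
def tipX (k n i l c : ℕ) : ℕ :=
  if i = 0 then scaleS k n + k * c
  else if i = 1 then scaleS k n + k * scaleT k n - k * (2 * l + c)
  else scaleS k n + k * scaleT k n + (2 * k * l + 2 * (l + c))

/-- The second coordinate of `tip`, shifted by `4 * scaleS k n`. -/
def tipY (k n i l c : ℕ) : ℕ :=
  if i = 0 then 4 * scaleS k n + (k + 1) * (2 * l + c)
  else if i = 1 then 4 * scaleS k n + (k * (2 * l + c) + c) - (k + 1) * scaleT k n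
  else 4 * scaleS k n + (k + 1) * scaleT k n + 2 * (k + 1) * l

/-- The first coordinate of a vertex of a hub on the right. -/
def hubX (k n m v : ℕ) : ℕ := if v = 2 then 4 * scaleS k n + m else 0

/-- The second coordinate of a vertex of a hub, shifted by `4 * scaleS k n`. -/
def hubY (k n m v : ℕ) : ℕ :=
  if v = 1 then 4 * scaleS k n - (3 * scaleS k n + m) else 4 * scaleS k n + scaleS k n

/-- The first coordinate of a point at distance `a` from the axis of symmetry. -/
def sidedX (k n : ℕ) (s : Bool) (a : ℕ) : ℕ :=
  if s then 5 * scaleS k n + a else 5 * scaleS k n - a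

/-- The first coordinate of a vertex of a triangle of the reduction. -/
def Item.x (k n : ℕ) : Item → ℕ → ℕ
  | .small s x y z, v => sidedX k n s (smallX k n x y z v)
  | .large i l c j l' c' _, v =>
    if v = 0 then sidedX k n true (tipX k n i l c)
    else if v = 1 then 5 * scaleS k n else sidedX k n false (tipX k n j l' c')
  | .hub s m, v => sidedX k n s (hubX k n m v)

/-- The second coordinate of a vertex of a triangle of the reduction. -/
def Item.y (k n : ℕ) : Item → ℕ → ℕ
  | .small _ x y z, v => smallY k n x y z v
  | .large i l c j l' c' m, v =>
    if v = 0 then tipY k n i l c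
    else if v = 1 then 4 * scaleS k n + (scaleS k n - scaleU k n) + m else tipY k n j l' c'
  | .hub _ m, v => hubY k n m v

theorem cast_sub_eq {a b : ℕ} {r : ℝ} (h : (b : ℝ) ≤ a) (e : (a : ℝ) - b = r) :
    ((a - b : ℕ) : ℝ) = r := by
  rw [Nat.cast_sub (by exact_mod_cast h), e]

section
variable {k n : ℕ}

theorem smallTri_bounds (hk : 10 ≤ k) (hn : 1 ≤ n) {x y z : ℕ} (hx : x < n) (hy : y < n)
    (hz : z < n) (j : Fin 3) : (smallTri k n x y z j).1 ≤ 5 * scaleS k n ∧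
      |(smallTri k n x y z j).2| ≤ 4 * scaleS k n := by
  obtain ⟨hE, hT, hkT, hET, hU, hS⟩ := scale_bounds hk hn
  have h0 := (pert_le (k := k) hx hy hz 0).1
  have h1 := (pert_le (k := k) hx hy hz 1).2
  have h2 := (pert_le (k := k) hx hy hz 2).1
  have p0 : (0 : ℝ) ≤ (k + 1) * (2 * rot n 0 x y z + 1) := by positivity
  have p1 : (0 : ℝ) ≤ k * (2 * rot n 1 x y z + 1) := by positivity
  have p2 : (0 : ℝ) ≤ (k + 1) * (2 * rot n 2 x y z + 1) := by positivity
  rw [abs_le]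
  fin_cases j
  · simp only [smallTri, smallTriangle, Fin.zero_eta, Matrix.cons_val_zero]
    refine ⟨?_, ?_, ?_⟩ <;> linarith
  · simp only [smallTri, smallTriangle, Fin.mk_one, Matrix.cons_val_one, Matrix.cons_val_zero]
    refine ⟨?_, ?_, ?_⟩ <;> linarith
  · simp only [smallTri, smallTriangle, Fin.reduceFinMk, Matrix.cons_val]
    refine ⟨?_, ?_, ?_⟩ <;> linarith

theorem cast_smallX (hk : 10 ≤ k) (hn : 1 ≤ n) {x y z : ℕ} (hx : x < n) (hy : y < n)
    (hz : z < n) (j : Fin 3) : (smallX k n x y z j : ℝ) = (smallTri k n x y z j).1 := by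
  obtain ⟨hE, hT, hkT, hET, hU, hS⟩ := scale_bounds hk hn
  have h1 := (pert_le (k := k) hx hy hz 1).2
  fin_cases j
  · simp [smallX, smallTri, smallTriangle]
  · refine cast_sub_eq ?_ ?_
    · push_cast; linarith
    · simp [smallTri, smallTriangle]
  · simp [smallX, smallTri, smallTriangle]

theorem cast_smallY (hk : 10 ≤ k) (hn : 1 ≤ n) (x y z : ℕ) (j : Fin 3) :
    (smallY k n x y z j : ℝ) = 4 * scaleS k n + (smallTri k n x y z j).2 := by
  obtain ⟨hE, hT, hkT, hET, hU, hS⟩ := scale_bounds hk hn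
  have p1 : (0 : ℝ) ≤ k * (2 * rot n 1 x y z + 1) := by positivity
  fin_cases j
  · simp [smallY, smallTri, smallTriangle]
  · refine cast_sub_eq ?_ ?_
    · push_cast; linarith
    · simp [smallTri, smallTriangle]; ring
  · simp [smallY, smallTri, smallTriangle]; ring

theorem cast_tipX (hk : 10 ≤ k) (hn : 1 ≤ n) (i : ℕ) {l c : ℕ} (h : l + c ≤ n ^ 3) :
    (tipX k n i l c : ℝ) = (tip k n i l c).1 := by
  obtain ⟨hE, hT, hkT, hET, hU, hS⟩ := scale_bounds hk hn
  have hb := pert_bounds (k := k) h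
  have kc : (0 : ℝ) ≤ k * c := by positivity
  have c0 : (0 : ℝ) ≤ c := by positivity
  have l0 : (0 : ℝ) ≤ l := by positivity
  unfold tipX tip
  split_ifs
  · push_cast; ring
  · refine cast_sub_eq ?_ ?_
    · push_cast; linarith
    · push_cast; ring
  · push_cast; ring

theorem cast_tipY (hk : 10 ≤ k) (hn : 1 ≤ n) (i : ℕ) {l c : ℕ} :
    (tipY k n i l c : ℝ) = 4 * scaleS k n + (tip k n i l c).2 := by
  obtain ⟨hE, hT, hkT, hET, hU, hS⟩ := scale_bounds hk hn
  have kc : (0 : ℝ) ≤ k * c := by positivity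
  have kl : (0 : ℝ) ≤ k * l := by positivity
  have c0 : (0 : ℝ) ≤ c := by positivity
  unfold tipY tip
  split_ifs
  · push_cast; ring
  · refine cast_sub_eq ?_ ?_
    · push_cast; linarith
    · push_cast; ring
  · push_cast; ring

theorem cast_sidedX {s : Bool} {a : ℕ} {p : ℝ × ℝ} (h : (a : ℝ) = p.1)
    (ha : p.1 ≤ 5 * scaleS k n) :
    (sidedX k n s a : ℝ) = 5 * scaleS k n + (sided s p).1 := by
  cases s
  · refine cast_sub_eq ?_ ?_
    · push_cast; linarith
    · simp [sided, mirror, h]; ring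
  · simp [sidedX, sided, h]

theorem sided_snd (s : Bool) (p : ℝ × ℝ) : (sided s p).2 = p.2 := by cases s <;> rfl

theorem sided_bounds (s : Bool) {p : ℝ × ℝ} {r : ℝ} (h0 : 0 ≤ p.1) (h : p.1 ≤ r) :
    |(sided s p).1| ≤ r := by
  cases s <;> simpa [sided, mirror, abs_of_nonneg h0] using h

/-- The coordinates describe the triangles, moved to the first quadrant. -/
theorem Item.cast_coord (hk : 10 ≤ k) (hn : 1 ≤ n) (it : Item) (hit : it.Valid k n) (j : Fin 3) :
    ((it.x k n j : ℝ), (it.y k n j : ℝ)) =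
        place (5 * scaleS k n) (4 * scaleS k n) 1 (it.tri k n j) ∧
      |(it.tri k n j).1| ≤ 5 * scaleS k n ∧ |(it.tri k n j).2| ≤ 4 * scaleS k n := by
  obtain ⟨hE, hT, hkT, hET, hU, hS⟩ := scale_bounds hk hn
  have hS0 : (0 : ℝ) < scaleS k n := by linarith
  simp only [place, one_mul, Prod.mk.injEq]
  match it, hit with
  | .small s x y z, hit =>
    obtain ⟨hx, hy, hz⟩ := hit
    have b := smallTri_bounds hk hn hx hy hz j
    refine ⟨⟨cast_sidedX (cast_smallX hk hn hx hy hz j) b.1, ?_⟩,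
      sided_bounds s (small_fst_pos hk hn hx hy hz j).le b.1, ?_⟩
    · simp only [Item.tri, sided_snd]; exact cast_smallY hk hn x y z j
    · simp only [Item.tri, sided_snd]; exact b.2
  | .large i l c j' l' c' m, hit =>
    obtain ⟨-, -, h, h', hm⟩ := hit
    have t1 := tip_bounds hk hn i h
    have t2 := tip_bounds hk hn j' h'
    obtain ⟨z1, z2, -, -⟩ := apex_bounds hk hn hm
    have hsc := (scales k n hk hn).S_eq
    fin_cases j
    · refine ⟨⟨cast_sidedX (s := true) (p := tip k n i l c) (cast_tipX hk hn i h) ?_, cast_tipY hk hn i⟩,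
        sided_bounds true (p := tip k n i l c) ?_ ?_, ?_⟩
      · linarith
      · linarith
      · linarith
      · exact t1.2.2.1.trans (by linarith)
    · refine ⟨⟨?_, ?_⟩, ?_, ?_⟩
      · simp [Item.x, Item.tri, largeTri, largeTriangle]
      · have : ((scaleS k n - scaleU k n : ℕ) : ℝ) = scaleS k n - scaleU k n :=
          cast_sub_eq (by linarith) rfl
        simp only [Item.y, Item.tri, largeTri, largeTriangle, apex, Fin.mk_one, Matrix.cons_val_one,
          Matrix.cons_val_zero, one_ne_zero, if_false, if_true]
        push_cast [this]
        linarith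
      · simp [Item.tri, largeTri, largeTriangle]
      · show |apex k n m| ≤ _
        rw [abs_of_nonneg z1]; linarith
    · refine ⟨⟨cast_sidedX (s := false) (p := tip k n j' l' c') (cast_tipX hk hn j' h') ?_, cast_tipY hk hn j'⟩,
        sided_bounds false (p := tip k n j' l' c') ?_ ?_, ?_⟩
      · linarith
      · linarith
      · linarith
      · exact t2.2.2.1.trans (by linarith)
  | .hub s m, hit =>
    have hm : (m : ℝ) ≤ scaleE k n := by exact_mod_cast hit
    have hm0 : (0 : ℝ) ≤ m := Nat.cast_nonneg m
    have b : (hubTri k n m j).1 ≤ 5 * scaleS k n := by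
      fin_cases j
      · simp [hubTri, hS0.le]
      · simp [hubTri, hS0.le]
      · simp [hubTri]; linarith
    have hX : (hubX k n m j : ℝ) = (hubTri k n m j).1 := by
      fin_cases j <;> simp [hubX, hubTri]
    have hY : (hubY k n m j : ℝ) = 4 * scaleS k n + (hubTri k n m j).2 ∧
        |(hubTri k n m j).2| ≤ 4 * scaleS k n := by
      fin_cases j
      · constructor
        · simp [hubY, hubTri]
        · simp [hubTri]; linarith
      · constructor
        · refine cast_sub_eq ?_ ?_
          · push_cast; linarith
          · simp [hubTri]; ring
        · simp [hubTri, abs_le]; constructor <;> linarith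
      · constructor
        · simp [hubY, hubTri]
        · simp [hubTri]; linarith
    refine ⟨⟨cast_sidedX hX b, ?_⟩, sided_bounds s (hub_fst_nonneg m j) b, ?_⟩
    · simp only [Item.tri, sided_snd]; exact hY.1
    · simp only [Item.tri, sided_snd]; exact hY.2

theorem Item.coord_le (hk : 10 ≤ k) (hn : 1 ≤ n) (it : Item) (hit : it.Valid k n) (j : Fin 3) :
    it.x k n j ≤ 10 * scaleS k n ∧ it.y k n j ≤ 10 * scaleS k n := by
  obtain ⟨h, h1, h2⟩ := it.cast_coord hk hn hit j
  simp only [place, one_mul, Prod.mk.injEq] at h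
  have hS : (0 : ℝ) ≤ scaleS k n := Nat.cast_nonneg _
  have e1 : (it.x k n j : ℝ) ≤ 10 * scaleS k n := by linarith [h.1, (abs_le.1 h1).2]
  have e2 : (it.y k n j : ℝ) ≤ 10 * scaleS k n := by linarith [h.2, (abs_le.1 h2).2]
  exact ⟨by exact_mod_cast e1, by exact_mod_cast e2⟩

/-- The coordinates are bounded by a power of the number of triangles. -/
def gridDegree (k : ℕ) : ℕ := 10 * k * 10 ^ 4 * (2 * (k + 1)) ^ 4 + 4

theorem le_pow_gridDegree {N : ℕ} (hN : 2 ≤ N) (hnN : n ^ 3 ≤ N) :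
    10 * scaleS k n ≤ N ^ gridDegree k := by
  calc 10 * scaleS k n = 10 * k * 10 ^ 4 * (2 * (k + 1)) ^ 4 * (n ^ 3) ^ 4 := by
        simp only [scaleS, scaleU, scaleT, scaleE]; ring
    _ ≤ N ^ (10 * k * 10 ^ 4 * (2 * (k + 1)) ^ 4) * N ^ 4 := by
        -- As `N ≥ 2`, the constant factor is at most `N` raised to that constant.
        refine Nat.mul_le_mul ?_ (Nat.pow_le_pow_left hnN 4)
        exact Nat.lt_two_pow_self.le.trans (Nat.pow_le_pow_left hN _)
    _ = N ^ gridDegree k := by rw [gridDegree, pow_add]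

end

/-! ### The triangles of a hypergraph -/

/-- The first part of the triples of type `t`. -/
def partA (t : ℕ) : ℕ := if t < 18 then t / 6 else if t = 18 then 0 else 3

/-- The second part of the triples of type `t`. -/
def partB (t : ℕ) : ℕ :=
  if t < 18 then if t % 2 = 0 then (t / 6 + 1) % 3 else 3 + t / 2 % 3
  else if t = 18 then 1 else 4

/-- The third part of the triples of type `t`. -/
def partC (t : ℕ) : ℕ :=
  if t < 18 then if t % 2 = 0 then 3 + t / 2 % 3 else 3 + (t / 2 % 3 + 1) % 3
  else if t = 18 then 2 else 5

/-- The position of a triple of type `t` in the adjacency table. -/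
def tripleIndex (n t x y z : ℕ) : ℕ :=
  ((partA t * n + x) * (6 * n) + (partB t * n + y)) * (6 * n) + (partC t * n + z)

/-- The entry of the adjacency table for a triple of type `t`. -/
def tripleBit (n : ℕ) (tab : ℕ → ℕ) (t x y z : ℕ) : ℕ := tab (tripleIndex n t x y z) % 2

/-- The large triangle for a triple of type `t < 18`, with number `m`. -/
def tripleItem (n t x y z m : ℕ) : Item :=
  if t % 2 = 0 then .large (t / 6) ((x * n + y) * n) n (t / 2 % 3) (z * n ^ 2) (n ^ 2) m
  else .large (t / 6) (x * n ^ 2) (n ^ 2) (t / 2 % 3) ((y * n + z) * n) n m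

/-- The triangle with number `m`. -/
def itemAt (n : ℕ) (tab : ℕ → ℕ) (m : ℕ) : Item :=
  if m / n ^ 3 < 18 then
    if tripleBit n tab (m / n ^ 3) (m / n ^ 2 % n) (m / n % n) (m % n) = 1 then .hub true m
    else tripleItem n (m / n ^ 3) (m / n ^ 2 % n) (m / n % n) (m % n) m
  else if m / n ^ 3 = 18 then
    if tripleBit n tab (m / n ^ 3) (m / n ^ 2 % n) (m / n % n) (m % n) = 1
    then .small true (m / n ^ 2 % n) (m / n % n) (m % n) else .hub true m
  else if m / n ^ 3 = 19 then
    if tripleBit n tab (m / n ^ 3) (m / n ^ 2 % n) (m / n % n) (m % n) = 1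
    then .small false (m / n ^ 2 % n) (m / n % n) (m % n) else .hub true m
  else if m = 20 * n ^ 3 + 1 then .hub false 0 else .hub true m

/-- The number of the triangle for a triple of type `t`. -/
def tripleNumber (n t x y z : ℕ) : ℕ := t * n ^ 3 + ((x * n + y) * n + z)

/-- The possible triangles with a given number. -/
inductive IsItem (n : ℕ) (tab : ℕ → ℕ) : ℕ → Item → Prop
  | large {t x y z : ℕ} (ht : t < 18) (hx : x < n) (hy : y < n) (hz : z < n)
      (h : tripleBit n tab t x y z ≠ 1) :
      IsItem n tab (tripleNumber n t x y z) (tripleItem n t x y z (tripleNumber n t x y z))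
  | right {x y z : ℕ} (hx : x < n) (hy : y < n) (hz : z < n)
      (h : tripleBit n tab 18 x y z = 1) : IsItem n tab (tripleNumber n 18 x y z) (.small true x y z)
  | left {x y z : ℕ} (hx : x < n) (hy : y < n) (hz : z < n)
      (h : tripleBit n tab 19 x y z = 1) : IsItem n tab (tripleNumber n 19 x y z) (.small false x y z)
  | hub_left : IsItem n tab (20 * n ^ 3 + 1) (.hub false 0)
  | hub_right (m : ℕ) : IsItem n tab m (.hub true m)

section
variable {n : ℕ} {tab : ℕ → ℕ}

theorem tripleNumber_div_mod {t x y z : ℕ} (hx : x < n) (hy : y < n) (hz : z < n) :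
    tripleNumber n t x y z / n ^ 3 = t ∧ tripleNumber n t x y z / n ^ 2 % n = x ∧
      tripleNumber n t x y z / n % n = y ∧ tripleNumber n t x y z % n = z := by
  have hn : 0 < n := by omega
  have h0 : tripleNumber n t x y z = n * ((t * n + x) * n + y) + z := by
    rw [tripleNumber]; ring
  have h1 : tripleNumber n t x y z / n = n * (t * n + x) + y := by
    rw [h0, Nat.mul_add_div hn, Nat.div_eq_of_lt hz]; ring
  have h2 : tripleNumber n t x y z / n ^ 2 = n * t + x := by
    rw [pow_two, ← Nat.div_div_eq_div_mul, h1, Nat.mul_add_div hn, Nat.div_eq_of_lt hy]; ring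
  have h3 : tripleNumber n t x y z / n ^ 3 = t := by
    rw [show n ^ 3 = n ^ 2 * n by ring, ← Nat.div_div_eq_div_mul, h2, Nat.mul_add_div hn,
      Nat.div_eq_of_lt hx, add_zero]
  refine ⟨h3, ?_, ?_, ?_⟩
  · rw [h2, Nat.mul_add_mod, Nat.mod_eq_of_lt hx]
  · rw [h1, Nat.mul_add_mod, Nat.mod_eq_of_lt hy]
  · rw [h0, Nat.mul_add_mod, Nat.mod_eq_of_lt hz]

theorem tripleNumber_digits (m : ℕ) :
    tripleNumber n (m / n ^ 3) (m / n ^ 2 % n) (m / n % n) (m % n) = m := by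
  have h2 := Nat.div_add_mod (m / n / n) n
  have h1 := Nat.div_add_mod (m / n) n
  have h0 := Nat.div_add_mod m n
  rw [show n ^ 3 = n * n * n by ring, pow_two, ← Nat.div_div_eq_div_mul, ← Nat.div_div_eq_div_mul,
    tripleNumber]
  calc _ = n * (n * (n * (m / n / n / n) + m / n / n % n) + m / n % n) + m % n := by ring
    _ = m := by rw [h2, h1, h0]

theorem isItem_itemAt (hn : 1 ≤ n) (m : ℕ) : IsItem n tab m (itemAt n tab m) := by
  have e := tripleNumber_digits (n := n) m
  have lt : ∀ a, a % n < n := fun a => Nat.mod_lt _ hn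
  unfold itemAt
  split_ifs with h1 h2 h3 h4 h5 h6 h7
  · exact .hub_right m
  · have := IsItem.large (tab := tab) h1 (lt _) (lt _) (lt _) h2
    rwa [e] at this
  · rw [h3] at h4
    have := IsItem.right (tab := tab) (lt _) (lt _) (lt _) h4
    rwa [← h3, e] at this
  · exact .hub_right m
  · rw [h5] at h6
    have := IsItem.left (tab := tab) (lt _) (lt _) (lt _) h6
    rwa [← h5, e] at this
  · exact .hub_right m
  · subst h7; exact .hub_left
  · exact .hub_right m

theorem itemAt_large {t x y z : ℕ} (ht : t < 18) (hx : x < n) (hy : y < n) (hz : z < n)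
    (h : tripleBit n tab t x y z ≠ 1) : itemAt n tab (tripleNumber n t x y z) =
      tripleItem n t x y z (tripleNumber n t x y z) := by
  obtain ⟨e0, e1, e2, e3⟩ := tripleNumber_div_mod (t := t) hx hy hz
  rw [itemAt, e0, e1, e2, e3, if_pos ht, if_neg h]

theorem itemAt_right {x y z : ℕ} (hx : x < n) (hy : y < n) (hz : z < n)
    (h : tripleBit n tab 18 x y z = 1) :
    itemAt n tab (tripleNumber n 18 x y z) = .small true x y z := by
  obtain ⟨e0, e1, e2, e3⟩ := tripleNumber_div_mod (t := 18) hx hy hz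
  rw [itemAt, e0, e1, e2, e3, if_neg (by norm_num), if_pos rfl, if_pos h]

theorem itemAt_left {x y z : ℕ} (hx : x < n) (hy : y < n) (hz : z < n)
    (h : tripleBit n tab 19 x y z = 1) :
    itemAt n tab (tripleNumber n 19 x y z) = .small false x y z := by
  obtain ⟨e0, e1, e2, e3⟩ := tripleNumber_div_mod (t := 19) hx hy hz
  rw [itemAt, e0, e1, e2, e3, if_neg (by norm_num), if_neg (by norm_num), if_pos rfl, if_pos h]

theorem itemAt_hub (hn : 1 ≤ n) : itemAt n tab (20 * n ^ 3) = .hub true (20 * n ^ 3) ∧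
    itemAt n tab (20 * n ^ 3 + 1) = .hub false 0 := by
  have hn3 : 0 < n ^ 3 := by positivity
  have h0 : 20 * n ^ 3 / n ^ 3 = 20 := Nat.mul_div_cancel _ hn3
  have h1 : 20 ≤ (20 * n ^ 3 + 1) / n ^ 3 := by
    rw [Nat.le_div_iff_mul_le hn3]; omega
  constructor
  · rw [itemAt, h0, if_neg (by norm_num), if_neg (by norm_num), if_neg (by norm_num),
      if_neg (by omega)]
  · rw [itemAt, if_neg (by omega), if_neg (by omega), if_neg (by omega), if_pos rfl]

theorem tripleNumber_lt {t x y z : ℕ} (ht : t < 20) (hx : x < n) (hy : y < n) (hz : z < n) :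
    tripleNumber n t x y z < 20 * n ^ 3 := by
  have h1 := digits_lt hx hy hz
  have h2 : (t + 1) * n ^ 3 ≤ 20 * n ^ 3 := Nat.mul_le_mul_right _ ht
  rw [Nat.add_mul, one_mul] at h2
  rw [tripleNumber]; omega

theorem IsItem.valid {k m : ℕ} (hk : 10 ≤ k) (hn : 1 ≤ n) (hm : m < 20 * n ^ 3 + 2) {it : Item}
    (h : IsItem n tab m it) : it.Valid k n := by
  -- Since `20 * n ^ 3 + 2 ≤ 22 * n ^ 3`, the number of a triangle is itself an admissible
  -- perturbation.
  have hE : 22 * n ^ 3 ≤ scaleE k n := Nat.mul_le_mul_right _ (by omega)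
  have hn3 : 1 ≤ n ^ 3 := Nat.one_le_pow _ _ hn
  cases h with
  | @large t x y z ht hx hy hz h =>
    have a1 : ∀ {x y : ℕ}, x < n → y < n → (x * n + y) * n + n ≤ n ^ 3 := fun {x y} hx hy => by
      have := digits_lt hx hy (by omega : n - 1 < n); omega
    have a2 : ∀ {x : ℕ}, x < n → x * n ^ 2 + n ^ 2 ≤ n ^ 3 := fun {x} hx => by
      have := Nat.mul_le_mul_right (n ^ 2) (Nat.succ_le_of_lt hx)
      rw [Nat.succ_mul] at this
      rwa [show n ^ 3 = n * n ^ 2 by ring]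
    unfold tripleItem
    split_ifs
    · exact ⟨by omega, by omega, a1 hx hy, a2 hz, by omega⟩
    · exact ⟨by omega, by omega, a2 hx, a1 hy hz, by omega⟩
  | right hx hy hz h => exact ⟨hx, hy, hz⟩
  | left hx hy hz h => exact ⟨hx, hy, hz⟩
  | hub_left => exact Nat.zero_le _
  | hub_right => show m ≤ _; omega

theorem exists_tripleItem_eq (n t x y z m : ℕ) :
    ∃ i l c j l' c', tripleItem n t x y z m = .large i l c j l' c' m := by
  unfold tripleItem
  split_ifs
  · exact ⟨_, _, _, _, _, _, rfl⟩
  · exact ⟨_, _, _, _, _, _, rfl⟩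

theorem IsItem.apart {m m' : ℕ} {a b : Item} (ha : IsItem n tab m a) (hb : IsItem n tab m' b)
    (h : m ≠ m') : a.Apart b := by
  cases ha with
  | @large t x y z =>
    obtain ⟨i, l, c, j, l', c', e⟩ := exists_tripleItem_eq n t x y z (tripleNumber n t x y z)
    rw [e]
    cases hb with
    | @large t₁ x₁ y₁ z₁ =>
      obtain ⟨i, l, c, j, l', c', e⟩ := exists_tripleItem_eq n t₁ x₁ y₁ z₁ (tripleNumber n t₁ x₁ y₁ z₁)
      rw [e]; exact h
    | right => trivial
    | left => trivial
    | hub_left => trivial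
    | hub_right => trivial
  | right =>
    cases hb with
    | @large t x y z =>
      obtain ⟨i, l, c, j, l', c', e⟩ := exists_tripleItem_eq n t x y z (tripleNumber n t x y z)
      rw [e]; trivial
    | right => rintro ⟨-, rfl, rfl, rfl⟩; exact h rfl
    | left => rintro ⟨h, -⟩; cases h
    | hub_left => trivial
    | hub_right => trivial
  | left =>
    cases hb with
    | @large t x y z =>
      obtain ⟨i, l, c, j, l', c', e⟩ := exists_tripleItem_eq n t x y z (tripleNumber n t x y z)
      rw [e]; trivial
    | right => rintro ⟨h, -⟩; cases h
    | left => rintro ⟨-, rfl, rfl, rfl⟩; exact h rfl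
    | hub_left => trivial
    | hub_right => trivial
  | hub_left =>
    cases hb with
    | @large t x y z =>
      obtain ⟨i, l, c, j, l', c', e⟩ := exists_tripleItem_eq n t x y z (tripleNumber n t x y z)
      rw [e]; trivial
    | right => trivial
    | left => trivial
    | hub_left => exact absurd rfl h
    | hub_right => rintro ⟨h, -⟩; cases h
  | hub_right =>
    cases hb with
    | @large t x y z =>
      obtain ⟨i, l, c, j, l', c', e⟩ := exists_tripleItem_eq n t x y z (tripleNumber n t x y z)
      rw [e]; trivial
    | right => trivial
    | left => trivial
    | hub_left => rintro ⟨h, -⟩; cases h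
    | hub_right => rintro ⟨-, h'⟩; exact h h'

/-! ### Which small triangles touch a large triangle -/

/-- The shift by `i` puts the digits `i` and `i + 1` modulo 3 in front. Every single digit and every
pair of digits arises as a prefix in this way. -/
theorem rot_right (V : ℕ → ℕ) {i : ℕ} (hi : i < 3) : rot n i (V 0) (V 1) (V 2) =
    (V i * n + V ((i + 1) % 3)) * n + V ((i + 2) % 3) := by
  interval_cases i <;> rfl

theorem rot_left (V : ℕ → ℕ) {i : ℕ} (hi : i < 3) : rot n i (V 3) (V 4) (V 5) =
    (V (3 + i) * n + V (3 + (i + 1) % 3)) * n + V (3 + (i + 2) % 3) := by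
  interval_cases i <;> rfl

theorem mem_long_interval {a b c x : ℕ} (hb : b < n) (hc : c < n) :
    x * n ^ 2 ≤ (a * n + b) * n + c ∧ (a * n + b) * n + c < x * n ^ 2 + n ^ 2 ↔ x = a := by
  have h1 : b * n + c < n ^ 2 := by
    have := Nat.mul_le_mul_right n (Nat.succ_le_of_lt hb)
    rw [Nat.succ_mul] at this; rw [pow_two]; omega
  have h2 : (a * n + b) * n + c = a * n ^ 2 + (b * n + c) := by ring
  rw [h2]
  constructor
  · rintro ⟨h3, h4⟩
    apply le_antisymm
    · by_contra h
      have := Nat.mul_le_mul_right (n ^ 2) (by omega : a + 1 ≤ x)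
      rw [Nat.add_mul, one_mul] at this
      omega
    · by_contra h
      have := Nat.mul_le_mul_right (n ^ 2) (by omega : x + 1 ≤ a)
      rw [Nat.add_mul, one_mul] at this
      omega
  · rintro rfl
    omega

theorem mem_short_interval {a b c x y : ℕ} (hb : b < n) (hc : c < n) (hy : y < n) :
    (x * n + y) * n ≤ (a * n + b) * n + c ∧ (a * n + b) * n + c < (x * n + y) * n + n ↔
      x = a ∧ y = b := by
  constructor
  · rintro ⟨h3, h4⟩
    have : x * n + y = a * n + b := by
      apply le_antisymm
      · by_contra h
        have := Nat.mul_le_mul_right n (by omega : a * n + b + 1 ≤ x * n + y)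
        rw [Nat.add_mul (a * n + b), one_mul] at this
        omega
      · by_contra h
        have := Nat.mul_le_mul_right n (by omega : x * n + y + 1 ≤ a * n + b)
        rw [Nat.add_mul (x * n + y), one_mul] at this
        omega
    exact eq_of_digits hy hb this
  · rintro ⟨rfl, rfl⟩
    omega

/-- The large triangle of a triple touches a small triangle on the right and a small triangle on
the left if and only if their labels extend the triple. -/
theorem touch_tripleItem_iff {V : ℕ → ℕ} (hV : ∀ p, V p < n) {t x y z m : ℕ} (ht : t < 18)
    (hy : y < n) (hz : z < n) :
    (Item.small true (V 0) (V 1) (V 2)).Touch n (tripleItem n t x y z m) ∧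
      (Item.small false (V 3) (V 4) (V 5)).Touch n (tripleItem n t x y z m) ↔
    x = V (partA t) ∧ y = V (partB t) ∧ z = V (partC t) := by
  have h6 : t / 6 < 3 := by omega
  have h2 : t / 2 % 3 < 3 := by omega
  unfold tripleItem partA partB partC
  simp only [if_pos ht]
  split_ifs with h
  · simp only [Item.Touch]
    rw [rot_right V h6, rot_left V h2, mem_short_interval (hV _) (hV _) hy,
      mem_long_interval (hV _) (hV _), and_assoc]
  · simp only [Item.Touch]
    rw [rot_right V h6, rot_left V h2, mem_short_interval (hV _) (hV _) hz,
      mem_long_interval (hV _) (hV _)]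

end

/-! ### Hypercliques and the adjacency table -/

namespace SixPartiteHypergraph

variable {n : ℕ} (G : SixPartiteHypergraph n)

theorem table_lt_two (m : ℕ) : G.table m < 2 := by
  unfold table
  split_ifs <;> omega

theorem vertexIndex_lt (u : Fin 6 × Fin n) : vertexIndex u < 6 * n := by
  have h1 := Nat.mul_le_mul_right n (Nat.succ_le_of_lt u.1.isLt)
  have h2 := u.2.isLt
  rw [Nat.succ_mul] at h1
  rw [vertexIndex]; omega

theorem table_eq_zero {m : ℕ} (h : 216 * n ^ 3 ≤ m) : G.table m = 0 := by
  unfold table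
  rw [if_neg]
  rintro ⟨u, v, w, -, e⟩
  have := digits_lt (vertexIndex_lt u) (vertexIndex_lt v) (vertexIndex_lt w)
  rw [show (6 * n) ^ 3 = 216 * n ^ 3 by ring] at this
  omega

theorem vertexIndex_injective : Function.Injective (vertexIndex (n := n)) := by
  intro u v h
  obtain ⟨h1, h2⟩ := eq_of_digits u.2.isLt v.2.isLt h
  exact Prod.ext (Fin.ext h1) (Fin.ext h2)

/-- Digits to base `6 * n` are unique, so a position of the table comes from only one ordered
triple. -/
theorem table_eq_one_iff (u v w : Fin 6 × Fin n) :
    G.table ((vertexIndex u * (6 * n) + vertexIndex v) * (6 * n) + vertexIndex w) = 1 ↔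
      ({u, v, w} : Finset (Fin 6 × Fin n)) ∈ G.edges := by
  unfold table
  split_ifs with h
  · refine iff_of_true rfl ?_
    obtain ⟨u', v', w', he, e⟩ := h
    obtain ⟨h1, h2⟩ := eq_of_digits (vertexIndex_lt w) (vertexIndex_lt w') e
    obtain ⟨h3, h4⟩ := eq_of_digits (vertexIndex_lt v) (vertexIndex_lt v') h1
    obtain rfl := vertexIndex_injective h2
    obtain rfl := vertexIndex_injective h3
    obtain rfl := vertexIndex_injective h4
    exact he
  · exact iff_of_false (by norm_num) fun he => h ⟨u, v, w, he, rfl⟩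

theorem part_lt (t : ℕ) : partA t < 6 ∧ partB t < 6 ∧ partC t < 6 := by
  unfold partA partB partC
  split_ifs <;> omega

theorem part_ne {t : ℕ} (ht : t < 20) :
    partA t ≠ partB t ∧ partA t ≠ partC t ∧ partB t ≠ partC t := by
  unfold partA partB partC
  split_ifs <;> omega

/-- An edge is an unordered set, so only the set of the three parts of a type matters, not their
order. -/
theorem tripleBit_eq_one_iff {V : ℕ → Fin n} (t : ℕ) :
    tripleBit n G.table t (V (partA t)) (V (partB t)) (V (partC t)) = 1 ↔
      (({partA t, partB t, partC t} : Finset ℕ).image fun p =>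
        ((Fin.ofNat 6 p, V p) : Fin 6 × Fin n)) ∈ G.edges := by
  obtain ⟨ha, hb, hc⟩ := part_lt t
  have e : ∀ p, p < 6 → p * n + V p = vertexIndex ((Fin.ofNat 6 p, V p) : Fin 6 × Fin n) :=
    fun p hp => by simp [vertexIndex, Nat.mod_eq_of_lt hp]
  rw [tripleBit, tripleIndex, Nat.mod_eq_of_lt (G.table_lt_two _), e _ ha, e _ hb, e _ hc,
    table_eq_one_iff, Finset.image_insert, Finset.image_insert, Finset.image_singleton]

/-- There are as many types as three-element sets of parts: 18 with parts on both sides, and one for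
each side. -/
theorem exists_type : ∀ i j k : Fin 6, i ≠ j → i ≠ k → j ≠ k →
    ∃ t < 20, ({partA t, partB t, partC t} : Finset ℕ) = {i.val, j.val, k.val} := by
  decide

/-- Hypercliques in terms of the adjacency table. -/
theorem hasHyperclique_iff : G.HasHyperclique ↔ ∃ V : ℕ → ℕ, (∀ p, V p < n) ∧
    ∀ t < 20, tripleBit n G.table t (V (partA t)) (V (partB t)) (V (partC t)) = 1 := by
  constructor
  · rintro ⟨v, hv⟩
    refine ⟨fun p => v (Fin.ofNat 6 p), fun p => (v _).isLt, fun t ht => ?_⟩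
    obtain ⟨ha, hb, hc⟩ := part_lt t
    obtain ⟨h1, h2, h3⟩ := part_ne ht
    rw [G.tripleBit_eq_one_iff (V := fun p => v (Fin.ofNat 6 p)), Finset.image_insert,
      Finset.image_insert, Finset.image_singleton]
    have ne : ∀ p q, p < 6 → q < 6 → p ≠ q → Fin.ofNat 6 p ≠ Fin.ofNat 6 q := by
      intro p q hp hq hpq h
      exact hpq (by simpa [Fin.ext_iff, Nat.mod_eq_of_lt hp, Nat.mod_eq_of_lt hq] using h)
    exact hv _ _ _ (ne _ _ ha hb h1) (ne _ _ ha hc h2) (ne _ _ hb hc h3)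
  · rintro ⟨V, hV, h⟩
    refine ⟨fun p => ⟨V p, hV p⟩, fun i j k hij hik hjk => ?_⟩
    obtain ⟨t, ht, e⟩ := exists_type i j k hij hik hjk
    have := (G.tripleBit_eq_one_iff (V := fun p => ⟨V p, hV p⟩) t).1 (h t ht)
    rw [e, Finset.image_insert, Finset.image_insert, Finset.image_singleton] at this
    simpa using this

end SixPartiteHypergraph

/-! ### The reduction -/

/-- The admissible relative error is `ρ = min (δ / 2) (1 / 10)`, and `k ≥ 2 / ρ` achieves it. -/
theorem exists_scale {δ : ℝ} (hδ : 0 < δ) : ∃ k : ℕ, 10 ≤ k ∧ ∀ (n : ℕ) (it : Item) (a b : ℝ),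
    1 ≤ n → it.Valid k n → IsHalfSquare δ fun j => toPlane (place a b 1 (it.tri k n j)) := by
  obtain ⟨k, hk⟩ := exists_nat_ge (2 / min (δ / 2) (1 / 10))
  have hρ : 0 < min (δ / 2) (1 / 10) := lt_min (by linarith) (by norm_num)
  refine ⟨max 10 k, le_max_left _ _, fun n it a b hn hit =>
    Item.isHalfSquare (le_max_left _ _) hn hρ ?_ (min_le_right _ _) ?_ a b it hit⟩
  · linarith [min_le_left (δ / 2) (1 / 10)]
  · rw [div_le_iff₀ hρ, mul_comm] at hk
    refine hk.trans (mul_le_mul_of_nonneg_left ?_ hρ.le)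
    exact_mod_cast le_max_right 10 k

section
variable {k n : ℕ} {shape : (Fin 3 → Plane) → Prop} {tab : ℕ → ℕ}

theorem toPlane_coord (hk : 10 ≤ k) (hn : 1 ≤ n) {it : Item} (hit : it.Valid k n) :
    (fun j : Fin 3 => toPlane ((it.x k n j : ℝ), (it.y k n j : ℝ))) =
      fun j => toPlane (place (5 * scaleS k n) (4 * scaleS k n) 1 (it.tri k n j)) := by
  funext j
  rw [(it.cast_coord hk hn hit j).1]

/-- The triangles for an adjacency table. -/
def triangles (hk : 10 ≤ k) (hn : 1 ≤ n) (hshape : ∀ (it : Item) (a b : ℝ), it.Valid k n →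
    shape fun j => toPlane (place a b 1 (it.tri k n j))) (tab : ℕ → ℕ) :
    TriangleSet shape (gridDegree k) (20 * n ^ 3 + 2) where
  coord i j l := if l.val = 0 then (itemAt n tab i).x k n j else (itemAt n tab i).y k n j
  coord_le i j l := by
    have h := (itemAt n tab i).coord_le hk hn ((isItem_itemAt hn _).valid hk hn i.isLt) j
    have h2 := le_pow_gridDegree (k := k) (n := n) (N := 20 * n ^ 3 + 2) (by omega) (by omega)
    split_ifs
    · exact h.1.trans h2
    · exact h.2.trans h2
  nondegenerate i := by
    have hv := (isItem_itemAt (tab := tab) hn _).valid hk hn i.isLt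
    have := affineIndependent_of_area_ne_zero (fun j : Fin 3 => place (5 * scaleS k n)
      (4 * scaleS k n) 1 ((itemAt n tab i).tri k n j))
      (by rw [area_place]; exact Item.area_ne_zero hk hn _ hv)
    rwa [← toPlane_coord hk hn hv] at this
  shape_of i := by
    have hv := (isItem_itemAt (tab := tab) hn _).valid hk hn i.isLt
    have := hshape _ (5 * scaleS k n) (4 * scaleS k n) hv
    rwa [← toPlane_coord hk hn hv] at this
  distinct i j h := by
    by_contra hij
    have hi := isItem_itemAt (tab := tab) hn i
    have hj := isItem_itemAt (tab := tab) hn j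
    have vi := hi.valid hk hn i.isLt
    have vj := hj.valid hk hn j.isLt
    have := Item.convexHull_ne hk hn vi vj (hi.apart hj fun e => hij (Fin.ext e))
      (5 * scaleS k n) (4 * scaleS k n)
    rw [← toPlane_coord hk hn vi, ← toPlane_coord hk hn vj] at this
    exact this h

theorem words_triangles (hk : 10 ≤ k) (hn : 1 ≤ n) (hshape) (q : ℕ) :
    (triangles (shape := shape) hk hn hshape tab).words q = if q < 6 * (20 * n ^ 3 + 2) then
      if q % 2 = 0 then (itemAt n tab (q / 6)).x k n (q % 6 / 2)
      else (itemAt n tab (q / 6)).y k n (q % 6 / 2) else 0 := by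
  unfold TriangleSet.words
  by_cases h : q / 6 < 20 * n ^ 3 + 2
  · rw [dif_pos h, if_pos (by omega)]; rfl
  · rw [dif_neg h, if_neg (by omega)]

theorem adj_triangles (hk : 10 ≤ k) (hn : 1 ≤ n) (hshape) (i j : Fin (20 * n ^ 3 + 2)) :
    (triangles (shape := shape) hk hn hshape tab).intersectionGraph.Adj i j ↔
      i ≠ j ∧ Meet ((itemAt n tab i).tri k n) ((itemAt n tab j).tri k n) := by
  have hi := (isItem_itemAt (tab := tab) hn _).valid hk hn i.isLt
  have hj := (isItem_itemAt (tab := tab) hn _).valid hk hn j.isLt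
  refine and_congr_right fun _ => ?_
  rw [← meet_place_iff (a := 5 * scaleS k n) (b := 4 * scaleS k n) one_ne_zero,
    ← inter_convexHull_nonempty_iff, ← toPlane_coord hk hn hi, ← toPlane_coord hk hn hj]
  rfl

theorem Item.touch_hub {a : Item} {s : Bool} (m : ℕ) (h : ∀ x y z, a ≠ .small (!s) x y z) :
    a.Regular (.hub s m) ∧ a.Touch n (.hub s m) := by
  match a with
  | .small s' x y z =>
    have : s' = s := by
      by_contra hs
      exact h x y z (by rw [Bool.eq_not.2 hs])
    subst this
    cases s' <;> exact ⟨trivial, rfl⟩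
  | .large _ _ _ _ _ _ _ => exact ⟨trivial, trivial⟩
  | .hub _ _ => exact ⟨trivial, trivial⟩

theorem IsItem.tripleBit_right {m x y z : ℕ} {c : Item} (h : IsItem n tab m c)
    (hc : c = .small true x y z) : tripleBit n tab 18 x y z = 1 := by
  cases h with
  | @large t x₁ y₁ z₁ =>
    obtain ⟨i, l, c, j, l', c', e⟩ := exists_tripleItem_eq n t x₁ y₁ z₁ (tripleNumber n t x₁ y₁ z₁)
    rw [e] at hc; cases hc
  | right _ _ _ h => cases hc; exact h
  | left => cases hc
  | hub_left => cases hc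
  | hub_right => cases hc

theorem IsItem.tripleBit_left {m x y z : ℕ} {c : Item} (h : IsItem n tab m c)
    (hc : c = .small false x y z) : tripleBit n tab 19 x y z = 1 := by
  cases h with
  | @large t x₁ y₁ z₁ =>
    obtain ⟨i, l, c, j, l', c', e⟩ := exists_tripleItem_eq n t x₁ y₁ z₁ (tripleNumber n t x₁ y₁ z₁)
    rw [e] at hc; cases hc
  | right => cases hc
  | left _ _ _ h => cases hc; exact h
  | hub_left => cases hc
  | hub_right => cases hc

/-- A triangle `c` adjacent to a right and a left small triangle must be large: a hub misses the
small triangles of the other side, and so does a small triangle. The premises are implications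
because `Touch` describes only the regular pairs; `h₃` covers the case that `c` is itself a small
triangle on the right. -/
theorem IsItem.exists_triple {V : ℕ → ℕ} (hV : ∀ p, V p < n) {m : ℕ} {c : Item}
    (h : IsItem n tab m c)
    (h₁ : Item.Regular (.small true (V 0) (V 1) (V 2)) c →
      Item.Touch n (.small true (V 0) (V 1) (V 2)) c)
    (h₂ : Item.Regular (.small false (V 3) (V 4) (V 5)) c →
      Item.Touch n (.small false (V 3) (V 4) (V 5)) c)
    (h₃ : c.Regular (.small false (V 3) (V 4) (V 5)) →
      c.Touch n (.small false (V 3) (V 4) (V 5))) :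
    ∃ t < 18, tripleBit n tab t (V (partA t)) (V (partB t)) (V (partC t)) ≠ 1 := by
  cases h with
  | @large t x y z ht hx hy hz h =>
    obtain ⟨i, l, c, j, l', c', e⟩ := exists_tripleItem_eq n t x y z (tripleNumber n t x y z)
    obtain ⟨rfl, rfl, rfl⟩ := (touch_tripleItem_iff hV ht hy hz).1
      ⟨h₁ (by rw [e]; trivial), h₂ (by rw [e]; trivial)⟩
    exact ⟨t, ht, h⟩
  | right => exact (h₃ trivial).elim
  | left => exact (h₁ trivial).elim
  | hub_left => cases (h₁ trivial : true = false)
  | hub_right => cases (h₂ trivial : false = true)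

/-- The intersection graph of the triangles has diameter at most two if and only if no choice of
labels satisfies all triples. -/
theorem ediam_triangles_le_two_iff (hk : 10 ≤ k) (hn : 1 ≤ n) (hshape) :
    (triangles (shape := shape) hk hn hshape tab).intersectionGraph.ediam ≤ 2 ↔
      ¬ ∃ V : ℕ → ℕ, (∀ p, V p < n) ∧
        ∀ t < 20, tripleBit n tab t (V (partA t)) (V (partB t)) (V (partC t)) = 1 := by
  set G := (triangles (shape := shape) hk hn hshape tab).intersectionGraph with hG
  have adj : ∀ i j : Fin (20 * n ^ 3 + 2), i ≠ j →
      (itemAt n tab i).Regular (itemAt n tab j) →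
      (G.Adj i j ↔ (itemAt n tab i).Touch n (itemAt n tab j)) := fun i j hij hr => by
    rw [hG, adj_triangles, and_iff_right hij]
    exact meet_iff_touch hk hn ((isItem_itemAt hn _).valid hk hn i.isLt)
      ((isItem_itemAt hn _).valid hk hn j.isLt) hr
  have near : ∀ (s : Bool) (h i : Fin (20 * n ^ 3 + 2)) (m : ℕ), itemAt n tab h = .hub s m →
      (∀ x y z, itemAt n tab i ≠ .small (!s) x y z) → G.edist i h ≤ 1 := fun s h i m e hi => by
    rw [SimpleGraph.edist_le_one_iff_adj_or_eq]
    by_cases hih : i = h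
    · exact .inr hih
    · obtain ⟨h1, h2⟩ := Item.touch_hub (n := n) m hi
      exact .inl ((adj i h hih (by rwa [e])).2 (by rwa [e]))
  have through : ∀ i w j : Fin (20 * n ^ 3 + 2), G.edist i w ≤ 1 → G.edist j w ≤ 1 →
      G.edist i j ≤ 2 := fun i w j h1 h2 => by
    rw [SimpleGraph.edist_comm] at h2
    calc G.edist i j ≤ G.edist i w + G.edist w j := SimpleGraph.edist_triangle
      _ ≤ 1 + 1 := add_le_add h1 h2
      _ = 2 := by norm_num
  rw [SimpleGraph.ediam_le_iff]
  constructor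
  · rintro h ⟨V, hV, hall⟩
    set a : Fin (20 * n ^ 3 + 2) := ⟨tripleNumber n 18 (V 0) (V 1) (V 2),
      (tripleNumber_lt (by norm_num) (hV _) (hV _) (hV _)).trans (by omega)⟩
    set b : Fin (20 * n ^ 3 + 2) := ⟨tripleNumber n 19 (V 3) (V 4) (V 5),
      (tripleNumber_lt (by norm_num) (hV _) (hV _) (hV _)).trans (by omega)⟩
    have ea : itemAt n tab a = .small true (V 0) (V 1) (V 2) :=
      itemAt_right (hV _) (hV _) (hV _) (hall 18 (by norm_num))
    have eb : itemAt n tab b = .small false (V 3) (V 4) (V 5) :=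
      itemAt_left (hV _) (hV _) (hV _) (hall 19 (by norm_num))
    have hab : a ≠ b := fun e => by rw [e, eb] at ea; cases ea
    have nadj : ¬ G.Adj a b := fun hadj => by
      have := (adj a b hab (by rw [ea, eb]; trivial)).1 hadj
      rw [ea, eb] at this
      exact this
    have hne : ¬ 2 < G.edist a b := not_lt.2 (h a b)
    rw [SimpleGraph.two_lt_edist_iff] at hne
    obtain ⟨w, hw⟩ : (G.commonNeighbors a b).Nonempty := by
      rw [Set.nonempty_iff_ne_empty]
      exact fun he => hne ⟨hab, nadj, he⟩
    obtain ⟨ha, hb⟩ := (SimpleGraph.mem_commonNeighbors G).1 hw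
    obtain ⟨t, ht, hbit⟩ := (isItem_itemAt (tab := tab) hn w).exists_triple hV
      (fun hr => by rw [← ea] at hr ⊢; exact (adj a w ha.ne hr).1 ha)
      (fun hr => by rw [← eb] at hr ⊢; exact (adj b w hb.ne hr).1 hb)
      (fun hr => by rw [← eb] at hr ⊢; exact (adj w b hb.ne' hr).1 hb.symm)
    exact hbit (hall t (by omega))
  · intro h
    have key : ∀ i j : Fin (20 * n ^ 3 + 2), ∀ x y z x' y' z',
        itemAt n tab i = .small true x y z → itemAt n tab j = .small false x' y' z' →
        G.edist i j ≤ 2 := by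
      intro i j x y z x' y' z' ei ej
      have hi := isItem_itemAt (tab := tab) hn i
      have hj := isItem_itemAt (tab := tab) hn j
      have vi := hi.valid hk hn i.isLt
      have vj := hj.valid hk hn j.isLt
      rw [ei] at hi vi
      rw [ej] at hj vj
      set V : ℕ → ℕ := fun p => (![x, y, z, x', y', z'] : Fin 6 → ℕ) (Fin.ofNat 6 p)
      have hV : ∀ p, V p < n := by
        have : ∀ p : Fin 6, (![x, y, z, x', y', z'] : Fin 6 → ℕ) p < n := by
          intro p
          fin_cases p
          exacts [vi.1, vi.2.1, vi.2.2, vj.1, vj.2.1, vj.2.2]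
        exact fun p => this _
      have : ∃ t < 20, tripleBit n tab t (V (partA t)) (V (partB t)) (V (partC t)) ≠ 1 := by
        by_contra! hc
        exact h ⟨V, hV, hc⟩
      obtain ⟨t, ht, hbit⟩ := this
      -- The two small triangles exist, so their own labels are edges and the non-edge has vertices
      -- on both sides.
      have ht' : t < 18 := by
        by_contra ht'
        obtain rfl | rfl : t = 18 ∨ t = 19 := by omega
        · exact hbit (hi.tripleBit_right rfl)
        · exact hbit (hj.tripleBit_left rfl)
      set w : Fin (20 * n ^ 3 + 2) :=
        ⟨tripleNumber n t (V (partA t)) (V (partB t)) (V (partC t)),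
          (tripleNumber_lt ht (hV _) (hV _) (hV _)).trans (by omega)⟩ with hw
      have ew : itemAt n tab w = tripleItem n t (V (partA t)) (V (partB t)) (V (partC t)) w :=
        itemAt_large ht' (hV _) (hV _) (hV _) hbit
      obtain ⟨t1, t2⟩ := (touch_tripleItem_iff (m := w) hV ht' (hV (partB t))
        (hV (partC t))).2 ⟨rfl, rfl, rfl⟩
      obtain ⟨i₁, l, c, j₁, l', c', e⟩ := exists_tripleItem_eq n t (V (partA t)) (V (partB t))
        (V (partC t)) w
      refine through i w j ?_ ?_
      · rw [SimpleGraph.edist_le_one_iff_adj_or_eq]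
        refine .inl ((adj i w (fun hc => ?_) ?_).2 ?_)
        · rw [hc, ew, e] at ei; cases ei
        · rw [ei, ew, e]; trivial
        · rw [ei, ew]; exact t1
      · rw [SimpleGraph.edist_le_one_iff_adj_or_eq]
        refine .inl ((adj j w (fun hc => ?_) ?_).2 ?_)
        · rw [hc, ew, e] at ej; cases ej
        · rw [ej, ew, e]; trivial
        · rw [ej, ew]; exact t2
    obtain ⟨e₁, e₀⟩ := itemAt_hub (tab := tab) hn
    set r : Fin (20 * n ^ 3 + 2) := ⟨20 * n ^ 3, by omega⟩
    set l : Fin (20 * n ^ 3 + 2) := ⟨20 * n ^ 3 + 1, by omega⟩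
    intro i j
    by_cases hi : ∃ x y z, itemAt n tab i = .small true x y z
    · obtain ⟨x, y, z, ei⟩ := hi
      by_cases hj : ∃ x y z, itemAt n tab j = .small false x y z
      · obtain ⟨x', y', z', ej⟩ := hj
        exact key i j x y z x' y' z' ei ej
      -- Neither triangle is a small one on the left, so the right hub links them.
      · push Not at hj
        exact through i r j (near true r i _ e₁ fun _ _ _ => by rw [ei]; simp)
          (near true r j _ e₁ hj)
    · push Not at hi
      by_cases hj : ∃ x y z, itemAt n tab j = .small true x y z
      · obtain ⟨x, y, z, ej⟩ := hj
        by_cases hi' : ∃ x y z, itemAt n tab i = .small false x y z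
        · obtain ⟨x', y', z', ei⟩ := hi'
          rw [SimpleGraph.edist_comm]
          exact key j i x y z x' y' z' ej ei
        · push Not at hi'
          exact through i r j (near true r i _ e₁ hi')
            (near true r j _ e₁ fun _ _ _ => by rw [ej]; simp)
      -- Neither triangle is a small one on the right, so the left hub links them.
      · push Not at hj
        exact through i l j (near false l i _ e₀ hi) (near false l j _ e₀ hj)

end

/-! ### The reduction as an arithmetic expression -/

namespace WordRAM.Expr

instance : Add Expr := ⟨.op .add⟩
instance : Sub Expr := ⟨.op .sub⟩
instance : Mul Expr := ⟨.op .mul⟩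
instance : Div Expr := ⟨.op .div⟩
instance : Mod Expr := ⟨.op .mod⟩
instance (v : ℕ) : OfNat Expr v := ⟨.const v⟩

section
variable (n i : ℕ) (mem : ℕ → ℕ) (a b c d : Expr) (v : ℕ)

@[simp] theorem eval_size : eval n i mem size = n := (rfl)
@[simp] theorem eval_index : eval n i mem index = i := (rfl)
@[simp] theorem eval_const : (const v).eval n i mem = v := (rfl)
@[simp] theorem eval_ofNat : eval n i mem (no_index (OfNat.ofNat v)) = OfNat.ofNat v := (rfl)
@[simp] theorem eval_bit : (bit a).eval n i mem = mem (a.eval n i mem) % 2 := (rfl)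
@[simp] theorem eval_add : (a + b).eval n i mem = a.eval n i mem + b.eval n i mem := (rfl)
@[simp] theorem eval_sub : (a - b).eval n i mem = a.eval n i mem - b.eval n i mem := (rfl)
@[simp] theorem eval_mul : (a * b).eval n i mem = a.eval n i mem * b.eval n i mem := (rfl)
@[simp] theorem eval_div : (a / b).eval n i mem = a.eval n i mem / b.eval n i mem := (rfl)
@[simp] theorem eval_mod : (a % b).eval n i mem = a.eval n i mem % b.eval n i mem := (rfl)

/-- The number one if the values of `a` and `b` are equal, and zero otherwise. -/
def indicator (a b : Expr) : Expr := 1 / (1 + ((a - b) + (b - a)))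

/-- Of the two truncated differences at least one is zero, and their sum vanishes exactly in case of
equality. -/
theorem eval_indicator : (indicator a b).eval n i mem =
    if a.eval n i mem = b.eval n i mem then 1 else 0 := by
  simp only [indicator, eval_div, eval_add, eval_sub, eval_ofNat]
  split_ifs with h
  · simp [h]
  · exact Nat.div_eq_of_lt (by omega)

/-- The value of `c` if those of `a` and `b` are equal, and that of `d` otherwise. -/
def ifEq (a b c d : Expr) : Expr := indicator a b * c + (1 - indicator a b) * d

@[simp] theorem eval_ifEq : (ifEq a b c d).eval n i mem =
    if a.eval n i mem = b.eval n i mem then c.eval n i mem else d.eval n i mem := by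
  simp only [ifEq, eval_add, eval_mul, eval_sub, eval_ofNat, eval_indicator]
  split_ifs <;> simp

/-- The value of `c` if that of `a` is less than that of `b`, and that of `d` otherwise. -/
def ifLt (a b c d : Expr) : Expr := ifEq (b - a) 0 d c

@[simp] theorem eval_ifLt : (ifLt a b c d).eval n i mem =
    if a.eval n i mem < b.eval n i mem then c.eval n i mem else d.eval n i mem := by
  simp only [ifLt, eval_ifEq, eval_sub, eval_ofNat]
  by_cases h : a.eval n i mem < b.eval n i mem
  · rw [if_pos h, if_neg (by omega)]
  · rw [if_neg h, if_pos (by omega)]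

end

/-! #### Coordinates -/

/-- The expression for `scaleE`. -/
def scaleE (k : ℕ) : Expr := 2 * (const k + 1) * (size * size * size)

/-- The expression for `scaleT`. -/
def scaleT (k : ℕ) : Expr := 100 * (scaleE k * scaleE k)

/-- The expression for `scaleU`. -/
def scaleU (k : ℕ) : Expr := scaleT k * scaleT k

/-- The expression for `scaleS`. -/
def scaleS (k : ℕ) : Expr := const k * scaleU k

/-- The expression for `rot`. -/
def rot (i x y z : Expr) : Expr :=
  ifEq i 0 ((x * size + y) * size + z)
    (ifEq i 1 ((y * size + z) * size + x) ((z * size + x) * size + y))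

/-- The expression for `smallX`. -/
def smallX (k : ℕ) (x y z v : Expr) : Expr :=
  ifEq v 0 (scaleS k) (ifEq v 1
    (scaleS k + const k * scaleT k - const k * (2 * rot 1 x y z + 1))
    (scaleS k + const k * scaleT k + (const k + 1) * (2 * rot 2 x y z + 1)))

/-- The expression for `smallY`. -/
def smallY (k : ℕ) (x y z v : Expr) : Expr :=
  ifEq v 0 (4 * scaleS k + (const k + 1) * (2 * rot 0 x y z + 1)) (ifEq v 1
    (4 * scaleS k + const k * (2 * rot 1 x y z + 1) - (const k + 1) * scaleT k)
    (4 * scaleS k + (const k + 1) * scaleT k + (const k + 1) * (2 * rot 2 x y z + 1)))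

/-- The expression for `tipX`. -/
def tipX (k : ℕ) (i l c : Expr) : Expr :=
  ifEq i 0 (scaleS k + const k * c) (ifEq i 1
    (scaleS k + const k * scaleT k - const k * (2 * l + c))
    (scaleS k + const k * scaleT k + (2 * const k * l + 2 * (l + c))))

/-- The expression for `tipY`. -/
def tipY (k : ℕ) (i l c : Expr) : Expr :=
  ifEq i 0 (4 * scaleS k + (const k + 1) * (2 * l + c)) (ifEq i 1
    (4 * scaleS k + (const k * (2 * l + c) + c) - (const k + 1) * scaleT k)
    (4 * scaleS k + (const k + 1) * scaleT k + 2 * (const k + 1) * l))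

/-- The expression for `hubX`. -/
def hubX (k : ℕ) (m v : Expr) : Expr := ifEq v 2 (4 * scaleS k + m) 0

/-- The expression for `hubY`. -/
def hubY (k : ℕ) (m v : Expr) : Expr :=
  ifEq v 1 (4 * scaleS k - (3 * scaleS k + m)) (4 * scaleS k + scaleS k)

/-- The expression for `sidedX`. -/
def sidedX (k : ℕ) (s : Bool) (a : Expr) : Expr :=
  if s then 5 * scaleS k + a else 5 * scaleS k - a

section
variable (k n p : ℕ) (mem : ℕ → ℕ) (i x y z l c m v a : Expr)

@[simp] theorem eval_scaleE : (scaleE k).eval n p mem = _root_.scaleE k n := by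
  simp only [scaleE, _root_.scaleE, eval_mul, eval_add, eval_const, eval_ofNat, eval_size]
  ring

@[simp] theorem eval_scaleT : (scaleT k).eval n p mem = _root_.scaleT k n := by
  simp [scaleT, _root_.scaleT, pow_two]

@[simp] theorem eval_scaleU : (scaleU k).eval n p mem = _root_.scaleU k n := by
  simp [scaleU, _root_.scaleU, pow_two]

@[simp] theorem eval_scaleS : (scaleS k).eval n p mem = _root_.scaleS k n := by
  simp [scaleS, _root_.scaleS]

@[simp] theorem eval_rot : (rot i x y z).eval n p mem = _root_.rot n (i.eval n p mem)
    (x.eval n p mem) (y.eval n p mem) (z.eval n p mem) := by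
  simp only [rot, _root_.rot, eval_ifEq, eval_add, eval_mul, eval_size, eval_ofNat]

@[simp] theorem eval_smallX : (smallX k x y z v).eval n p mem = _root_.smallX k n
    (x.eval n p mem) (y.eval n p mem) (z.eval n p mem) (v.eval n p mem) := by
  simp [smallX, _root_.smallX]

@[simp] theorem eval_smallY : (smallY k x y z v).eval n p mem = _root_.smallY k n
    (x.eval n p mem) (y.eval n p mem) (z.eval n p mem) (v.eval n p mem) := by
  simp [smallY, _root_.smallY]

@[simp] theorem eval_tipX : (tipX k i l c).eval n p mem = _root_.tipX k n
    (i.eval n p mem) (l.eval n p mem) (c.eval n p mem) := by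
  simp [tipX, _root_.tipX]

@[simp] theorem eval_tipY : (tipY k i l c).eval n p mem = _root_.tipY k n
    (i.eval n p mem) (l.eval n p mem) (c.eval n p mem) := by
  simp [tipY, _root_.tipY]

@[simp] theorem eval_hubX : (hubX k m v).eval n p mem = _root_.hubX k n
    (m.eval n p mem) (v.eval n p mem) := by
  simp [hubX, _root_.hubX]

@[simp] theorem eval_hubY : (hubY k m v).eval n p mem = _root_.hubY k n
    (m.eval n p mem) (v.eval n p mem) := by
  simp [hubY, _root_.hubY]

@[simp] theorem eval_sidedX (s : Bool) : (sidedX k s a).eval n p mem = _root_.sidedX k n s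
    (a.eval n p mem) := by
  cases s <;> simp [sidedX, _root_.sidedX]

end

/-! #### The triangle with a given number -/

/-- The expression for `partA`. -/
def partA (t : Expr) : Expr := ifLt t 18 (t / 6) (ifEq t 18 0 3)

/-- The expression for `partB`. -/
def partB (t : Expr) : Expr :=
  ifLt t 18 (ifEq (t % 2) 0 ((t / 6 + 1) % 3) (3 + t / 2 % 3)) (ifEq t 18 1 4)

/-- The expression for `partC`. -/
def partC (t : Expr) : Expr :=
  ifLt t 18 (ifEq (t % 2) 0 (3 + t / 2 % 3) (3 + (t / 2 % 3 + 1) % 3)) (ifEq t 18 2 5)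

/-- The expression for `tripleIndex`. -/
def tripleIndex (t x y z : Expr) : Expr :=
  ((partA t * size + x) * (6 * size) + (partB t * size + y)) * (6 * size) + (partC t * size + z)

/-- The square of the size. -/
def sizeSq : Expr := size * size

/-- The cube of the size. -/
def sizeCube : Expr := size * size * size

/-- The expression for a quantity that depends on the triangle with number `m` and is described
by `small`, `large` and `hub` for the three kinds of triangles. -/
def atItem (small : Bool → Expr → Expr → Expr → Expr)
    (large : Expr → Expr → Expr → Expr → Expr → Expr → Expr → Expr) (hub : Bool → Expr → Expr)
    (m : Expr) : Expr :=
  let t := m / sizeCube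
  let x := m / sizeSq % size
  let y := m / size % size
  let z := m % size
  let b := bit (tripleIndex t x y z)
  ifLt t 18
    (ifEq b 1 (hub true m)
      (ifEq (t % 2) 0 (large (t / 6) ((x * size + y) * size) size (t / 2 % 3) (z * sizeSq) sizeSq m)
        (large (t / 6) (x * sizeSq) sizeSq (t / 2 % 3) ((y * size + z) * size) size m)))
    (ifEq t 18 (ifEq b 1 (small true x y z) (hub true m))
      (ifEq t 19 (ifEq b 1 (small false x y z) (hub true m))
        (ifEq m (20 * sizeCube + 1) (hub false 0) (hub true m))))

section
variable (n p : ℕ) (mem : ℕ → ℕ)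

@[simp] theorem eval_sizeSq : sizeSq.eval n p mem = n ^ 2 := (pow_two n).symm

@[simp] theorem eval_sizeCube : sizeCube.eval n p mem = n ^ 3 := by
  simp only [sizeCube, eval_mul, eval_size]; ring

@[simp] theorem eval_tripleIndex (t x y z : Expr) : (tripleIndex t x y z).eval n p mem =
    _root_.tripleIndex n (t.eval n p mem) (x.eval n p mem) (y.eval n p mem) (z.eval n p mem) := by
  simp only [tripleIndex, _root_.tripleIndex, partA, _root_.partA, partB, _root_.partB, partC,
    _root_.partC, eval_ifLt, eval_ifEq, eval_add, eval_mul, eval_div, eval_mod, eval_size,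
    eval_ofNat]

theorem eval_tripleBit (t x y z : Expr) : (bit (tripleIndex t x y z)).eval n p mem =
    tripleBit n mem (t.eval n p mem) (x.eval n p mem) (y.eval n p mem) (z.eval n p mem) := by
  rw [eval_bit, eval_tripleIndex, tripleBit]

/-- Stated for an arbitrary quantity `f`, so that both coordinates share one case distinction. -/
theorem eval_atItem {small : Bool → Expr → Expr → Expr → Expr}
    {large : Expr → Expr → Expr → Expr → Expr → Expr → Expr → Expr} {hub : Bool → Expr → Expr}
    (f : Item → ℕ)
    (hs : ∀ s x y z, (small s x y z).eval n p mem =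
      f (.small s (x.eval n p mem) (y.eval n p mem) (z.eval n p mem)))
    (hl : ∀ i l c j l' c' m, (large i l c j l' c' m).eval n p mem =
      f (.large (i.eval n p mem) (l.eval n p mem) (c.eval n p mem) (j.eval n p mem)
        (l'.eval n p mem) (c'.eval n p mem) (m.eval n p mem)))
    (hh : ∀ s m, (hub s m).eval n p mem = f (.hub s (m.eval n p mem))) (m : Expr) :
    (atItem small large hub m).eval n p mem = f (itemAt n mem (m.eval n p mem)) := by
  simp only [itemAt, tripleItem, apply_ite f]
  simp only [atItem, eval_ifLt, eval_ifEq, hs, hl, hh, eval_tripleBit, eval_div, eval_mod, eval_mul,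
    eval_add, eval_size, eval_sizeSq, eval_sizeCube, eval_ofNat]

end

/-- The expression for `Item.x`. -/
def coordX (k : ℕ) (m v : Expr) : Expr :=
  atItem (fun s x y z => sidedX k s (smallX k x y z v))
    (fun i l c j l' c' _ => ifEq v 0 (sidedX k true (tipX k i l c))
      (ifEq v 1 (5 * scaleS k) (sidedX k false (tipX k j l' c'))))
    (fun s m => sidedX k s (hubX k m v)) m

/-- The expression for `Item.y`. -/
def coordY (k : ℕ) (m v : Expr) : Expr :=
  atItem (fun _ x y z => smallY k x y z v)
    (fun i l c j l' c' m => ifEq v 0 (tipY k i l c)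
      (ifEq v 1 (4 * scaleS k + (scaleS k - scaleU k) + m) (tipY k j l' c')))
    (fun _ m => hubY k m v) m

/-- The word with a given index of the list of all coordinates of the triangles. -/
def word (k : ℕ) : Expr :=
  ifEq (index % 2) 0 (coordX k (index / 6) (index % 6 / 2)) (coordY k (index / 6) (index % 6 / 2))

theorem eval_word (k n q : ℕ) (mem : ℕ → ℕ) : (word k).eval n q mem =
    if q % 2 = 0 then (itemAt n mem (q / 6)).x k n (q % 6 / 2)
    else (itemAt n mem (q / 6)).y k n (q % 6 / 2) := by
  have hx : (coordX k (index / 6) (index % 6 / 2)).eval n q mem =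
      (itemAt n mem (q / 6)).x k n (q % 6 / 2) :=
    eval_atItem n q mem (fun it => it.x k n (q % 6 / 2)) (fun s x y z => by simp [Item.x])
      (fun i l c j l' c' m => by simp [Item.x]) (fun s m => by simp [Item.x]) _
  have hy : (coordY k (index / 6) (index % 6 / 2)).eval n q mem =
      (itemAt n mem (q / 6)).y k n (q % 6 / 2) :=
    eval_atItem n q mem (fun it => it.y k n (q % 6 / 2)) (fun s x y z => by simp [Item.y])
      (fun i l c j l' c' m => by simp [Item.y]) (fun s m => by simp [Item.y]) _
  rw [word, eval_ifEq, hx, hy]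
  rfl

end WordRAM.Expr

/-! ### From the diameter problem to the hyperclique problem. -/

open WordRAM in
theorem hypercliqueProblem_solvableInTime {ε : ℝ} {k : ℕ} (hk : 10 ≤ k)
    {shape : (Fin 3 → Plane) → Prop}
    (hshape : ∀ (n : ℕ) (it : Item) (a b : ℝ), 1 ≤ n → it.Valid k n →
      shape fun j => toPlane (place a b 1 (it.tri k n j))) (hε : ε ≤ 1)
    (h : (diameterTwoProblem shape (gridDegree k)).SolvableInTime (2 - ε)) :
    hypercliqueProblem.SolvableInTime (6 - 3 * ε) := by
  refine solvableInTime_of_reduction hypercliqueProblem (diameterTwoProblem shape (gridDegree k))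
    (216 * Expr.sizeCube) (6 * (20 * Expr.sizeCube + 2)) (20 * Expr.sizeCube + 2) (Expr.word k)
    (fun n => 216 * n ^ 3) (fun n => 6 * (20 * n ^ 3 + 2)) (fun n => 20 * n ^ 3 + 2) 216
    (fun n i mem => by simp) (fun n i mem => by simp) (fun n i mem => by simp)
    (fun n G m => G.table_lt_two m) (fun n G m hm => G.table_eq_zero hm) (fun n _ => le_rfl)
    (fun n hn => ?_) (fun n hn => ?_) (fun n _ => by omega) (fun n hn G => ?_) hε h
  · have := Nat.one_le_pow 3 n hn
    omega
  · have := Nat.one_le_pow 3 n hn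
    omega
  · refine ⟨triangles hk hn (fun it a b => hshape n it a b hn) G.table, fun q => ?_, ?_⟩
    · rw [Expr.eval_word]
      exact words_triangles hk hn _ q
    · refine (ediam_triangles_le_two_iff hk hn _).trans (not_congr ?_)
      exact G.hasHyperclique_iff.symm

/-! ### Conclusion. -/

theorem WordRAM.Problem.SolvableInTime.mono {Q : WordRAM.Problem} {e e' : ℝ} (h : e ≤ e')
    (hQ : Q.SolvableInTime e) : Q.SolvableInTime e' := by
  obtain ⟨P, c, K, hP⟩ := hQ
  refine ⟨P, c, |K|, fun n hn x => ?_⟩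
  obtain ⟨t, s, he, ht, hs⟩ := hP n hn x
  refine ⟨t, s, he, ht.trans ?_, hs⟩
  have : (n : ℝ) ^ e ≤ (n : ℝ) ^ e' :=
    Real.rpow_le_rpow_of_exponent_le (by exact_mod_cast hn) h
  calc K * (n : ℝ) ^ e ≤ |K| * (n : ℝ) ^ e := by gcongr; exact le_abs_self K
    _ ≤ |K| * (n : ℝ) ^ e' := by gcongr

/-- The hardness of the diameter problem for every shape that includes half-squares. -/
theorem exists_not_solvableInTime (hyp : HypercliqueHypothesis) {δ : ℝ} (hδ : 0 < δ)
    {shape : (Fin 3 → Plane) → Prop} (hshape : ∀ p, IsHalfSquare δ p → shape p) :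
    ∃ d : ℕ, ∀ ε : ℝ, 0 < ε → ¬ (diameterTwoProblem shape d).SolvableInTime (2 - ε) := by
  obtain ⟨k, hk, h⟩ := exists_scale hδ
  refine ⟨gridDegree k, fun ε hε hs => ?_⟩
  -- The reduction needs `ε ≤ 1`; replacing `ε` by `min ε 1` only weakens the assumed running time.
  have hε' : 0 < min ε 1 := lt_min hε one_pos
  exact hyp (3 * min ε 1) (by linarith) (hypercliqueProblem_solvableInTime hk
    (fun n it a b hn hit => hshape _ (h n it a b hn hit)) (min_le_right _ _)
    (hs.mono (by linarith [min_le_left ε 1])))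

theorem mainTheorem8 (hyp : HypercliqueHypothesis) :
    (∀ α : ℝ, 0 < α → α < Real.pi / 4 → ∃ d : ℕ, ∀ ε : ℝ, 0 < ε →
      ¬ (diameterTwoProblem (IsFatTriangle α) d).SolvableInTime (2 - ε)) ∧
    (∀ δ : ℝ, 0 < δ → ∃ d : ℕ, ∀ ε : ℝ, 0 < ε →
      ¬ (diameterTwoProblem (IsHalfSquare δ) d).SolvableInTime (2 - ε)) := by
  refine ⟨fun α hα hα' => ?_, fun δ hδ => exists_not_solvableInTime hyp hδ fun _ h => h⟩
  obtain ⟨δ, hδ, h⟩ := exists_isFatTriangle_of_isHalfSquare hα hα'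
  exact exists_not_solvableInTime hyp hδ h
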